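/- Graphs are finite, simple, undirected, with positive integer edge-capacities; $n$ is the number of nodes, $m$ the number of edges. $\text{Max-Flow}_G(s,t)$ denotes the minimum total capacity of a cut separating $s$ from $t$, and a flow-equivalent tree of $G$ is a capacitated tree $T$ on the node set of $G$ with $\text{Max-Flow}_T(s,t)=\text{Max-Flow}_G(s,t)$ for all $s\ne t$. The model is the word RAM with words of at least $\kappa\log_2 n$ bits for a sufficiently large constant $\kappa$; randomized programs may draw uniform integers from $\{0,\dots,k-1\}$ in one step, and capacities are polynomially bounded, i.e. at most $n^b$ for a constant $b$. Let $\mathcal F$ be a family of capacitated graphs that is closed under perturbation of edge-capacities: whenever $(V,E,c)\in\mathcal F$, $K\ge 1$ and $r:E\to\{0,\dots,K-1\}$, also $(V,E,K\cdot c+r)\in\mathcal F$ (that is, $c+r/K$ scaled to integers). Suppose there is a deterministic Max-Flow data structure for $\mathcal F$ with running times $t_p,t_{mf}$: for every constant $b$, on the connected graphs in $\mathcal F$ with $n\ge 2$ nodes, $m$ edges and capacities at most $n^b$, it preprocesses the graph in time $O(t_p(m))$ and then answers every query for the value $\text{Max-Flow}_G(s,t)$, $s\neq t$, in time $O(t_{mf}(m))$.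 **Theorem.** For every constant $c$ there is a randomized algorithm with access to the data structure such that, for every constant $b$ and every connected $G\in\mathcal F$ with $n\ge 2$ nodes, $m$ edges and capacities at most $n^b$, with probability at least $1-n^{-c}$ it outputs a flow-equivalent tree of $G$, in total time (the time spent by the data structure included) $$O\big(t_p(m)+n\log n\cdot t_{mf}(m)+n\log^2 n\big),$$ using $O(n\log n)$ Max-Flow queries. The algorithm depends on $c$ only; the constants in $O(\cdot)$ and $\kappa$ may depend on $b$, $c$, $\mathcal F$ and the data structure, but not on $G$. -/

import Mathlib

namespace FlowTree

noncomputable section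

/-! ## Capacitated graphs, minimum cuts and flow-equivalent trees -/

/-- A simple undirected graph on the nodes `0, …, n - 1` with positive integer edge-capacities:
`cap u v` is the capacity of the edge `uv`, and `0` means that `uv` is not an edge. -/
structure CapGraph (n : ℕ) where
  cap : Fin n → Fin n → ℕ
  symm : ∀ u v, cap u v = cap v u
  loopless : ∀ u, cap u u = 0

namespace CapGraph

variable {n : ℕ}

/-- The underlying simple graph. -/
def graph (G : CapGraph n) : SimpleGraph (Fin n) where
  Adj u v := 0 < G.cap u v
  symm := ⟨fun u v h => by rw [G.symm v u]; exact h⟩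
  loopless := ⟨fun u h => by rw [G.loopless u] at h; exact lt_irrefl 0 h⟩

/-- The number `m` of edges. -/
def numEdges (G : CapGraph n) : ℕ := G.graph.edgeSet.ncard

/-- The total capacity of the edges between `S` and its complement. -/
def cutValue (G : CapGraph n) (S : Finset (Fin n)) : ℕ :=
  ∑ u ∈ S, ∑ v ∈ Sᶜ, G.cap u v

/-- `Max-Flow_G(s, t)`: the minimum value of a cut separating `s` from `t` (for `s ≠ t`). -/
def maxFlow (G : CapGraph n) (s t : Fin n) : ℕ :=
  sInf {x | ∃ S : Finset (Fin n), s ∈ S ∧ t ∉ S ∧ G.cutValue S = x}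

/-- `T` is a flow-equivalent tree of `G`: a capacitated tree on the same nodes with the same
Max-Flow values. -/
def IsFlowEquivalentTree (G T : CapGraph n) : Prop :=
  T.graph.IsTree ∧ ∀ s t : Fin n, s ≠ t → T.maxFlow s t = G.maxFlow s t

/-- The perturbation that adds `r u v / K` to the capacity of every edge `uv`, with all capacities
then scaled by `K` so that they stay integers. -/
def perturb (G : CapGraph n) (K : ℕ) (r : Fin n → Fin n → ℕ) (hr : ∀ u v, r u v = r v u) :
    CapGraph n where
  cap u v := if 0 < G.cap u v then K * G.cap u v + r u v else 0
  symm u v := by rw [G.symm u v, hr u v]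
  loopless u := by simp [G.loopless u]

/-- `L` lists every edge of `G` exactly once, in some order and with one of its two orientations,
together with its capacity. -/
def IsListing (G : CapGraph n) (L : List (Fin n × Fin n × ℕ)) : Prop :=
  (L.map fun e => s(e.1, e.2.1)).Nodup ∧
  (∀ u v, 0 < G.cap u v ↔ s(u, v) ∈ L.map fun e => s(e.1, e.2.1)) ∧
  ∀ e ∈ L, e.2.2 = G.cap e.1 e.2.1

end CapGraph

/-- The family `F` is closed under perturbation of edge-capacities: adding to the capacities
arbitrary fractions `r u v / K` in `[0, 1)` with a common denominator `K` (and scaling by `K`)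
does not leave the family. -/
def ClosedUnderPerturbation (F : ∀ n, Set (CapGraph n)) : Prop :=
  ∀ n, ∀ G ∈ F n, ∀ (K : ℕ) (r : Fin n → Fin n → ℕ) (hr : ∀ u v, r u v = r v u),
    (∀ u v, r u v < K) → G.perturb K r hr ∈ F n

/-! ## The word RAM

The memory consists of registers and of arrays, both named by natural numbers; a program is a
finite text and so can name only finitely many of them. All results of operations are reduced
modulo `2 ^ w`, where `w` is the word size, and every instruction and every test takes one step. -/

/-- The contents of the memory. -/
structure Mem where
  reg : ℕ → ℕ
  arr : ℕ → ℕ → ℕ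

namespace Mem

def setReg (σ : Mem) (d x : ℕ) : Mem := { σ with reg := Function.update σ.reg d x }

def setArr (σ : Mem) (a i x : ℕ) : Mem :=
  { σ with arr := Function.update σ.arr a (Function.update (σ.arr a) i x) }

/-- The empty memory. -/
def blank : Mem := ⟨fun _ => 0, fun _ _ => 0⟩

/-- The memory that holds just a listing `L` of a graph on `n` nodes: `n` and the number of edges
in registers `0` and `1`, the endpoints and the capacities of the edges in arrays `0`, `1`, `2`. -/
def input {n : ℕ} (L : List (Fin n × Fin n × ℕ)) : Mem where
  reg i := if i = 0 then n else if i = 1 then L.length else 0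
  arr a i :=
    if a = 0 then (L.map fun e => (e.1 : ℕ)).getD i 0
    else if a = 1 then (L.map fun e => (e.2.1 : ℕ)).getD i 0
    else if a = 2 then (L.map fun e => e.2.2).getD i 0
    else 0

/-- The memory contains the listing `L` in the same format, and possibly other things. -/
def Holds {n : ℕ} (σ : Mem) (L : List (Fin n × Fin n × ℕ)) : Prop :=
  σ.reg 0 = n ∧ σ.reg 1 = L.length ∧
  ∀ i (h : i < L.length),
    σ.arr 0 i = (L[i].1 : ℕ) ∧ σ.arr 1 i = (L[i].2.1 : ℕ) ∧ σ.arr 2 i = L[i].2.2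

/-- The part of the memory in which a graph is stored. -/
def graphPart (σ : Mem) : Mem where
  reg i := if i ≤ 1 then σ.reg i else 0
  arr a := if a ≤ 2 then σ.arr a else fun _ => 0

end Mem

/-- The binary word operations. -/
inductive Op
  | add | sub | mul | div | mod | lt | eq | and | or | xor | shl | shr

/-- Values of the word operations, before the reduction modulo `2 ^ w` (subtraction is
truncated at `0`, division by `0` gives `0`). -/
def Op.eval : Op → ℕ → ℕ → ℕ
  | .add, x, y => x + y
  | .sub, x, y => x - y
  | .mul, x, y => x * y
  | .div, x, y => x / y
  | .mod, x, y => x % y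
  | .lt, x, y => if x < y then 1 else 0
  | .eq, x, y => if x = y then 1 else 0
  | .and, x, y => Nat.land x y
  | .or, x, y => Nat.lor x y
  | .xor, x, y => Nat.xor x y
  | .shl, x, y => x <<< y
  | .shr, x, y => x >>> y

/-- The deterministic instructions. -/
inductive Instr
  /-- register `d` becomes the number `k` -/
  | const (d k : ℕ)
  /-- register `d` becomes the result of an operation on registers `x` and `y` -/
  | op (o : Op) (d x y : ℕ)
  /-- register `d` becomes the entry of array `a` whose index is in register `i` -/
  | load (d a i : ℕ)
  /-- the entry of array `a` whose index is in register `i` becomes the value of register `x` -/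
  | store (a i x : ℕ)

def Instr.step (w : ℕ) : Instr → Mem → Mem
  | .const d k, σ => σ.setReg d (k % 2 ^ w)
  | .op o d x y, σ => σ.setReg d (o.eval (σ.reg x) (σ.reg y) % 2 ^ w)
  | .load d a i, σ => σ.setReg d (σ.arr a (σ.reg i))
  | .store a i x, σ => σ.setArr a (σ.reg i) (σ.reg x)

/-! ### Deterministic programs and data structures -/

/-- Deterministic programs. -/
inductive Det
  | instr (i : Instr)
  | seq (p q : Det)
  /-- branch on whether register `x` is nonzero -/
  | ite (x : ℕ) (p q : Det)
  /-- repeat as long as register `x` is nonzero -/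
  | loop (x : ℕ) (p : Det)

/-- At most `fuel` tests of the loop "while register `x` is nonzero do `body`", on pairs of a memory
and a step count; `none` if the loop has not ended by then. -/
def Det.iter (x : ℕ) (body : Mem × ℕ → Option (Mem × ℕ)) : ℕ → Mem × ℕ → Option (Mem × ℕ)
  | 0, _ => none
  | fuel + 1, (σ, k) =>
    if σ.reg x = 0 then some (σ, k + 1)
    else (body (σ, k + 1)).bind (Det.iter x body fuel)

/-- Execution from a memory and a step count; `fuel` limits the length of each loop. -/
def Det.exec (w fuel : ℕ) : Det → Mem × ℕ → Option (Mem × ℕ)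
  | .instr i, (σ, k) => some (i.step w σ, k + 1)
  | .seq p q, s => (Det.exec w fuel p s).bind (Det.exec w fuel q)
  | .ite x p q, (σ, k) =>
    if σ.reg x = 0 then Det.exec w fuel q (σ, k + 1) else Det.exec w fuel p (σ, k + 1)
  | .loop x p, s => Det.iter x (Det.exec w fuel p) fuel s

/-- With word size `w`, the program `p` started in `σ` halts after exactly `k` steps in `σ'`. -/
def Det.Halts (w : ℕ) (p : Det) (σ σ' : Mem) (k : ℕ) : Prop :=
  ∃ fuel, p.exec w fuel (σ, 0) = some (σ', k)

/-- A deterministic data structure: a program for the preprocessing and one for the queries.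
The latter finds the queried pair in registers `0` and `1`, puts the answer into register `0`, and
works on the memory that the preprocessing and the earlier queries have left. -/
structure DataStructure where
  pre : Det
  qry : Det

/-- The memory of a data structure when it is asked the query `(s, t)`. -/
def askMem (σ : Mem) (s t : ℕ) : Mem := (σ.setReg 0 s).setReg 1 t

/-- `D` is a Max-Flow data structure for the family `F` with preprocessing time `tp` and query time
`tmf`, as functions of the number of edges. Capacities are polynomially bounded and words have
logarithmically many bits: for every exponent `b` there are `κ` and `C` such that for the connected
graphs in `F` with `n ≥ 2` nodes and capacities at most `n ^ b`, on words of at least `κ log₂ n` bits,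
the preprocessing takes at most `C * tp m` steps and thereafter, in any sequence of queries, each one
is answered correctly in at most `C * tmf m` steps. -/
def DataStructure.AnswersMaxFlow (D : DataStructure) (F : ∀ n, Set (CapGraph n))
    (tp tmf : ℕ → ℕ) : Prop :=
  ∀ b : ℕ, ∃ κ C : ℕ, ∀ n, 2 ≤ n → ∀ G ∈ F n, G.graph.Connected → (∀ u v, G.cap u v ≤ n ^ b) →
    ∀ L, G.IsListing L → ∀ w, n ^ κ ≤ 2 ^ w →
      ∃ Inv : Mem → Prop,
        (∃ σ k, D.pre.Halts w (Mem.input L) σ k ∧ k ≤ C * tp G.numEdges ∧ Inv σ) ∧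
        ∀ σ, Inv σ → ∀ s t : Fin n, s ≠ t →
          ∃ σ' k, D.qry.Halts w (askMem σ s t) σ' k ∧ k ≤ C * tmf G.numEdges ∧
            σ'.reg 0 = G.maxFlow s t ∧ Inv σ'

/-! ### Randomized programs with access to a data structure -/

/-- Randomized programs that can call a data structure. -/
inductive Prog
  | instr (i : Instr)
  /-- register `d` becomes a uniformly random element of `{0, …, k - 1}` (`0` if `k = 0`), where
  `k` is the value of register `x` -/
  | rand (d x : ℕ)
  /-- preprocess the graph that is stored in registers `0`, `1` and arrays `0`, `1`, `2` -/
  | preprocess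
  /-- register `d` becomes the answer to the query on the values of registers `x` and `y` -/
  | query (d x y : ℕ)
  | seq (p q : Prog)
  | ite (x : ℕ) (p q : Prog)
  | loop (x : ℕ) (p : Prog)

/-- A configuration: the memory of the program, the memory of the data structure (which the program
can access only through its calls), the number of steps taken so far, including those of the data
structure, and the number of queries made so far. -/
structure Config where
  mem : Mem
  ds : Mem
  time : ℕ
  queries : ℕ

/-- The configuration in which a program starts on the listing `L` of a graph. -/
def Config.start {n : ℕ} (L : List (Fin n × Fin n × ℕ)) : Config := ⟨Mem.input L, Mem.blank, 0, 0⟩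

/-- One more step is taken. -/
def Config.tick (τ : Config) : Config := { τ with time := τ.time + 1 }

/-- Sequential composition of random, possibly unfinished computations. -/
def andThen (μ : PMF (Option Config)) (f : Config → PMF (Option Config)) : PMF (Option Config) :=
  μ.bind fun o => o.elim (PMF.pure none) f

/-- At most `fuel` tests of the loop "while register `x` is nonzero do `body`". -/
def Prog.iter (x : ℕ) (body : Config → PMF (Option Config)) : ℕ → Config → PMF (Option Config)
  | 0, _ => PMF.pure none
  | fuel + 1, τ =>
    if τ.mem.reg x = 0 then PMF.pure (some τ.tick)
    else andThen (body τ.tick) (Prog.iter x body fuel)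

/-- The distribution of the final configuration, for programs with access to `D` on words of `w`
bits; `fuel` limits the length of each loop, and `none` stands for the runs that exceed it. The steps
of the data structure count towards the time. -/
def Prog.exec (D : DataStructure) (w fuel : ℕ) : Prog → Config → PMF (Option Config)
  | .instr i, τ => PMF.pure (some { τ.tick with mem := i.step w τ.mem })
  | .rand d x, τ =>
    (PMF.uniformOfFintype (Fin (τ.mem.reg x - 1 + 1))).map fun j =>
      some { τ.tick with mem := τ.mem.setReg d j }
  | .preprocess, τ =>
    PMF.pure ((D.pre.exec w fuel (τ.mem.graphPart, τ.time + 1)).map fun s =>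
      { τ with ds := s.1, time := s.2 })
  | .query d x y, τ =>
    PMF.pure ((D.qry.exec w fuel (askMem τ.ds (τ.mem.reg x) (τ.mem.reg y), τ.time + 1)).map fun s =>
      { mem := τ.mem.setReg d (s.1.reg 0), ds := s.1, time := s.2, queries := τ.queries + 1 })
  | .seq p q, τ => andThen (Prog.exec D w fuel p τ) (Prog.exec D w fuel q)
  | .ite x p q, τ =>
    if τ.mem.reg x = 0 then Prog.exec D w fuel q τ.tick else Prog.exec D w fuel p τ.tick
  | .loop x p, τ => Prog.iter x (Prog.exec D w fuel p) fuel τ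

end

end FlowTree

open FlowTree

namespace FlowTree

namespace CapGraph

variable {n : ℕ} (G : CapGraph n)

/-! ## Cuts -/

/-! Max-Flow values form an ultrametric (`min_le_maxFlow`), and the tree is grown while a partition
of the nodes is refined. In each round every class draws a pivot, the values between the pivot and
the members are queried, and the class is split by these values. Each new class other than the
pivot's own is joined to the pivot by an edge at its representative, weighted with the queried
value. By the ultrametric inequality, connections inside an old class can be rerouted through its
pivot without loss (`TreeInv.step`), so once all classes are singletons the edges form a
flow-equivalent tree (`TreeInv.isFlowEquivalentTree`).

Ties would make this slow: if all values in a class are equal, a pivot splits off only itself.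
Therefore the capacities are first scaled by `K` and perturbed at random. By the isolation lemma all
minimum cuts are then unique with high probability, and this excludes three nodes with pairwise
equal values (`UniqueMinCuts.noTies`). Now in every triple at most one node has equal values to the
other two, so a nearly uniform pivot leaves on average about a third of the colliding pairs
together, and the expected number of such pairs at least halves (`sum_collisions_le`). After
logarithmically many rounds Markov's inequality shows that no pair is likely to be left
(`main_loop`). The noise in a cut totals less than `K`, so division by `K` recovers the original
values (`perturb_maxFlow_div`).

A round makes at most `n` queries and linearly many further steps, as new classes are found in a
table addressed directly by value and label. Perturbing takes time proportional to `m`, a term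
absent from the bound. It is paid for by a lower bound (`lowerBound`): a deterministic data
structure that leaves some capacity unread cannot notice that it is lowered, although at most `n`
queries suffice to detect this. Hence `m` is at most of order `tp m + n * tmf m`. -/

theorem cutValue_compl (S : Finset (Fin n)) : G.cutValue Sᶜ = G.cutValue S := by
  unfold cutValue
  rw [compl_compl, Finset.sum_comm]
  exact Finset.sum_congr rfl fun u _ => Finset.sum_congr rfl fun v _ => G.symm v u

theorem maxFlow_le_cutValue {s t : Fin n} {S : Finset (Fin n)} (hs : s ∈ S) (ht : t ∉ S) :
    G.maxFlow s t ≤ G.cutValue S :=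
  Nat.sInf_le ⟨S, hs, ht, rfl⟩

theorem exists_minCut {s t : Fin n} (h : s ≠ t) :
    ∃ S : Finset (Fin n), s ∈ S ∧ t ∉ S ∧ G.cutValue S = G.maxFlow s t := by
  have : (G.cutValue {s}) ∈ {x | ∃ S : Finset (Fin n), s ∈ S ∧ t ∉ S ∧ G.cutValue S = x} :=
    ⟨{s}, by simp, by simpa using h.symm, rfl⟩
  exact Nat.sInf_mem ⟨_, this⟩

/-- No cut separates a node from itself, and `sInf ∅ = 0`. Together with `maxFlow_pos`, the value 0
thus singles out the pivot within its class. -/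
theorem maxFlow_self (s : Fin n) : G.maxFlow s s = 0 := by
  have : {x | ∃ S : Finset (Fin n), s ∈ S ∧ s ∉ S ∧ G.cutValue S = x} = ∅ := by
    ext x; simp only [Set.mem_ofPred_eq, Set.mem_empty_iff_false, iff_false]; tauto
  rw [maxFlow, this, Nat.sInf_empty]

theorem maxFlow_comm (s t : Fin n) : G.maxFlow s t = G.maxFlow t s := by
  have key : ∀ s t : Fin n, s ≠ t → G.maxFlow s t ≤ G.maxFlow t s := by
    intro s t h
    obtain ⟨S, h1, h2, h3⟩ := G.exists_minCut h.symm
    rw [← h3, ← cutValue_compl]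
    exact G.maxFlow_le_cutValue (by simpa using h2) (by simpa using h1)
  rcases eq_or_ne s t with rfl | h
  · rfl
  · exact le_antisymm (key s t h) (key t s h.symm)

/-- The ultrametric inequality: a minimum cut between `u` and `w` has `v` on one side, so it also
separates `v` from `u` or from `w`. The case `u = w` is excluded because the diagonal is 0. -/
theorem min_le_maxFlow {u w : Fin n} (v : Fin n) (h : u ≠ w) :
    min (G.maxFlow u v) (G.maxFlow v w) ≤ G.maxFlow u w := by
  obtain ⟨S, h1, h2, h3⟩ := G.exists_minCut h
  rw [← h3]
  by_cases hv : v ∈ S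
  · exact min_le_of_right_le (G.maxFlow_le_cutValue hv h2)
  · exact min_le_of_left_le (G.maxFlow_le_cutValue h1 hv)

theorem cap_le_cutValue {s t : Fin n} {S : Finset (Fin n)} (hs : s ∈ S) (ht : t ∉ S) :
    G.cap s t ≤ G.cutValue S := by
  unfold cutValue
  calc G.cap s t ≤ ∑ v ∈ Sᶜ, G.cap s v :=
        Finset.single_le_sum (f := fun v => G.cap s v) (fun _ _ => Nat.zero_le _) (by simpa using ht)
    _ ≤ _ := Finset.single_le_sum (f := fun u => ∑ v ∈ Sᶜ, G.cap u v)
        (fun _ _ => Nat.zero_le _) hs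

theorem sum_cut_le {f : Fin n → Fin n → ℕ} {M : ℕ} (h : ∀ u v, f u v ≤ M)
    (S T : Finset (Fin n)) : ∑ u ∈ S, ∑ v ∈ T, f u v ≤ n * n * M := by
  calc ∑ u ∈ S, ∑ v ∈ T, f u v ≤ ∑ u ∈ S, ∑ v ∈ T, M :=
        Finset.sum_le_sum fun u _ => Finset.sum_le_sum fun v _ => h u v
    _ = S.card * (T.card * M) := by simp
    _ ≤ n * (n * M) := by
        gcongr
        · simpa using S.card_le_univ
        · simpa using T.card_le_univ
    _ = _ := by ring

theorem cutValue_le {M : ℕ} (h : ∀ u v, G.cap u v ≤ M) (S : Finset (Fin n)) :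
    G.cutValue S ≤ n * n * M :=
  sum_cut_le h _ _

theorem maxFlow_le {M : ℕ} (h : ∀ u v, G.cap u v ≤ M) (s t : Fin n) :
    G.maxFlow s t ≤ n * n * M := by
  rcases eq_or_ne s t with rfl | hst
  · rw [maxFlow_self]; exact Nat.zero_le _
  · obtain ⟨S, -, -, h3⟩ := G.exists_minCut hst
    rw [← h3]; exact G.cutValue_le h S

variable {G}

theorem exists_adj_of_connected (hG : G.graph.Connected) {S : Finset (Fin n)} {s t : Fin n}
    (hs : s ∈ S) (ht : t ∉ S) : ∃ u ∈ S, ∃ v ∉ S, 0 < G.cap u v := by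
  obtain ⟨p⟩ := hG.preconnected s t
  obtain ⟨d, -, h1, h2⟩ := p.exists_boundary_dart (S : Set (Fin n)) hs ht
  exact ⟨d.fst, h1, d.snd, h2, d.adj⟩

theorem maxFlow_pos (hG : G.graph.Connected) {s t : Fin n} (h : s ≠ t) : 0 < G.maxFlow s t := by
  obtain ⟨S, h1, h2, h3⟩ := G.exists_minCut h
  obtain ⟨u, hu, v, hv, huv⟩ := exists_adj_of_connected hG h1 h2
  rw [← h3]
  exact huv.trans_le (G.cap_le_cutValue hu hv)

/-! ## Perturbations -/

section perturb

variable {K : ℕ} {r : Fin n → Fin n → ℕ} {hr : ∀ u v, r u v = r v u}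

theorem perturb_graph (hK : 0 < K) : (G.perturb K r hr).graph = G.graph := by
  ext u v
  simp only [graph, perturb]
  constructor
  · intro h
    by_contra h0
    simp [h0] at h
  · intro h
    rw [if_pos h]
    positivity

theorem perturb_numEdges (hK : 0 < K) : (G.perturb K r hr).numEdges = G.numEdges := by
  rw [numEdges, numEdges, perturb_graph hK]

theorem mul_cap_le_perturb (u v : Fin n) : K * G.cap u v ≤ (G.perturb K r hr).cap u v := by
  simp only [perturb]
  split_ifs with h
  · omega
  · simp [Nat.eq_zero_of_not_pos h]

theorem perturb_cap_le (u v : Fin n) : (G.perturb K r hr).cap u v ≤ K * G.cap u v + r u v := by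
  simp only [perturb]
  split_ifs with h <;> omega

theorem mul_cutValue_le_perturb (S : Finset (Fin n)) :
    K * G.cutValue S ≤ (G.perturb K r hr).cutValue S := by
  simp only [cutValue, Finset.mul_sum]
  exact Finset.sum_le_sum fun u _ => Finset.sum_le_sum fun v _ => mul_cap_le_perturb u v

/-- A cut has at most `n * n` ordered pairs, each with noise at most `R - 1`, so the total noise
stays below one scaled unit. -/
theorem perturb_cutValue_lt {R : ℕ} (hn : 0 < n) (hR : ∀ u v, r u v < R) (hK : n * n * R ≤ K)
    (S : Finset (Fin n)) : (G.perturb K r hr).cutValue S < K * G.cutValue S + K := by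
  have hR0 : 0 < R := (Nat.zero_le _).trans_lt (hR ⟨0, hn⟩ ⟨0, hn⟩)
  have h1 : (G.perturb K r hr).cutValue S ≤ K * G.cutValue S + ∑ u ∈ S, ∑ v ∈ Sᶜ, r u v := by
    simp only [cutValue, Finset.mul_sum, ← Finset.sum_add_distrib]
    exact Finset.sum_le_sum fun u _ => Finset.sum_le_sum fun v _ => perturb_cap_le u v
  have h2 : ∑ u ∈ S, ∑ v ∈ Sᶜ, r u v ≤ n * n * (R - 1) :=
    sum_cut_le (fun u v => Nat.le_sub_one_of_lt (hR u v)) _ _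
  have h3 : n * n * (R - 1) < n * n * R :=
    Nat.mul_lt_mul_of_pos_left (by omega) (by positivity)
  omega

/-- Small perturbations do not change the integer part of the Max-Flow values. -/
theorem perturb_maxFlow_div {R : ℕ} (hn : 0 < n) (hR : ∀ u v, r u v < R) (hK : n * n * R ≤ K)
    {s t : Fin n} (h : s ≠ t) : (G.perturb K r hr).maxFlow s t / K = G.maxFlow s t := by
  -- The lower bound uses a minimum cut of the perturbed graph, the upper bound one of the original
  -- graph.
  apply Nat.div_eq_of_lt_le
  · obtain ⟨S, h1, h2, h3⟩ := (G.perturb K r hr).exists_minCut h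
    rw [← h3, mul_comm]
    exact (Nat.mul_le_mul_left K (G.maxFlow_le_cutValue h1 h2)).trans (mul_cutValue_le_perturb S)
  · obtain ⟨S, h1, h2, h3⟩ := G.exists_minCut h
    rw [← h3]
    refine ((G.perturb K r hr).maxFlow_le_cutValue h1 h2).trans_lt ?_
    have := perturb_cutValue_lt (G := G) (hr := hr) hn hR hK S
    linarith

end perturb

/-! ## Listings -/

theorem IsListing.length_eq {L : List (Fin n × Fin n × ℕ)} (h : G.IsListing L) :
    L.length = G.numEdges := by
  classical
  have h1 : G.graph.edgeSet = ((L.map fun e => s(e.1, e.2.1)).toFinset : Set (Sym2 (Fin n))) := by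
    ext e
    induction e with
    | _ u v =>
      rw [SimpleGraph.mem_edgeSet]
      simp only [List.coe_toFinset, Set.mem_ofPred_eq]
      exact h.2.1 u v
  rw [numEdges, h1, Set.ncard_coe_finset, List.toFinset_card_of_nodup h.1, List.length_map]

theorem numEdges_le : G.numEdges ≤ n * n := by
  classical
  let φ : Sym2 (Fin n) → Fin n × Fin n := Quot.out
  have hinj : Function.Injective φ := fun a b hab => by
    rw [← Quot.out_eq a, ← Quot.out_eq b]; exact congrArg _ hab
  have := Nat.card_le_card_of_injective (fun e : G.graph.edgeSet => φ e.1)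
    (fun a b hab => Subtype.ext (hinj hab))
  calc G.numEdges = Nat.card G.graph.edgeSet := (Nat.card_coe_set_eq _).symm
    _ ≤ Nat.card (Fin n × Fin n) := this
    _ = n * n := by simp

end CapGraph

/-! ## The isolation lemma -/

section isolation

variable {ι : Type*} {m : ℕ}

/-- The weight of the object `S` with base weight `a S` and ground set `X S`. -/
def isoWeight (a : ι → ℕ) (X : ι → Finset (Fin m)) (ρ : Fin m → ℕ) (S : ι) : ℕ :=
  a S + ∑ i ∈ X S, ρ i

def IsMinimizer (P : ι → Prop) (w : ι → ℕ) (S : ι) : Prop :=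
  P S ∧ ∀ T, P T → w S ≤ w T

theorem isoWeight_of_eq_off {a : ι → ℕ} {X : ι → Finset (Fin m)} {ρ ρ' : Fin m → ℕ} {i : Fin m}
    (h : ∀ j, j ≠ i → ρ j = ρ' j) (S : ι) :
    (i ∉ X S → isoWeight a X ρ S = isoWeight a X ρ' S) ∧
    (i ∈ X S → isoWeight a X ρ S + ρ' i = isoWeight a X ρ' S + ρ i) := by
  constructor
  · intro hi
    unfold isoWeight
    rw [Finset.sum_congr rfl fun j hj => h j (fun e => hi (e ▸ hj))]
  · intro hi
    unfold isoWeight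
    rw [← Finset.add_sum_erase _ _ hi, ← Finset.add_sum_erase _ ρ' hi,
      Finset.sum_congr rfl fun j hj => h j (Finset.ne_of_mem_erase hj)]
    ring

/-- The weight of a ground element that separates two minimizers is determined by the others. -/
theorem isolation_le {P : ι → Prop} {a : ι → ℕ} {X : ι → Finset (Fin m)} {ρ ρ' : Fin m → ℕ}
    {i : Fin m} (h : ∀ j, j ≠ i → ρ j = ρ' j)
    (h1 : ∃ A B, IsMinimizer P (isoWeight a X ρ) A ∧ IsMinimizer P (isoWeight a X ρ) B ∧
      i ∈ X A ∧ i ∉ X B)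
    (h2 : ∃ A B, IsMinimizer P (isoWeight a X ρ') A ∧ IsMinimizer P (isoWeight a X ρ') B ∧
      i ∈ X A ∧ i ∉ X B) : ρ' i ≤ ρ i := by
  obtain ⟨A, B, hA, hB, hiA, hiB⟩ := h1
  obtain ⟨A', B', hA', hB', hiA', hiB'⟩ := h2
  -- The cheapest object avoiding `i` costs the same under both weights, and so does the cheapest
  -- one containing `i`, up to the weight of `i` itself. A tie between the two kinds fixes that
  -- weight.
  have e1 := hA.2 A' hA'.1
  have e2 := hB.2 B' hB'.1
  have e3 := hA.2 B hB.1
  have e4 := hB.2 A hA.1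
  have e5 := hA'.2 B' hB'.1
  have e6 := hB'.2 B hB.1
  have e7 := hB'.2 A' hA'.1
  have w1 := (isoWeight_of_eq_off (a := a) h A').2 hiA'
  have w2 := (isoWeight_of_eq_off (a := a) h B).1 hiB
  have w3 := (isoWeight_of_eq_off (a := a) h B').1 hiB'
  omega

open Classical in
/-- The weights for which the ground element `i` separates two minimizers. -/
noncomputable def ambiguous (P : ι → Prop) (a : ι → ℕ) (X : ι → Finset (Fin m)) (R : ℕ)
    (i : Fin m) : Finset (Fin m → Fin R) :=
  Finset.univ.filter fun ρ => ∃ A B,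
      IsMinimizer P (isoWeight a X fun j => ρ j) A ∧
      IsMinimizer P (isoWeight a X fun j => ρ j) B ∧ i ∈ X A ∧ i ∉ X B

theorem mem_ambiguous {P : ι → Prop} {a : ι → ℕ} {X : ι → Finset (Fin m)} {R : ℕ}
    {i : Fin m} {ρ : Fin m → Fin R} : ρ ∈ ambiguous P a X R i ↔ ∃ A B,
      IsMinimizer P (isoWeight a X fun j => ρ j) A ∧
      IsMinimizer P (isoWeight a X fun j => ρ j) B ∧ i ∈ X A ∧ i ∉ X B := by
  simp [ambiguous]

/-- Overwriting coordinate `i` by an arbitrary value is injective on ambiguous weights, since by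
`isolation_le` the lost coordinate is determined by the others. So a fraction of at most `1 / R` is
ambiguous. -/
theorem card_ambiguous (P : ι → Prop) (a : ι → ℕ) (X : ι → Finset (Fin m)) (R : ℕ) (i : Fin m) :
    (ambiguous P a X R i).card * R ≤ R ^ m := by
  calc (ambiguous P a X R i).card * R = (ambiguous P a X R i ×ˢ (Finset.univ : Finset (Fin R))).card := by
        rw [Finset.card_product]; simp
    _ ≤ (Finset.univ : Finset (Fin m → Fin R)).card := by
        apply Finset.card_le_card_of_injOn (fun q => Function.update q.1 i q.2)
          (fun _ _ => Finset.mem_univ _)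
        rintro ⟨ρ, x⟩ h1 ⟨ρ', x'⟩ h2 h
        simp only [Finset.coe_product, Set.mem_prod, Finset.mem_coe, mem_ambiguous,
          Finset.coe_univ, Set.mem_univ, and_true] at h1 h2
        have hx : x = x' := by simpa using congrFun h i
        have hoff : ∀ j, j ≠ i → ρ j = ρ' j := fun j hj => by simpa [hj] using congrFun h j
        have hi : ρ i = ρ' i := by
          apply Fin.ext
          exact le_antisymm
            (isolation_le (fun j hj => congrArg Fin.val (hoff j hj).symm) h2 h1)
            (isolation_le (fun j hj => congrArg Fin.val (hoff j hj)) h1 h2)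
        have : ρ = ρ' := funext fun j => by
          by_cases hj : j = i
          · rw [hj, hi]
          · exact hoff j hj
        rw [hx, this]
    _ = R ^ m := by simp

end isolation

/-! ### Minimum cuts made unique by random capacities. -/

namespace CapGraph

variable {n : ℕ} {G : CapGraph n}

/-- The perturbation with the value `ρ i` for the `i`-th edge of `L`. -/
def noise (L : List (Fin n × Fin n × ℕ)) (ρ : Fin L.length → ℕ) (u v : Fin n) : ℕ :=
  ∑ i : Fin L.length, if s(u, v) = s(L[i].1, L[i].2.1) then ρ i else 0

theorem noise_comm (L : List (Fin n × Fin n × ℕ)) (ρ : Fin L.length → ℕ) (u v : Fin n) :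
    noise L ρ u v = noise L ρ v u := by
  unfold noise
  rw [Sym2.eq_swap]

theorem IsListing.edge_inj {L : List (Fin n × Fin n × ℕ)} (hL : G.IsListing L)
    {i j : Fin L.length} (h : s(L[i].1, L[i].2.1) = s(L[j].1, L[j].2.1)) : i = j := by
  have h1 := hL.1
  rw [List.nodup_iff_injective_get] at h1
  have : (⟨i, by simp⟩ : Fin (L.map fun e => s(e.1, e.2.1)).length) = ⟨j, by simp⟩ :=
    h1 (by simpa using h)
  exact Fin.ext (by simpa using this)

theorem IsListing.exists_index {L : List (Fin n × Fin n × ℕ)} (hL : G.IsListing L)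
    {u v : Fin n} (h : 0 < G.cap u v) : ∃ i : Fin L.length, s(u, v) = s(L[i].1, L[i].2.1) := by
  have := (hL.2.1 u v).1 h
  obtain ⟨e, he, h2⟩ := List.mem_map.1 this
  obtain ⟨i, hi, rfl⟩ := List.mem_iff_getElem.1 he
  exact ⟨⟨i, hi⟩, h2.symm⟩

theorem IsListing.cap_pos {L : List (Fin n × Fin n × ℕ)} (hL : G.IsListing L)
    (i : Fin L.length) : 0 < G.cap L[i].1 L[i].2.1 :=
  (hL.2.1 _ _).2 (List.mem_map.2 ⟨L[i], List.getElem_mem _, rfl⟩)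

theorem IsListing.noise_getElem {L : List (Fin n × Fin n × ℕ)} (hL : G.IsListing L)
    (ρ : Fin L.length → ℕ) (i : Fin L.length) : noise L ρ L[i].1 L[i].2.1 = ρ i := by
  unfold noise
  rw [Finset.sum_eq_single i]
  · simp
  · intro j _ hj
    rw [if_neg]
    intro h
    exact hj (hL.edge_inj h).symm
  · simp

theorem IsListing.noise_eq_zero {L : List (Fin n × Fin n × ℕ)} (hL : G.IsListing L)
    (ρ : Fin L.length → ℕ) {u v : Fin n} (h : ¬ 0 < G.cap u v) : noise L ρ u v = 0 := by
  unfold noise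
  apply Finset.sum_eq_zero
  intro i _
  rw [if_neg]
  intro h'
  exact h ((hL.2.1 u v).2 (h' ▸ List.mem_map.2 ⟨L[i], List.getElem_mem _, rfl⟩))

theorem IsListing.noise_lt {L : List (Fin n × Fin n × ℕ)} (hL : G.IsListing L)
    {ρ : Fin L.length → ℕ} {R : ℕ} (hR : 0 < R) (hρ : ∀ i, ρ i < R) (u v : Fin n) :
    noise L ρ u v < R := by
  by_cases h : 0 < G.cap u v
  · obtain ⟨i, hi⟩ := hL.exists_index h
    have : noise L ρ u v = noise L ρ L[i].1 L[i].2.1 := by unfold noise; rw [hi]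
    rw [this, hL.noise_getElem]
    exact hρ i
  · rw [hL.noise_eq_zero ρ h]
    exact hR

/-- The perturbed graph. -/
def shake (G : CapGraph n) (L : List (Fin n × Fin n × ℕ)) (K : ℕ) (ρ : Fin L.length → ℕ) :
    CapGraph n :=
  G.perturb K (noise L ρ) (noise_comm L ρ)

theorem IsListing.shake_cap {L : List (Fin n × Fin n × ℕ)} (hL : G.IsListing L) (K : ℕ)
    (ρ : Fin L.length → ℕ) (u v : Fin n) :
    (G.shake L K ρ).cap u v = K * G.cap u v + noise L ρ u v := by
  simp only [shake, perturb]
  split_ifs with h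
  · rfl
  · rw [hL.noise_eq_zero ρ h, Nat.eq_zero_of_not_pos h]; simp

/-- The indices of the edges that cross a cut. -/
def crossing (L : List (Fin n × Fin n × ℕ)) (S : Finset (Fin n)) : Finset (Fin L.length) :=
  Finset.univ.filter fun i => ¬ (L[i].1 ∈ S ↔ L[i].2.1 ∈ S)

/-- The double sum runs over ordered pairs leaving `S`, so at most one orientation of an edge occurs
in it. This serves both for the noise of a cut and for the only tree edge that leaves a side of the
tree. -/
theorem sum_indicator_cut {a b : Fin n} (hab : a ≠ b) (x : ℕ) (S : Finset (Fin n)) :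
    ∑ u ∈ S, ∑ v ∈ Sᶜ, (if s(u, v) = s(a, b) then x else 0) =
      if ¬ (a ∈ S ↔ b ∈ S) then x else 0 := by
  have h1 : ∀ u v : Fin n, (if s(u, v) = s(a, b) then x else 0) =
      (if u = a then if v = b then x else 0 else 0) +
      (if u = b then if v = a then x else 0 else 0) := by
    intro u v
    simp only [Sym2.eq_iff]
    by_cases h1 : u = a <;> by_cases h2 : v = b <;> by_cases h3 : u = b <;>
      by_cases h4 : v = a <;> simp_all
  simp only [h1, Finset.sum_add_distrib]
  have h2 : ∀ a b : Fin n, ∑ u ∈ S, ∑ v ∈ Sᶜ, (if u = a then if v = b then x else 0 else 0) =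
      if a ∈ S ∧ b ∉ S then x else 0 := by
    intro a b
    have : ∀ u : Fin n, ∑ v ∈ Sᶜ, (if u = a then if v = b then x else 0 else 0) =
        if u = a then if b ∉ S then x else 0 else 0 := by
      intro u
      split_ifs <;> simp_all
    simp only [this, Finset.sum_ite_eq']
    split_ifs <;> simp_all
  rw [h2, h2]
  by_cases ha : a ∈ S <;> by_cases hb : b ∈ S <;> simp [ha, hb]

/-- Cuts become the objects of the isolation lemma, with the crossing edges as ground set. -/
theorem IsListing.shake_cutValue {L : List (Fin n × Fin n × ℕ)} (hL : G.IsListing L) (K : ℕ)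
    (ρ : Fin L.length → ℕ) (S : Finset (Fin n)) :
    (G.shake L K ρ).cutValue S = isoWeight (fun S => K * G.cutValue S) (crossing L) ρ S := by
  have h1 : (G.shake L K ρ).cutValue S =
      K * G.cutValue S + ∑ u ∈ S, ∑ v ∈ Sᶜ, noise L ρ u v := by
    simp only [cutValue, hL.shake_cap, Finset.sum_add_distrib, Finset.mul_sum]
  have h2 : ∑ u ∈ S, ∑ v ∈ Sᶜ, noise L ρ u v = ∑ i : Fin L.length, ∑ u ∈ S, ∑ v ∈ Sᶜ,
      (if s(u, v) = s(L[i].1, L[i].2.1) then ρ i else 0) := by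
    unfold noise
    rw [Finset.sum_comm]
    rw [Finset.sum_congr rfl fun u _ => Finset.sum_comm]
    rw [Finset.sum_comm]
    rw [Finset.sum_congr rfl fun u _ => Finset.sum_comm]
  rw [h1, h2, isoWeight, crossing, Finset.sum_filter]
  congr 1
  refine Finset.sum_congr rfl fun i _ => ?_
  apply sum_indicator_cut
  intro h
  have := hL.cap_pos i
  rw [h, G.loopless] at this
  omega

/-- The set of nodes on which `A` and `B` agree contains `s` but is not everything. By connectivity
an edge leaves it, and such an edge crosses exactly one of the two cuts. -/
theorem IsListing.exists_separating {L : List (Fin n × Fin n × ℕ)} (hL : G.IsListing L)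
    (hG : G.graph.Connected) {s : Fin n} {A B : Finset (Fin n)} (hA : s ∈ A) (hB : s ∈ B)
    (h : A ≠ B) : ∃ i, ¬ (i ∈ crossing L A ↔ i ∈ crossing L B) := by
  obtain ⟨t, ht⟩ : ∃ t, ¬ (t ∈ A ↔ t ∈ B) := by
    by_contra hc
    push Not at hc
    exact h (Finset.ext hc)
  obtain ⟨u, hu, v, hv, huv⟩ := exists_adj_of_connected hG
    (S := Finset.univ.filter fun x => (x ∈ A ↔ x ∈ B)) (s := s) (t := t)
    (by simp [hA, hB]) (by simpa using ht)
  simp only [Finset.mem_filter, Finset.mem_univ, true_and] at hu hv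
  obtain ⟨i, hi⟩ := hL.exists_index huv
  refine ⟨i, ?_⟩
  simp only [crossing, Finset.mem_filter, Finset.mem_univ, true_and]
  rcases Sym2.eq_iff.1 hi with ⟨h1, h2⟩ | ⟨h1, h2⟩
  · rw [← h1, ← h2]; tauto
  · rw [← h1, ← h2]; tauto

/-- No three nodes have pairwise the same Max-Flow values. -/
def NoTies (G : CapGraph n) : Prop :=
  ∀ p u v : Fin n, p ≠ u → p ≠ v → u ≠ v → G.maxFlow p u = G.maxFlow p v →
    G.maxFlow u v ≠ G.maxFlow p u

def UniqueMinCuts (G : CapGraph n) : Prop :=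
  ∀ s t : Fin n, s ≠ t → ∀ A B : Finset (Fin n), s ∈ A → t ∉ A → s ∈ B → t ∉ B →
    G.cutValue A = G.maxFlow s t → G.cutValue B = G.maxFlow s t → A = B

/-- If three values agree, a minimum cut with `u` and `p` against `v` is minimum for both `(u, v)`
and `(p, v)`. A minimum cut between `u` and `p` has `v` on one side, so it is minimum for one of
these pairs too, but it is a different cut. -/
theorem UniqueMinCuts.noTies (h : G.UniqueMinCuts) : G.NoTies := by
  intro p u v hpu hpv huv h1 h2
  have key : ∀ u v : Fin n, p ≠ u → p ≠ v → u ≠ v → G.maxFlow p u = G.maxFlow p v →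
      G.maxFlow u v = G.maxFlow p u → ∀ S : Finset (Fin n), u ∈ S → v ∉ S →
      G.cutValue S = G.maxFlow u v → p ∈ S → False := by
    intro u v hpu hpv huv h1 h2 S hu hv hS hp
    obtain ⟨S', a1, a2, a3⟩ := G.exists_minCut hpu.symm
    have a4 := G.maxFlow_comm p u
    by_cases hv' : v ∈ S'
    · have := h p v hpv S S'ᶜ hp hv (by simpa using a2) (by simpa using hv') (by omega)
        (by rw [cutValue_compl]; omega)
      rw [this] at hu
      simp [a1] at hu
    · have := h u v huv S S' hu hv a1 hv' (by omega) (by omega)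
      rw [this] at hp
      exact a2 hp
  obtain ⟨S, a1, a2, a3⟩ := G.exists_minCut huv
  by_cases hp : p ∈ S
  · exact key u v hpu hpv huv h1 h2 S a1 a2 a3 hp
  · refine key v u hpv hpu huv.symm h1.symm ?_ Sᶜ (by simpa using a2) (by simpa using a1) ?_
      (by simpa using hp)
    · rw [maxFlow_comm]; omega
    · rw [cutValue_compl, a3, maxFlow_comm]

theorem isMinimizer_of_minCut {A : Finset (Fin n)} {s t : Fin n} (hs : s ∈ A) (ht : t ∉ A)
    (h : G.cutValue A = G.maxFlow s t) :
    IsMinimizer (fun S : Finset (Fin n) => s ∈ S ∧ t ∉ S) G.cutValue A :=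
  ⟨⟨hs, ht⟩, fun _ hT => h ▸ G.maxFlow_le_cutValue hT.1 hT.2⟩

open Classical in
/-- Random perturbations make ties unlikely. -/
theorem IsListing.card_not_noTies {L : List (Fin n × Fin n × ℕ)} (hL : G.IsListing L)
    (hG : G.graph.Connected) (K R : ℕ) :
    (Finset.univ.filter fun ρ : Fin L.length → Fin R =>
      ¬ (G.shake L K fun i => ρ i).NoTies).card * R ≤ n * n * L.length * R ^ L.length := by
  -- Union bound over all pairs of nodes and all edges: two minimum cuts for a pair make some edge
  -- ambiguous for that pair.
  let bad (q : (Fin n × Fin n) × Fin L.length) : Finset (Fin L.length → Fin R) :=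
    ambiguous (fun S : Finset (Fin n) => q.1.1 ∈ S ∧ q.1.2 ∉ S) (fun S => K * G.cutValue S)
      (crossing L) R q.2
  have hsub : (Finset.univ.filter fun ρ : Fin L.length → Fin R =>
      ¬ (G.shake L K fun i => ρ i).NoTies) ⊆ Finset.univ.biUnion bad := by
    intro ρ hρ
    simp only [Finset.mem_filter, Finset.mem_univ, true_and] at hρ
    have h1 : ¬ (G.shake L K fun i => ρ i).UniqueMinCuts := fun h => hρ h.noTies
    unfold UniqueMinCuts at h1
    push Not at h1
    obtain ⟨s, t, -, A, B, hsA, htA, hsB, htB, hA, hB, hAB⟩ := h1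
    have e : (G.shake L K fun i => ρ i).cutValue =
        isoWeight (fun S => K * G.cutValue S) (crossing L) fun j => (ρ j : ℕ) :=
      funext fun S => hL.shake_cutValue K _ S
    have mA := isMinimizer_of_minCut hsA htA hA
    have mB := isMinimizer_of_minCut hsB htB hB
    rw [e] at mA mB
    obtain ⟨i, hi⟩ := hL.exists_separating hG hsA hsB hAB
    simp only [Finset.mem_biUnion, Finset.mem_univ, true_and, bad, mem_ambiguous]
    by_cases hiA : i ∈ crossing L A
    · exact ⟨((s, t), i), A, B, mA, mB, hiA, by tauto⟩
    · exact ⟨((s, t), i), B, A, mB, mA, by tauto, hiA⟩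
  calc _ ≤ (∑ q, (bad q).card) * R :=
        Nat.mul_le_mul_right _ ((Finset.card_le_card hsub).trans Finset.card_biUnion_le)
    _ = ∑ q, (bad q).card * R := Finset.sum_mul _ _ _
    _ ≤ ∑ _q : (Fin n × Fin n) × Fin L.length, R ^ L.length :=
        Finset.sum_le_sum fun q _ => card_ambiguous _ _ _ _ _
    _ = _ := by simp

end CapGraph

/-! ## Partitions refined by random pivots -/

section refinement

variable {n : ℕ}

/-- The number of nodes with label `l`. -/
def classSize (lab : Fin n → Fin n) (l : Fin n) : ℕ :=
  (Finset.univ.filter fun u => lab u = l).card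

/-- The number of later nodes with the same label. -/
def rankIn (lab : Fin n → Fin n) (v : Fin n) : ℕ :=
  (Finset.univ.filter fun u => v < u ∧ lab u = lab v).card

/-- The random number `x` selects `p` as the pivot of its class. -/
def IsPivot (lab : Fin n → Fin n) (x : ℕ) (p : Fin n) : Prop :=
  x % classSize lab (lab p) = rankIn lab p

/-- One round of refinement: every class of `lab` is split according to the values `f p v`, where
`p` is the pivot of the class. -/
structure Refines (f : Fin n → Fin n → ℕ) (x : ℕ) (lab lab' piv : Fin n → Fin n) : Prop where
  lab_piv : ∀ v, lab (piv (lab v)) = lab v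
  isPivot : ∀ v, IsPivot lab x (piv (lab v))
  eq_iff : ∀ u v, lab' u = lab' v ↔ lab u = lab v ∧ f (piv (lab u)) u = f (piv (lab v)) v
  idem : ∀ v, lab' (lab' v) = lab' v

/-- The number of pairs of distinct nodes with the same label. -/
def collisions (lab : Fin n → Fin n) : ℕ :=
  ∑ u, ∑ v, if u ≠ v ∧ lab u = lab v then 1 else 0

theorem collisions_le (lab : Fin n → Fin n) : collisions lab ≤ n * n := by
  have := CapGraph.sum_cut_le (n := n) (M := 1)
    (f := fun u v => if u ≠ v ∧ lab u = lab v then 1 else 0)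
    (fun u v => by split_ifs <;> simp) Finset.univ Finset.univ
  simpa [collisions] using this

theorem injective_of_collisions {lab : Fin n → Fin n} (h : collisions lab = 0) :
    Function.Injective lab := by
  intro u v huv
  by_contra hne
  unfold collisions at h
  rw [Finset.sum_eq_zero_iff] at h
  have h1 := h u (Finset.mem_univ _)
  rw [Finset.sum_eq_zero_iff] at h1
  have h2 := h1 v (Finset.mem_univ _)
  simp [hne, huv] at h2

theorem rankIn_lt_classSize (lab : Fin n → Fin n) (v : Fin n) :
    rankIn lab v < classSize lab (lab v) := by
  apply Finset.card_lt_card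
  refine ⟨fun u hu => ?_, fun h => ?_⟩
  · simp only [Finset.mem_filter, Finset.mem_univ, true_and] at hu ⊢
    exact hu.2
  · have := h (show v ∈ Finset.univ.filter fun u => lab u = lab v by simp)
    simp at this

theorem rankIn_injOn {lab : Fin n → Fin n} {u v : Fin n} (h : lab u = lab v)
    (hr : rankIn lab u = rankIn lab v) : u = v := by
  have key : ∀ u v : Fin n, lab u = lab v → u < v → rankIn lab v < rankIn lab u := by
    intro u v h huv
    apply Finset.card_lt_card
    refine ⟨fun w hw => ?_, fun h' => ?_⟩
    · simp only [Finset.mem_filter, Finset.mem_univ, true_and] at hw ⊢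
      exact ⟨huv.trans hw.1, hw.2.trans h.symm⟩
    · have := h' (show v ∈ Finset.univ.filter fun w => u < w ∧ lab w = lab u by simp [huv, h])
      simp at this
  rcases lt_trichotomy u v with h1 | h1 | h1
  · have := key u v h h1; omega
  · exact h1
  · have := key v u h.symm h1; omega

/-- The ranks within a class of size `k` are distinct and below `k`, so every residue modulo `k` is
a rank. -/
theorem exists_pivot (lab : Fin n → Fin n) (x : ℕ) (v : Fin n) :
    ∃ p, lab p = lab v ∧ IsPivot lab x p := by
  have hpos : 0 < classSize lab (lab v) := (Nat.zero_le _).trans_lt (rankIn_lt_classSize lab v)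
  obtain ⟨p, hp, h⟩ := Finset.surj_on_of_inj_on_of_card_le
    (s := Finset.univ.filter fun u => lab u = lab v)
    (t := Finset.range (classSize lab (lab v))) (fun u _ => rankIn lab u)
    (fun u hu => by
      simp only [Finset.mem_filter, Finset.mem_univ, true_and] at hu
      rw [Finset.mem_range, ← hu]; exact rankIn_lt_classSize lab u)
    (fun u w hu hw h => by
      simp only [Finset.mem_filter, Finset.mem_univ, true_and] at hu hw
      exact rankIn_injOn (hu.trans hw.symm) h)
    (by rw [Finset.card_range]; rfl) (x % classSize lab (lab v))
    (Finset.mem_range.2 (Nat.mod_lt _ hpos))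
  simp only [Finset.mem_filter, Finset.mem_univ, true_and] at hp
  exact ⟨p, hp, by rw [IsPivot, hp]; exact h⟩

/-- The pivot is only nearly uniform, because `R` need not be a multiple of the class size; the
error is the summand 1. -/
theorem card_isPivot (lab : Fin n → Fin n) (R : ℕ) (p : Fin n) :
    ((Finset.range R).filter fun x => x % classSize lab (lab p) = rankIn lab p).card ≤
      R / classSize lab (lab p) + 1 := by
  set k := classSize lab (lab p)
  rw [← Finset.card_range (R / k + 1)]
  apply Finset.card_le_card_of_injOn (fun x => x / k)
  · intro x hx
    simp only [Finset.coe_filter, Finset.mem_range, Set.mem_ofPred_eq] at hx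
    simp only [Finset.coe_range, Set.mem_Iio]
    exact Nat.lt_succ_of_le (Nat.div_le_div_right hx.1.le)
  · intro x hx y hy hxy
    simp only [Finset.coe_filter, Set.mem_ofPred_eq] at hx hy
    rw [← Nat.div_add_mod x k, ← Nat.div_add_mod y k, hx.2, hy.2]
    simp only at hxy
    rw [hxy]

theorem sum_rotate (g : Fin n → Fin n → Fin n → ℕ) :
    ∑ u, ∑ v, ∑ p, g u v p = ∑ u, ∑ v, ∑ p, g v p u := by
  calc ∑ u, ∑ v, ∑ p, g u v p = ∑ u, ∑ p, ∑ v, g u v p :=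
        Finset.sum_congr rfl fun u _ => Finset.sum_comm
    _ = _ := Finset.sum_comm

/-- Among three nodes of a class at most one is equally far from the other two, so a random pivot
collapses at most about a third of the pairs. -/
theorem sum_apex_le {f : Fin n → Fin n → ℕ} (hf : ∀ u v, f u v = f v u)
    (hties : ∀ p u v, p ≠ u → p ≠ v → u ≠ v → f p u = f p v → f u v ≠ f p u)
    (lab : Fin n → Fin n) {R : ℕ} (hR : 2 * n ≤ R) :
    2 * ∑ u, ∑ v, ∑ p, (if (u ≠ v ∧ u ≠ p ∧ v ≠ p ∧ lab u = lab p ∧ lab v = lab p) ∧ f p u = f p v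
      then R / classSize lab (lab p) + 1 else 0) ≤ R * collisions lab := by
  set w : Fin n → ℕ := fun l => R / classSize lab l + 1
  let T (u v p : Fin n) : Prop := u ≠ v ∧ u ≠ p ∧ v ≠ p ∧ lab u = lab p ∧ lab v = lab p
  have dT : ∀ u v p, Decidable (T u v p) := fun _ _ _ => by unfold T; infer_instance
  let g (u v p : Fin n) : ℕ := if T u v p ∧ f p u = f p v then w (lab p) else 0
  -- The three sums let each node of the triple be the apex. Two apexes would make all three values
  -- equal, which `hties` forbids.
  have hsum : (∑ u, ∑ v, ∑ p, g u v p) + (∑ u, ∑ v, ∑ p, g v p u) + (∑ u, ∑ v, ∑ p, g p u v) ≤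
      ∑ u, ∑ v, ∑ p, if T u v p then w (lab p) else 0 := by
    simp only [← Finset.sum_add_distrib]
    refine Finset.sum_le_sum fun u _ => Finset.sum_le_sum fun v _ => Finset.sum_le_sum fun p _ => ?_
    by_cases h : T u v p
    · obtain ⟨a, b, c, d, e⟩ := id h
      have t1 := hties p u v b.symm c.symm a
      have t2 := hties v p u c a.symm b.symm
      have t3 := hties u v p a b c
      have e1 := hf p u
      have e2 := hf p v
      have e3 := hf u v
      have i1 : T v p u := ⟨c, a.symm, b.symm, e.trans d.symm, d.symm⟩
      have i2 : T p u v := ⟨b.symm, c.symm, a, e.symm, d.trans e.symm⟩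
      simp only [g, h, i1, i2, true_and, if_true, d, e]
      split_ifs <;> omega
    · have i1 : ¬ T v p u := fun ⟨c, a, b, d, e⟩ => h ⟨a.symm, b.symm, c, e.symm, d.trans e.symm⟩
      have i2 : ¬ T p u v := fun ⟨b, c, a, d, e⟩ => h ⟨a, b.symm, c.symm, e.trans d.symm, d.symm⟩
      simp [g, h, i1, i2]
  have r1 := sum_rotate g
  have r2 := sum_rotate fun u v p => g v p u
  -- In a class of size `k` the third node contributes `k * (R / k + 1) ≤ R + n` per colliding pair.
  -- As `2 * n ≤ R`, this is at most `3 * R / 2`, and a third of it at most `R / 2`.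
  have htot : ∑ u, ∑ v, ∑ p, (if T u v p then w (lab p) else 0) ≤ (R + n) * collisions lab := by
    unfold collisions
    simp only [Finset.mul_sum]
    refine Finset.sum_le_sum fun u _ => Finset.sum_le_sum fun v _ => ?_
    by_cases h : u ≠ v ∧ lab u = lab v
    · rw [if_pos h, mul_one]
      calc _ ≤ ∑ p, (if lab p = lab u then w (lab u) else 0) := by
            refine Finset.sum_le_sum fun p _ => ?_
            by_cases hp : T u v p
            · rw [if_pos hp, if_pos hp.2.2.2.1.symm, hp.2.2.2.1]
            · rw [if_neg hp]; exact Nat.zero_le _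
        _ = classSize lab (lab u) * w (lab u) := by
            rw [← Finset.sum_filter, Finset.sum_const, smul_eq_mul]; rfl
        _ ≤ R + classSize lab (lab u) := by
            simp only [w, mul_add, mul_one]
            have := Nat.mul_div_le R (classSize lab (lab u))
            omega
        _ ≤ R + n := by
            have : classSize lab (lab u) ≤ n := (Finset.card_le_univ _).trans (by simp)
            omega
    · rw [if_neg h, mul_zero, Nat.le_zero]
      refine Finset.sum_eq_zero fun p _ => if_neg ?_
      rintro ⟨a, b, c, d, e⟩
      exact h ⟨a, d.trans e.symm⟩
  have h3 : 3 * (∑ u, ∑ v, ∑ p, g u v p) ≤ (R + n) * collisions lab := by omega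
  have h4 : 2 * ((R + n) * collisions lab) ≤ 3 * (R * collisions lab) := by
    calc 2 * ((R + n) * collisions lab) = (2 * R + 2 * n) * collisions lab := by ring
      _ ≤ (2 * R + R) * collisions lab := by gcongr
      _ = _ := by ring
  have h5 : 2 * (∑ u, ∑ v, ∑ p, g u v p) ≤ R * collisions lab := by omega
  convert h5

/-- In a round of refinement the expected number of colliding pairs at least halves. -/
theorem sum_collisions_le {f : Fin n → Fin n → ℕ} (hf : ∀ u v, f u v = f v u)
    (h0 : ∀ u, f u u = 0) (hpos : ∀ u v, u ≠ v → 0 < f u v)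
    (hties : ∀ p u v, p ≠ u → p ≠ v → u ≠ v → f p u = f p v → f u v ≠ f p u)
    (lab : Fin n → Fin n) {R : ℕ} (hR : 2 * n ≤ R) (lab' piv : ℕ → Fin n → Fin n)
    (h : ∀ x < R, Refines f x lab (lab' x) (piv x)) :
    2 * ∑ x ∈ Finset.range R, collisions (lab' x) ≤ R * collisions lab := by
  refine le_trans (Nat.mul_le_mul_left 2 ?_) (sum_apex_le hf hties lab hR)
  calc ∑ x ∈ Finset.range R, collisions (lab' x)
      ≤ ∑ x ∈ Finset.range R, ∑ u, ∑ v, ∑ p,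
        (if (u ≠ v ∧ u ≠ p ∧ v ≠ p ∧ lab u = lab p ∧ lab v = lab p) ∧ f p u = f p v then
          if x % classSize lab (lab p) = rankIn lab p then 1 else 0 else 0) := by
        refine Finset.sum_le_sum fun x hx => Finset.sum_le_sum fun u _ =>
          Finset.sum_le_sum fun v _ => ?_
        split_ifs with huv
        · have hr := h x (Finset.mem_range.1 hx)
          obtain ⟨h1, h2⟩ := (hr.eq_iff u v).1 huv.2
          have hp := hr.lab_piv u
          have hpv := hr.isPivot u
          rw [← h1] at h2
          set p := piv x (lab u)
          -- The pivot is alone in its new class, since it has value 0 to itself and positive values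
          -- to all others.
          have hup : u ≠ p := by
            intro e
            rw [← e, h0] at h2
            exact absurd h2 (hpos u v huv.1).ne
          have hvp : v ≠ p := by
            intro e
            rw [← e, h0] at h2
            exact absurd h2.symm (hpos v u huv.1.symm).ne
          refine le_trans ?_ (Finset.single_le_sum (fun _ _ => Nat.zero_le _) (Finset.mem_univ p))
          rw [if_pos ⟨⟨huv.1, hup, hvp, hp.symm, h1.symm.trans hp.symm⟩, h2⟩, if_pos (show x % _ = _ from hpv)]
        · exact Nat.zero_le _
    _ = ∑ u, ∑ v, ∑ p, ∑ x ∈ Finset.range R,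
        (if (u ≠ v ∧ u ≠ p ∧ v ≠ p ∧ lab u = lab p ∧ lab v = lab p) ∧ f p u = f p v then
          if x % classSize lab (lab p) = rankIn lab p then 1 else 0 else 0) := by
        rw [Finset.sum_comm]
        refine Finset.sum_congr rfl fun u _ => ?_
        rw [Finset.sum_comm]
        refine Finset.sum_congr rfl fun v _ => ?_
        rw [Finset.sum_comm]
    _ ≤ _ := by
        refine Finset.sum_le_sum fun u _ => Finset.sum_le_sum fun v _ =>
          Finset.sum_le_sum fun p _ => ?_
        split_ifs with hc
        · rw [← Finset.sum_filter, ← Finset.card_eq_sum_ones]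
          exact card_isPivot lab R p
        · simp

end refinement

/-! ## Max-Flow values of trees -/

section chains

variable {α : Type*} {r r' : α → α → Prop} {a b : α}

theorem reflTransGen_bind (h : ∀ a b, r a b → Relation.ReflTransGen r' a b)
    (hab : Relation.ReflTransGen r a b) : Relation.ReflTransGen r' a b := by
  induction hab with
  | refl => exact .refl
  | tail _ h1 ih => exact ih.trans (h _ _ h1)

theorem reflTransGen_mono (h : ∀ a b, r a b → r' a b) (hab : Relation.ReflTransGen r a b) :
    Relation.ReflTransGen r' a b :=
  reflTransGen_bind (fun a b hab => .single (h a b hab)) hab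

theorem reflTransGen_symm (h : ∀ a b, r a b → r b a) (hab : Relation.ReflTransGen r a b) :
    Relation.ReflTransGen r b a := by
  induction hab with
  | refl => exact .refl
  | tail _ h1 ih => exact .head (h _ _ h1) ih

end chains

section trees

variable {n : ℕ}

/-- Every cut between `s` and `t` has to break some link of the chain. -/
theorem le_maxFlow_of_chain {T : CapGraph n} {x : ℕ} {s t : Fin n} (hst : s ≠ t)
    (h : Relation.ReflTransGen (fun a b => x ≤ T.cap a b) s t) : x ≤ T.maxFlow s t := by
  obtain ⟨S, hs, ht, hS⟩ := T.exists_minCut hst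
  rw [← hS]
  have key : ∀ t, Relation.ReflTransGen (fun a b => x ≤ T.cap a b) s t → t ∉ S →
      x ≤ T.cutValue S := by
    intro t h
    induction h with
    | refl => intro h; exact absurd hs h
    | @tail b c _ hbc ih =>
      intro hc
      by_cases hb : b ∈ S
      · exact hbc.trans (T.cap_le_cutValue hb hc)
      · exact ih hb
  exact key t h ht

theorem exists_walk_avoiding {H : SimpleGraph (Fin n)} {e : Sym2 (Fin n)} {s t : Fin n}
    (h : Relation.ReflTransGen (fun a b => H.Adj a b ∧ s(a, b) ≠ e) s t) :
    ∃ p : H.Walk s t, e ∉ p.edges := by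
  induction h with
  | refl => exact ⟨.nil, by simp⟩
  | tail _ hbc ih =>
    obtain ⟨p, hp⟩ := ih
    refine ⟨p.concat hbc.1, ?_⟩
    simp [SimpleGraph.Walk.edges_concat, hp, hbc.2.symm]

theorem le_of_walk {H : SimpleGraph (Fin n)} {h : Fin n → Fin n → ℕ} {y : ℕ}
    (hult : ∀ u v w, u ≠ w → min (h u v) (h v w) ≤ h u w) {s t : Fin n} (p : H.Walk s t)
    (hp : ∀ d ∈ p.darts, y ≤ h d.fst d.snd) (hst : s ≠ t) : y ≤ h s t := by
  induction p with
  | nil => exact absurd rfl hst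
  | @cons u v w huv p ih =>
    simp only [SimpleGraph.Walk.darts_cons, List.mem_cons, forall_eq_or_imp] at hp
    rcases eq_or_ne v w with rfl | hvw
    · exact hp.1
    · exact (le_min hp.1 (ih hp.2 hvw)).trans (hult u v w hst)

/-- In a tree whose capacities are values of an ultrametric, no Max-Flow value exceeds the value of
the ultrametric. -/
theorem maxFlow_le_of_isTree {T : CapGraph n} (hT : T.graph.IsTree) {h : Fin n → Fin n → ℕ}
    (hult : ∀ u v w, u ≠ w → min (h u v) (h v w) ≤ h u w)
    (hcap : ∀ u v, T.graph.Adj u v → T.cap u v = h u v) {s t : Fin n} (hst : s ≠ t) :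
    T.maxFlow s t ≤ h s t := by
  classical
  obtain ⟨w⟩ := hT.1.preconnected s t
  let p := w.toPath
  -- The edge `d` is the cheapest one on the tree path. Without it the tree falls apart, so `d`
  -- alone leaves the side `S` of `s`; by the ultrametric inequality along the path its capacity is
  -- at most `h s t`.
  obtain ⟨d, hd, hmin⟩ := Finset.exists_min_image p.1.darts.toFinset
    (fun d => T.cap d.fst d.snd) (by
      obtain ⟨p, hp⟩ := p
      cases p with
      | nil => exact absurd rfl hst
      | cons h p => exact ⟨⟨(_, _), h⟩, by simp⟩)
  rw [List.mem_toFinset] at hd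
  let S : Finset (Fin n) := Finset.univ.filter fun x =>
    Relation.ReflTransGen (fun a b => T.graph.Adj a b ∧ s(a, b) ≠ s(d.fst, d.snd)) s x
  have hsS : s ∈ S := by simp only [S, Finset.mem_filter, Finset.mem_univ, true_and]; exact .refl
  have htS : t ∉ S := by
    simp only [S, Finset.mem_filter, Finset.mem_univ, true_and]
    intro h
    obtain ⟨q, hq⟩ := exists_walk_avoiding h
    have := (hT.2.subsingleton_path s t).elim q.toPath p
    apply hq
    apply SimpleGraph.Walk.edges_toPath_subset_edges
    rw [this]
    exact List.mem_map.2 ⟨d, hd, rfl⟩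
  have hcut : T.cutValue S ≤ T.cap d.fst d.snd := by
    calc T.cutValue S ≤ ∑ u ∈ S, ∑ v ∈ Sᶜ,
          (if s(u, v) = s(d.fst, d.snd) then T.cap d.fst d.snd else 0) := by
          refine Finset.sum_le_sum fun u hu => Finset.sum_le_sum fun v hv => ?_
          split_ifs with he
          · rcases Sym2.eq_iff.1 he with ⟨rfl, rfl⟩ | ⟨rfl, rfl⟩
            · exact le_rfl
            · rw [T.symm]
          · by_contra hc
            simp only [S, Finset.mem_filter, Finset.mem_univ, true_and, Finset.mem_compl] at hu hv
            exact hv (hu.tail ⟨Nat.pos_of_ne_zero fun h0 => hc (by omega), he⟩)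
      _ ≤ _ := by
          rw [CapGraph.sum_indicator_cut d.adj.ne]
          split_ifs <;> simp
  refine (T.maxFlow_le_cutValue hsS htS).trans (hcut.trans ?_)
  refine le_of_walk hult p.1 (fun d' hd' => ?_) hst
  rw [← hcap _ _ d'.adj]
  exact hmin d' (List.mem_toFinset.2 hd')

end trees

/-! ## Trees grown along refinements -/

section growth

variable {n : ℕ}

/-- Two nodes are linked by a listed edge. -/
def Linked (E : List (Fin n × Fin n × ℕ)) (a b : Fin n) : Prop :=
  ∃ e ∈ E, (e.1 = a ∧ e.2.1 = b) ∨ (e.1 = b ∧ e.2.1 = a)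

theorem Linked.symm {E : List (Fin n × Fin n × ℕ)} {a b : Fin n} (h : Linked E a b) :
    Linked E b a := by
  obtain ⟨e, he, h⟩ := h
  exact ⟨e, he, h.symm⟩

/-- The edges listed in `E`, with weights `g`, form a tree on the classes of `lab`, with bottleneck
weights given by `f`. -/
structure TreeInv (f g : Fin n → Fin n → ℕ) (lab : Fin n → Fin n)
    (E : List (Fin n × Fin n × ℕ)) : Prop where
  idem : ∀ v, lab (lab v) = lab v
  edge : ∀ e ∈ E, e.1 ≠ e.2.1 ∧ e.2.2 = g e.1 e.2.1
  count : E.length + 1 = (Finset.univ.filter fun v => lab v = v).card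
  conn : ∀ u v, u ≠ v → Relation.ReflTransGen
    (fun a b => f u v ≤ f a b ∧ (lab a = lab b ∨ Linked E a b)) u v

theorem TreeInv.init (f g : Fin n → Fin n → ℕ) (z : Fin n) : TreeInv f g (fun _ => z) [] where
  idem _ := rfl
  edge := by simp
  count := by simp [Finset.filter_eq]
  conn u v _ := .single ⟨le_rfl, .inl rfl⟩

variable {f g : Fin n → Fin n → ℕ} {x : ℕ} {lab lab' piv : Fin n → Fin n}
  {E E' : List (Fin n × Fin n × ℕ)}

/-- The list `E'` arises from `E` by adding an edge from the pivots to all other new classes in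
their old classes. -/
structure Grows (f g : Fin n → Fin n → ℕ) (lab lab' piv : Fin n → Fin n)
    (E E' : List (Fin n × Fin n × ℕ)) : Prop where
  mem_iff : ∀ e, e ∈ E' ↔ e ∈ E ∨ ∃ v, (lab' v = v ∧ f (piv (lab v)) v ≠ 0) ∧
    e = (piv (lab v), v, g (piv (lab v)) v)
  length : E'.length = E.length +
    (Finset.univ.filter fun v => lab' v = v ∧ f (piv (lab v)) v ≠ 0).card

/-- Each old class has exactly one new class without a new edge, the singleton of its pivot; `lab`
and `piv` are inverse bijections between these pivots and the old representatives. So the number of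
edges remains one less than the number of classes. -/
theorem Refines.card_fixed (h0 : ∀ u, f u u = 0) (hpos : ∀ u v, u ≠ v → 0 < f u v)
    (hr : Refines f x lab lab' piv) (hidem : ∀ v, lab (lab v) = lab v) :
    (Finset.univ.filter fun v => lab' v = v).card =
      (Finset.univ.filter fun v => lab v = v).card +
      (Finset.univ.filter fun v => lab' v = v ∧ f (piv (lab v)) v ≠ 0).card := by
  have hp : ∀ v, f (piv (lab v)) v = 0 ↔ piv (lab v) = v := by
    intro v
    constructor
    · intro h
      by_contra hne
      exact absurd h (hpos _ _ hne).ne'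
    · intro h; rw [h, h0]
  rw [← Finset.card_filter_add_card_filter_not (s := Finset.univ.filter fun v => lab' v = v)
    (fun v => f (piv (lab v)) v = 0)]
  rw [Finset.filter_filter, Finset.filter_filter]
  congr 1
  apply Finset.card_nbij' lab piv
  · intro v hv
    simp [hidem]
  · intro l hl
    simp only [Finset.coe_filter, Finset.mem_univ, true_and, Set.mem_ofPred_eq] at hl ⊢
    have h1 : lab (piv l) = l := by have := hr.lab_piv l; rwa [hl] at this
    refine ⟨?_, by rw [h1, h0]⟩
    have h2 := (hr.eq_iff _ _).1 (hr.idem (piv l))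
    rw [h2.1, h1, h0] at h2
    by_contra hne
    exact absurd h2.2 (hpos _ _ (Ne.symm hne)).ne'
  · intro v hv
    simp only [Finset.coe_filter, Finset.mem_univ, true_and, Set.mem_ofPred_eq] at hv
    exact (hp v).1 hv.2
  · intro l hl
    simp only [Finset.coe_filter, Finset.mem_univ, true_and, Set.mem_ofPred_eq] at hl
    have := hr.lab_piv l
    rwa [hl] at this

/-- Only jumps inside an old class between different new classes have to be replaced. Such a jump is
rerouted through the pivot: from each end to the representative of its new class, then along the new
edge. -/
theorem TreeInv.step (hf : ∀ u v, f u v = f v u)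
    (hult : ∀ u v w, u ≠ w → min (f u v) (f v w) ≤ f u w)
    (h0 : ∀ u, f u u = 0) (hpos : ∀ u v, u ≠ v → 0 < f u v)
    (h : TreeInv f g lab E) (hr : Refines f x lab lab' piv) (hg : Grows f g lab lab' piv E E') :
    TreeInv f g lab' E' where
  idem := hr.idem
  edge e he := by
    rcases (hg.mem_iff e).1 he with he | ⟨v, ⟨-, hv⟩, rfl⟩
    · exact h.edge e he
    · exact ⟨fun e => hv (by dsimp only at e; rw [e, h0]), rfl⟩
  count := by
    rw [hg.length, hr.card_fixed h0 hpos h.idem, ← h.count]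
    ring
  conn u v huv := by
    have hx := hpos u v huv
    set y := f u v
    let r (a b : Fin n) : Prop := y ≤ f a b ∧ (lab' a = lab' b ∨ Linked E' a b)
    have hsymm : ∀ a b, r a b → r b a := fun a b h => by
      obtain ⟨h1, h2⟩ := h
      exact ⟨hf a b ▸ h1, h2.imp Eq.symm Linked.symm⟩
    have hpivot : ∀ a, a ≠ piv (lab a) → y ≤ f (piv (lab a)) a →
        Relation.ReflTransGen r a (piv (lab a)) := by
      intro a ha hya
      obtain ⟨h1, h2⟩ := (hr.eq_iff _ _).1 (hr.idem a)
      rw [h1] at h2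
      have hlink : r (lab' a) (piv (lab a)) := by
        refine ⟨by rw [hf, h2]; exact hya, .inr ⟨(piv (lab a), lab' a, g (piv (lab a)) (lab' a)),
          ?_, .inr ⟨rfl, rfl⟩⟩⟩
        refine (hg.mem_iff _).2 (.inr ⟨lab' a, ⟨hr.idem a, ?_⟩, ?_⟩)
        · rw [h1, h2]; omega
        · rw [h1]
      rcases eq_or_ne a (lab' a) with e | e
      · rw [← e] at hlink
        exact .single hlink
      -- Both `a` and `lab' a` have the same value to the pivot, so their mutual value is no
      -- smaller.
      · refine .head ⟨?_, .inl (hr.idem a).symm⟩ (.single hlink)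
        have := hult a (piv (lab a)) (lab' a) e
        rw [hf a, h2, min_self] at this
        exact hya.trans this
    have hstep : ∀ a b, y ≤ f a b ∧ (lab a = lab b ∨ Linked E a b) →
        Relation.ReflTransGen r a b := by
      rintro a b ⟨hab, hlab | hlink⟩
      · by_cases heq : lab' a = lab' b
        · exact .single ⟨hab, .inl heq⟩
        · have hne : f (piv (lab a)) a ≠ f (piv (lab b)) b := fun e =>
            heq ((hr.eq_iff a b).2 ⟨hlab, e⟩)
          have hpb : piv (lab b) = piv (lab a) := by rw [hlab]
          -- In an ultrametric the two smallest of three values agree. As the values to the pivot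
          -- differ, neither is below `f a b`.
          have key : ∀ a b p, f p a ≠ f p b → y ≤ f a b → a ≠ p → y ≤ f p a := by
            intro a b p hne hab hap
            rcases eq_or_ne b p with rfl | hbp
            · rwa [hf]
            · have h1 := hult p b a hap.symm
              have h2 := hult p a b hbp.symm
              have h3 := hf a b
              omega
          have ha : Relation.ReflTransGen r a (piv (lab a)) := by
            rcases eq_or_ne a (piv (lab a)) with e | e
            · rw [← e]
            · exact hpivot a e (key a b _ (by rwa [hpb] at hne) hab e)
          have hb : Relation.ReflTransGen r b (piv (lab b)) := by
            rcases eq_or_ne b (piv (lab b)) with e | e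
            · rw [← e]
            · exact hpivot b e (key b a _ (by rw [hpb] at hne ⊢; exact hne.symm)
                (by rwa [hf]) e)
          rw [hpb] at hb
          exact ha.trans (reflTransGen_symm hsymm hb)
      · refine .single ⟨hab, .inr ?_⟩
        obtain ⟨e, he, h⟩ := hlink
        exact ⟨e, (hg.mem_iff e).2 (.inl he), h⟩
    exact reflTransGen_bind hstep (h.conn u v huv)

open Classical in
/-- The graph whose edges are listed in `E`, with the capacities `g`. -/
noncomputable def linkGraph (g : Fin n → Fin n → ℕ) (hg : ∀ u v, g u v = g v u)
    (E : List (Fin n × Fin n × ℕ)) : CapGraph n where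
  cap u v := if u ≠ v ∧ Linked E u v then g u v else 0
  symm u v := by
    have : Linked E u v ↔ Linked E v u := ⟨Linked.symm, Linked.symm⟩
    simp only [hg u v, ne_comm (a := u), this]
  loopless u := by simp

/-- When all classes have become singletons, the listed edges form a flow-equivalent tree. -/
theorem TreeInv.isFlowEquivalentTree {G : CapGraph n} (hG : G.graph.Connected)
    (hlab : Function.Injective lab) (h : TreeInv f G.maxFlow lab E)
    (hfg : ∀ u v a b, u ≠ v → a ≠ b → f u v ≤ f a b → G.maxFlow u v ≤ G.maxFlow a b)
    (h0 : ∀ u, f u u = 0) (hpos : ∀ u v, u ≠ v → 0 < f u v) :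
    G.IsFlowEquivalentTree (linkGraph G.maxFlow G.maxFlow_comm E) ∧
      (linkGraph G.maxFlow G.maxFlow_comm E).IsListing E := by
  classical
  set T := linkGraph G.maxFlow G.maxFlow_comm E with hTdef
  have hadj : ∀ u v, T.graph.Adj u v ↔ u ≠ v ∧ Linked E u v := by
    intro u v
    show 0 < (if u ≠ v ∧ Linked E u v then G.maxFlow u v else 0) ↔ _
    split_ifs with hc
    · exact ⟨fun _ => hc, fun _ => CapGraph.maxFlow_pos hG hc.1⟩
    · exact ⟨fun h => absurd h (lt_irrefl 0), fun h => absurd h hc⟩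
  have hcap : ∀ u v, T.graph.Adj u v → T.cap u v = G.maxFlow u v := by
    intro u v huv
    exact if_pos ((hadj u v).1 huv)
  have hchain : ∀ u v, u ≠ v →
      Relation.ReflTransGen (fun a b => T.graph.Adj a b ∧ G.maxFlow u v ≤ T.cap a b) u v := by
    intro u v huv
    refine reflTransGen_mono ?_ (h.conn u v huv)
    rintro a b ⟨h1, h2⟩
    have hab : a ≠ b := by
      rintro rfl
      have := hpos u v huv
      rw [h0] at h1
      omega
    have had : T.graph.Adj a b := (hadj a b).2 ⟨hab, h2.resolve_left fun e => hab (hlab e)⟩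
    exact ⟨had, by rw [hcap a b had]; exact hfg u v a b huv hab h1⟩
  have hconn : T.graph.Connected := by
    have := hG.nonempty
    refine ⟨fun u v => ?_⟩
    rcases eq_or_ne u v with rfl | huv
    · rfl
    · rw [SimpleGraph.reachable_iff_reflTransGen]
      exact reflTransGen_mono (fun a b h => h.1) (hchain u v huv)
  have hset : T.graph.edgeSet = ((E.map fun e => s(e.1, e.2.1)).toFinset : Set (Sym2 (Fin n))) := by
    ext e
    induction e with
    | _ u v =>
      rw [SimpleGraph.mem_edgeSet, hadj]
      simp only [List.coe_toFinset, List.mem_map, Set.mem_ofPred_eq]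
      constructor
      · rintro ⟨-, e, he, h⟩
        exact ⟨e, he, Sym2.eq_iff.2 h⟩
      · rintro ⟨e, he, h'⟩
        have hl : Linked E u v := ⟨e, he, Sym2.eq_iff.1 h'⟩
        refine ⟨?_, hl⟩
        have := (h.edge e he).1
        rcases Sym2.eq_iff.1 h' with ⟨rfl, rfl⟩ | ⟨rfl, rfl⟩
        · exact this
        · exact this.symm
  have hlen : E.length + 1 = n := by
    rw [h.count]
    have : ∀ v, lab v = v := fun v => hlab (h.idem v)
    simp [this]
  have hcard : Nat.card T.graph.edgeSet = (E.map fun e => s(e.1, e.2.1)).toFinset.card := by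
    rw [hset, Nat.card_coe_set_eq, Set.ncard_coe_finset]
  -- Connectivity requires at least `n - 1` edges, while the list has only `n - 1` entries. So no
  -- edge is listed twice, and the graph is a tree.
  have h1 := hconn.card_vert_le_card_edgeSet_add_one
  have h2 := List.toFinset_card_le (E.map fun e => s(e.1, e.2.1))
  rw [List.length_map] at h2
  rw [Nat.card_fin] at h1
  have hnodup : (E.map fun e => s(e.1, e.2.1)).Nodup := by
    rw [← Multiset.coe_nodup, ← Multiset.toFinset_card_eq_card_iff_nodup, Multiset.coe_card,
      List.length_map]
    show (E.map fun e => s(e.1, e.2.1)).toFinset.card = _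
    omega
  have htree : T.graph.IsTree := by
    rw [SimpleGraph.isTree_iff_connected_and_card]
    refine ⟨hconn, ?_⟩
    rw [Nat.card_fin]
    omega
  refine ⟨⟨htree, fun s t hst => le_antisymm ?_ ?_⟩, hnodup, ?_, ?_⟩
  · exact maxFlow_le_of_isTree htree (fun u v w huw => G.min_le_maxFlow v huw) hcap hst
  · exact le_maxFlow_of_chain hst (reflTransGen_mono (fun a b h => h.2) (hchain s t hst))
  · intro u v
    have := Set.ext_iff.1 hset s(u, v)
    rw [SimpleGraph.mem_edgeSet] at this
    exact this.trans (by simp)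
  · intro e he
    have hl : Linked E e.1 e.2.1 := ⟨e, he, .inl ⟨rfl, rfl⟩⟩
    rw [(h.edge e he).2, hcap _ _ ((hadj _ _).2 ⟨(h.edge e he).1, hl⟩)]

end growth

/-! ## Deterministic executions -/

section det

variable {w : ℕ}

theorem Det.iter_run {x : ℕ} {p : Det}
    (hp : ∀ fuel σ k σ' k', p.exec w fuel (σ, k) = some (σ', k') →
      ∃ d, k' = k + d ∧ 1 ≤ d ∧ ∀ k₂ F, d < F → p.exec w F (σ, k₂) = some (σ', k₂ + d))
    (fuel f : ℕ) : ∀ σ k σ' k', Det.iter x (p.exec w fuel) f (σ, k) = some (σ', k') →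
      ∃ d, k' = k + d ∧ 1 ≤ d ∧ ∀ k₂ F f₂, d < F → d < f₂ →
        Det.iter x (p.exec w F) f₂ (σ, k₂) = some (σ', k₂ + d) := by
  induction f with
  | zero => intro σ k σ' k' h; simp [Det.iter] at h
  | succ f ih =>
    intro σ k σ' k' h
    rw [Det.iter] at h
    split_ifs at h with h0
    · simp only [Option.some.injEq, Prod.mk.injEq] at h
      obtain ⟨rfl, rfl⟩ := h
      refine ⟨1, rfl, le_rfl, fun k₂ F f₂ _ hf => ?_⟩
      obtain ⟨f₂, rfl⟩ : ∃ g, f₂ = g + 1 := ⟨f₂ - 1, by omega⟩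
      rw [Det.iter, if_pos h0]
    · rw [Option.bind_eq_some_iff] at h
      obtain ⟨⟨σ₁, k₁⟩, h1, h2⟩ := h
      obtain ⟨d₁, rfl, hd₁, e₁⟩ := hp _ _ _ _ _ h1
      obtain ⟨d₂, rfl, hd₂, e₂⟩ := ih _ _ _ _ h2
      refine ⟨1 + d₁ + d₂, by ring, by omega, fun k₂ F f₂ hF hf => ?_⟩
      obtain ⟨f₂, rfl⟩ : ∃ g, f₂ = g + 1 := ⟨f₂ - 1, by omega⟩
      rw [Det.iter, if_neg h0, e₁ _ _ (by omega), Option.bind_some, e₂ _ _ _ (by omega) (by omega)]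
      congr 2
      ring

/-- A halting run does not depend on the step count at its start, nor on the fuel if that exceeds
the number of its steps. -/
theorem Det.exec_run (p : Det) : ∀ fuel σ k σ' k', p.exec w fuel (σ, k) = some (σ', k') →
    ∃ d, k' = k + d ∧ 1 ≤ d ∧ ∀ k₂ F, d < F → p.exec w F (σ, k₂) = some (σ', k₂ + d) := by
  induction p with
  | instr i =>
    intro fuel σ k σ' k' h
    simp only [Det.exec, Option.some.injEq, Prod.mk.injEq] at h
    obtain ⟨rfl, rfl⟩ := h
    exact ⟨1, rfl, le_rfl, fun _ _ _ => rfl⟩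
  | seq p q ihp ihq =>
    intro fuel σ k σ' k' h
    rw [Det.exec, Option.bind_eq_some_iff] at h
    obtain ⟨⟨σ₁, k₁⟩, h1, h2⟩ := h
    obtain ⟨d₁, rfl, hd₁, e₁⟩ := ihp _ _ _ _ _ h1
    obtain ⟨d₂, rfl, hd₂, e₂⟩ := ihq _ _ _ _ _ h2
    refine ⟨d₁ + d₂, by ring, by omega, fun k₂ F hF => ?_⟩
    rw [Det.exec, e₁ _ _ (by omega), Option.bind_some, e₂ _ _ (by omega), add_assoc]
  | ite x p q ihp ihq =>
    intro fuel σ k σ' k' h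
    rw [Det.exec] at h
    split_ifs at h with h0
    · obtain ⟨d, rfl, hd, e⟩ := ihq _ _ _ _ _ h
      refine ⟨1 + d, by ring, by omega, fun k₂ F hF => ?_⟩
      rw [Det.exec, if_pos h0, e _ _ (by omega), add_assoc]
    · obtain ⟨d, rfl, hd, e⟩ := ihp _ _ _ _ _ h
      refine ⟨1 + d, by ring, by omega, fun k₂ F hF => ?_⟩
      rw [Det.exec, if_neg h0, e _ _ (by omega), add_assoc]
  | loop x p ih =>
    intro fuel σ k σ' k' h
    rw [Det.exec] at h
    obtain ⟨d, hd, hd', e⟩ := Det.iter_run ih fuel fuel _ _ _ _ h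
    exact ⟨d, hd, hd', fun k₂ F hF => by rw [Det.exec, e _ _ _ hF hF]⟩

theorem Det.Halts.exec_eq {p : Det} {σ σ' : Mem} {k : ℕ} (h : p.Halts w σ σ' k) (k₂ : ℕ)
    {fuel : ℕ} (hf : k < fuel) : p.exec w fuel (σ, k₂) = some (σ', k₂ + k) := by
  obtain ⟨fuel', h⟩ := h
  obtain ⟨d, hd, -, e⟩ := p.exec_run _ _ _ _ _ h
  rw [zero_add] at hd
  subst hd
  exact e _ _ hf

theorem Det.Halts.unique {p : Det} {σ σ₁ σ₂ : Mem} {k₁ k₂ : ℕ} (h₁ : p.Halts w σ σ₁ k₁)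
    (h₂ : p.Halts w σ σ₂ k₂) : σ₁ = σ₂ := by
  have e₁ := h₁.exec_eq 0 (fuel := k₁ + k₂ + 1) (by omega)
  have e₂ := h₂.exec_eq 0 (fuel := k₁ + k₂ + 1) (by omega)
  rw [e₁] at e₂
  simp only [Option.some.injEq, Prod.mk.injEq] at e₂
  exact e₂.1

/-! ### Independence of computations from unread capacities. -/

/-- The two memories agree, except possibly in the capacity of the `i`-th edge. -/
def AgreeOff (i : ℕ) (σ τ : Mem) : Prop :=
  σ.reg = τ.reg ∧ ∀ a j, ¬ (a = 2 ∧ j = i) → σ.arr a j = τ.arr a j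

theorem AgreeOff.setReg {i : ℕ} {σ τ : Mem} (h : AgreeOff i σ τ) (d x : ℕ) :
    AgreeOff i (σ.setReg d x) (τ.setReg d x) :=
  ⟨by simp only [Mem.setReg, h.1], h.2⟩

theorem AgreeOff.setArr {i : ℕ} {σ τ : Mem} (h : AgreeOff i σ τ) (a j x : ℕ) :
    AgreeOff i (σ.setArr a j x) (τ.setArr a j x) := by
  refine ⟨h.1, fun a' j' hne => ?_⟩
  have := h.2 a' j' hne
  simp only [Mem.setArr]
  rcases eq_or_ne a' a with rfl | ha
  · simp only [Function.update_self]
    rcases eq_or_ne j' j with rfl | hj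
    · simp
    · simpa [hj] using this
  · simpa [ha] using this

theorem AgreeOff.askMem {i : ℕ} {σ τ : Mem} (h : AgreeOff i σ τ) (s t : ℕ) :
    AgreeOff i (askMem σ s t) (askMem τ s t) :=
  (h.setReg 0 s).setReg 1 t

/-- Only a load can see the excluded entry, and it reads a single index. A store writes equal values
at equal places. -/
theorem Instr.step_agreeOff (ins : Instr) (σ : Mem) :
    ∃ T : Finset ℕ, T.card ≤ 1 ∧ ∀ i ∉ T, ∀ τ, AgreeOff i σ τ →
      AgreeOff i (ins.step w σ) (ins.step w τ) := by
  cases ins with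
  | const d k => exact ⟨∅, by simp, fun i _ τ h => h.setReg _ _⟩
  | op o d x y =>
    refine ⟨∅, by simp, fun i _ τ h => ?_⟩
    simp only [Instr.step, h.1]
    exact h.setReg _ _
  | load d a j =>
    refine ⟨{σ.reg j}, by simp, fun i hi τ h => ?_⟩
    rw [Finset.mem_singleton] at hi
    simp only [Instr.step, ← h.1]
    rw [← h.2 a (σ.reg j) (fun e => hi e.2.symm)]
    exact h.setReg _ _
  | store a j x =>
    refine ⟨∅, by simp, fun i _ τ h => ?_⟩
    simp only [Instr.step, h.1]
    exact h.setArr _ _ _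

theorem Det.iter_agreeOff {x : ℕ} {body : Mem × ℕ → Option (Mem × ℕ)}
    (hb : ∀ σ k σ' k', body (σ, k) = some (σ', k') → ∃ T : Finset ℕ, T.card + k ≤ k' ∧
      ∀ i ∉ T, ∀ τ, AgreeOff i σ τ → ∃ τ', body (τ, k) = some (τ', k') ∧ AgreeOff i σ' τ')
    (f : ℕ) : ∀ σ k σ' k', Det.iter x body f (σ, k) = some (σ', k') →
      ∃ T : Finset ℕ, T.card + k ≤ k' ∧ ∀ i ∉ T, ∀ τ, AgreeOff i σ τ →
        ∃ τ', Det.iter x body f (τ, k) = some (τ', k') ∧ AgreeOff i σ' τ' := by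
  induction f with
  | zero => intro σ k σ' k' h; simp [Det.iter] at h
  | succ f ih =>
    intro σ k σ' k' h
    rw [Det.iter] at h
    split_ifs at h with h0
    · simp only [Option.some.injEq, Prod.mk.injEq] at h
      obtain ⟨rfl, rfl⟩ := h
      refine ⟨∅, by simp, fun i _ τ hτ => ⟨τ, ?_, hτ⟩⟩
      rw [Det.iter, if_pos (by rw [← hτ.1, h0])]
    · rw [Option.bind_eq_some_iff] at h
      obtain ⟨⟨σ₁, k₁⟩, h1, h2⟩ := h
      obtain ⟨T₁, hT₁, e₁⟩ := hb _ _ _ _ h1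
      obtain ⟨T₂, hT₂, e₂⟩ := ih _ _ _ _ h2
      refine ⟨T₁ ∪ T₂, by have := Finset.card_union_le T₁ T₂; omega, fun i hi τ hτ => ?_⟩
      rw [Finset.mem_union, not_or] at hi
      obtain ⟨τ₁, g₁, hτ₁⟩ := e₁ i hi.1 τ hτ
      obtain ⟨τ₂, g₂, hτ₂⟩ := e₂ i hi.2 τ₁ hτ₁
      refine ⟨τ₂, ?_, hτ₂⟩
      rw [Det.iter, if_neg (by rw [← hτ.1]; exact h0), g₁, Option.bind_some, g₂]

/-- In `d` steps at most `d` capacities are read. -/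
theorem Det.exec_agreeOff (fuel : ℕ) (p : Det) : ∀ σ k σ' k', p.exec w fuel (σ, k) = some (σ', k') →
    ∃ T : Finset ℕ, T.card + k ≤ k' ∧ ∀ i ∉ T, ∀ τ, AgreeOff i σ τ →
      ∃ τ', p.exec w fuel (τ, k) = some (τ', k') ∧ AgreeOff i σ' τ' := by
  induction p with
  | instr ins =>
    intro σ k σ' k' h
    simp only [Det.exec, Option.some.injEq, Prod.mk.injEq] at h
    obtain ⟨rfl, rfl⟩ := h
    obtain ⟨T, hT, e⟩ := ins.step_agreeOff (w := w) σ
    exact ⟨T, by omega, fun i hi τ hτ => ⟨_, rfl, e i hi τ hτ⟩⟩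
  | seq p q ihp ihq =>
    intro σ k σ' k' h
    rw [Det.exec, Option.bind_eq_some_iff] at h
    obtain ⟨⟨σ₁, k₁⟩, h1, h2⟩ := h
    obtain ⟨T₁, hT₁, e₁⟩ := ihp _ _ _ _ h1
    obtain ⟨T₂, hT₂, e₂⟩ := ihq _ _ _ _ h2
    refine ⟨T₁ ∪ T₂, by have := Finset.card_union_le T₁ T₂; omega, fun i hi τ hτ => ?_⟩
    rw [Finset.mem_union, not_or] at hi
    obtain ⟨τ₁, g₁, hτ₁⟩ := e₁ i hi.1 τ hτ
    obtain ⟨τ₂, g₂, hτ₂⟩ := e₂ i hi.2 τ₁ hτ₁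
    exact ⟨τ₂, by rw [Det.exec, g₁, Option.bind_some, g₂], hτ₂⟩
  | ite x p q ihp ihq =>
    intro σ k σ' k' h
    rw [Det.exec] at h
    split_ifs at h with h0
    · obtain ⟨T, hT, e⟩ := ihq _ _ _ _ h
      refine ⟨T, by omega, fun i hi τ hτ => ?_⟩
      obtain ⟨τ', g, hτ'⟩ := e i hi τ hτ
      exact ⟨τ', by rw [Det.exec, if_pos (by rw [← hτ.1, h0]), g], hτ'⟩
    · obtain ⟨T, hT, e⟩ := ihp _ _ _ _ h
      refine ⟨T, by omega, fun i hi τ hτ => ?_⟩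
      obtain ⟨τ', g, hτ'⟩ := e i hi τ hτ
      exact ⟨τ', by rw [Det.exec, if_neg (by rw [← hτ.1]; exact h0), g], hτ'⟩
  | loop x p ih => exact Det.iter_agreeOff ih fuel

theorem Det.Halts.agreeOff {p : Det} {σ σ' : Mem} {k : ℕ} (h : p.Halts w σ σ' k) :
    ∃ T : Finset ℕ, T.card ≤ k ∧ ∀ i ∉ T, ∀ τ, AgreeOff i σ τ →
      ∃ τ', p.Halts w τ τ' k ∧ AgreeOff i σ' τ' := by
  obtain ⟨fuel, h⟩ := h
  obtain ⟨T, hT, e⟩ := p.exec_agreeOff fuel _ _ _ _ h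
  refine ⟨T, by omega, fun i hi τ hτ => ?_⟩
  obtain ⟨τ', g, hτ'⟩ := e i hi τ hτ
  exact ⟨τ', ⟨fuel, g⟩, hτ'⟩

end det

/-! ## Max-Flow data structures have to read all capacities -/

section lowerBound

/-- In memories satisfying `Inv`, queries for the values of `f` are answered within `B` steps. -/
def Answers (q : Det) (w : ℕ) {n : ℕ} (f : Fin n → Fin n → ℕ) (B : ℕ) (Inv : Mem → Prop) : Prop :=
  ∀ σ, Inv σ → ∀ s t : Fin n, s ≠ t → ∃ σ' k, q.Halts w (askMem σ s t) σ' k ∧ k ≤ B ∧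
    σ'.reg 0 = f s t ∧ Inv σ'

/-- The whole sequence of queries reads at most `Q.length * B` capacities. For any other index the
same run takes place on the second memory, and by `Det.Halts.unique` it is the run whose answers are
known to be `f₂`. -/
theorem Answers.agreeOff {q : Det} {w n : ℕ} {f : Fin n → Fin n → ℕ} {B : ℕ} {Inv : Mem → Prop}
    (h : Answers q w f B Inv) (Q : List (Fin n × Fin n)) (hQ : ∀ e ∈ Q, e.1 ≠ e.2) :
    ∀ σ, Inv σ → ∃ T : Finset ℕ, T.card ≤ Q.length * B ∧ ∀ i ∉ T, ∀ (f₂ : Fin n → Fin n → ℕ) B₂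
      Inv₂, Answers q w f₂ B₂ Inv₂ → ∀ σ₂, AgreeOff i σ σ₂ → Inv₂ σ₂ →
        ∀ e ∈ Q, f₂ e.1 e.2 = f e.1 e.2 := by
  induction Q with
  | nil => exact fun σ _ => ⟨∅, by simp, by simp⟩
  | cons e Q ih =>
    intro σ hσ
    have he : e.1 ≠ e.2 := hQ e (by simp)
    obtain ⟨σ₁, k, h1, hk, hf, hσ₁⟩ := h σ hσ e.1 e.2 he
    obtain ⟨T₁, hT₁, e₁⟩ := h1.agreeOff
    obtain ⟨T₂, hT₂, e₂⟩ := ih (fun e' he' => hQ e' (by simp [he'])) σ₁ hσ₁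
    refine ⟨T₁ ∪ T₂, ?_, ?_⟩
    · have := Finset.card_union_le T₁ T₂
      rw [List.length_cons, add_mul, one_mul]
      omega
    · intro i hi f₂ B₂ Inv₂ hA σ₂ hag hσ₂
      rw [Finset.mem_union, not_or] at hi
      obtain ⟨τ, g1, hτ⟩ := e₁ i hi.1 _ (hag.askMem e.1 e.2)
      obtain ⟨τ', k', g2, -, hf', hτ'⟩ := hA σ₂ hσ₂ e.1 e.2 he
      have := g2.unique g1
      subst this
      intro e' he'
      rcases List.mem_cons.1 he' with rfl | he'
      · rw [← hf', ← hf, hτ.1]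
      · exact e₂ i hi.2 f₂ B₂ Inv₂ hA _ hτ hτ' e' he'

/-- An ultrametric is determined by few of its values. -/
theorem exists_skeleton {n : ℕ} {f : Fin n → Fin n → ℕ} (hf : ∀ u v, f u v = f v u)
    (hult : ∀ u v w, u ≠ w → min (f u v) (f v w) ≤ f u w) :
    ∃ Q : List (Fin n × Fin n), Q.length ≤ n ∧ (∀ e ∈ Q, e.1 ≠ e.2) ∧
      ∀ f₂ : Fin n → Fin n → ℕ, (∀ u v, f₂ u v = f₂ v u) →
        (∀ u v w, u ≠ w → min (f₂ u v) (f₂ v w) ≤ f₂ u w) →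
        (∀ e ∈ Q, f₂ e.1 e.2 = f e.1 e.2) → ∀ u v, u ≠ v → f u v ≤ f₂ u v := by
  classical
  -- Each node is paired with the earlier node to which it has the largest value.
  have hch : ∀ u : Fin n, ∃ q : Fin n, (∀ v < u, q < u ∧ f u v ≤ f u q) := by
    intro u
    by_cases h : (Finset.univ.filter fun v => v < u).Nonempty
    · obtain ⟨q, hq, hmax⟩ := Finset.exists_max_image _ (fun v => f u v) h
      simp only [Finset.mem_filter, Finset.mem_univ, true_and] at hq hmax
      exact ⟨q, fun v hv => ⟨hq, hmax v hv⟩⟩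
    -- A node without predecessors is paired with itself, and the filter below drops it.
    · refine ⟨u, fun v hv => absurd ⟨v, by simpa using hv⟩ h⟩
  choose q hq using hch
  refine ⟨((List.finRange n).filter fun u => u ≠ q u).map fun u => (u, q u), ?_, ?_, ?_⟩
  · rw [List.length_map]
    exact (List.length_filter_le _ _).trans (by simp)
  · intro e he
    obtain ⟨u, hu, rfl⟩ := List.mem_map.1 he
    simpa using (List.mem_filter.1 hu).2
  · intro f₂ hf₂ hult₂ hQ
    -- Induction on the larger index. By maximality of `f u (q u)`, the path from `u` via `q u` to
    -- `v` has bottleneck at least `f u v`, and the pair of `q u` and `v` lies below `u`.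
    have key : ∀ N : ℕ, ∀ u v : Fin n, (u : ℕ) < N → v < u → f u v ≤ f₂ u v := by
      intro N
      induction N with
      | zero => intro u v h; omega
      | succ N ih =>
        intro u v hu hvu
        obtain ⟨hqu, hmax⟩ := hq u v hvu
        have hfq : f₂ u (q u) = f u (q u) := hQ (u, q u) (List.mem_map.2 ⟨u, by
          simp [hqu.ne'], rfl⟩)
        rcases eq_or_ne (q u) v with e | e
        · rw [← e, hfq]
        · have h1 := hult (q u) u v e
          rw [hf (q u) u, min_eq_right hmax] at h1
          have h2 : f (q u) v ≤ f₂ (q u) v := by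
            rcases lt_or_gt_of_ne e with h | h
            · rw [hf, hf₂]; exact ih v (q u) (by omega) h
            · exact ih (q u) v (by omega) h
          have h3 := hult₂ u (q u) v hvu.ne'
          rw [hfq] at h3
          exact (le_min hmax (h1.trans h2)).trans h3
    intro u v huv
    rcases lt_or_gt_of_ne huv with h | h
    · rw [hf, hf₂]; exact key n v u v.2 h
    · exact key n u v u.2 h

/-- The listing `L` with the capacities of `H`. -/
def relist {n : ℕ} (L : List (Fin n × Fin n × ℕ)) (H : CapGraph n) : List (Fin n × Fin n × ℕ) :=
  L.map fun e => (e.1, e.2.1, H.cap e.1 e.2.1)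

theorem CapGraph.IsListing.relist {n : ℕ} {G H : CapGraph n} {L : List (Fin n × Fin n × ℕ)}
    (hL : G.IsListing L) (h : H.graph = G.graph) : H.IsListing (relist L H) := by
  have e : ((FlowTree.relist L H).map fun e => s(e.1, e.2.1)) = L.map fun e => s(e.1, e.2.1) := by
    simp [FlowTree.relist, Function.comp_def]
  refine ⟨by rw [e]; exact hL.1, fun u v => ?_, fun x hx => ?_⟩
  · rw [e, ← hL.2.1 u v]
    show H.graph.Adj u v ↔ G.graph.Adj u v
    rw [h]
  · obtain ⟨y, -, rfl⟩ := List.mem_map.1 hx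
    rfl

/-- This pays for the perturbation phase, which reads all capacities. If preprocessing and the
queries of `exists_skeleton` left a capacity unread, lowering it by 1 would change none of the
answers, so no Max-Flow value would drop; yet the value between the ends of that edge does. -/
theorem lowerBound {F : ∀ n, Set (CapGraph n)} (hF : ClosedUnderPerturbation F)
    {D : DataStructure} {tp tmf : ℕ → ℕ} (hD : D.AnswersMaxFlow F tp tmf) (b : ℕ) :
    ∃ κ C : ℕ, ∀ n, 2 ≤ n → ∀ G ∈ F n, G.graph.Connected → (∀ u v, G.cap u v ≤ n ^ b) →
      ∀ L, G.IsListing L → ∀ w, n ^ κ ≤ 2 ^ w →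
        G.numEdges ≤ C * tp G.numEdges + n * (C * tmf G.numEdges) := by
  -- The graphs compared have capacities at most `2 * n ^ b + 1 ≤ n ^ (b + 2)`.
  obtain ⟨κ, C, h⟩ := hD (b + 2)
  refine ⟨κ, C, fun n hn G hGF hG hcap L hL w hw => ?_⟩
  have hmem : ∀ ρ : Fin L.length → ℕ, (∀ i, ρ i < 2) → G.shake L 2 ρ ∈ F n := fun ρ hρ =>
    hF n G hGF 2 _ (CapGraph.noise_comm L ρ) (hL.noise_lt two_pos hρ)
  have hgraph : ∀ ρ : Fin L.length → ℕ, (G.shake L 2 ρ).graph = G.graph := fun ρ =>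
    CapGraph.perturb_graph two_pos
  have hedges : ∀ ρ : Fin L.length → ℕ, (G.shake L 2 ρ).numEdges = G.numEdges := fun ρ =>
    CapGraph.perturb_numEdges two_pos
  have hbound : ∀ ρ : Fin L.length → ℕ, (∀ i, ρ i < 2) →
      ∀ u v, (G.shake L 2 ρ).cap u v ≤ n ^ (b + 2) := by
    intro ρ hρ u v
    rw [hL.shake_cap]
    have h1 := hcap u v
    have h2 := hL.noise_lt two_pos hρ u v
    have h3 : 1 ≤ n ^ b := Nat.one_le_pow _ _ (by omega)
    have h4 : 2 * 2 ≤ n * n := Nat.mul_le_mul hn hn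
    have h5 : n ^ b * (2 * 2) ≤ n ^ b * (n * n) := Nat.mul_le_mul_left _ h4
    rw [pow_add, pow_two]
    omega
  have hrun : ∀ ρ : Fin L.length → ℕ, (∀ i, ρ i < 2) → ∃ Inv : Mem → Prop,
      (∃ σ k, D.pre.Halts w (Mem.input (relist L (G.shake L 2 ρ))) σ k ∧ k ≤ C * tp G.numEdges ∧
        Inv σ) ∧ Answers D.qry w (G.shake L 2 ρ).maxFlow (C * tmf G.numEdges) Inv := by
    intro ρ hρ
    have := h n hn _ (hmem ρ hρ) (by rw [hgraph]; exact hG) (hbound ρ hρ) _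
      (hL.relist (hgraph ρ)) w hw
    rw [hedges] at this
    exact this
  -- Noise 1 on every edge leaves room to lower one capacity by 1 within the family: `K = 2` allows
  -- the noises 0 and 1.
  set G₁ := G.shake L 2 fun _ => 1 with hG₁
  obtain ⟨Inv, ⟨σ, k, hpre, hk, hσ⟩, hA⟩ := hrun (fun _ => 1) (fun _ => one_lt_two)
  obtain ⟨Q, hQ, hQne, hskel⟩ := exists_skeleton G₁.maxFlow_comm
    (fun u v w huw => G₁.min_le_maxFlow v huw)
  obtain ⟨T₁, hT₁, e₁⟩ := hpre.agreeOff
  obtain ⟨T₂, hT₂, e₂⟩ := hA.agreeOff Q hQne σ hσ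
  by_contra hlt
  rw [not_le] at hlt
  have hcard : (T₁ ∪ T₂).card < (Finset.range L.length).card := by
    rw [Finset.card_range, hL.length_eq]
    have h1 := Finset.card_union_le T₁ T₂
    have h2 := Nat.mul_le_mul_right (C * tmf G.numEdges) hQ
    omega
  obtain ⟨i, hi, hiT⟩ := Finset.exists_mem_notMem_of_card_lt_card hcard
  rw [Finset.mem_range] at hi
  rw [Finset.mem_union, not_or] at hiT
  set ρ : Fin L.length → ℕ := fun j => if j = ⟨i, hi⟩ then 0 else 1 with hρ
  have hρ2 : ∀ j, ρ j < 2 := fun j => by simp only [hρ]; split_ifs <;> omega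
  obtain ⟨Inv₂, ⟨σ₂, k₂, hpre₂, -, hσ₂⟩, hA₂⟩ := hrun ρ hρ2
  have hag : AgreeOff i (Mem.input (relist L G₁)) (Mem.input (relist L (G.shake L 2 ρ))) := by
    refine ⟨?_, fun a j hne => ?_⟩
    · simp [Mem.input, relist]
    · simp only [Mem.input]
      have e0 : ∀ H : CapGraph n, ((relist L H).map fun e => (e.1 : ℕ)) =
          L.map fun e => (e.1 : ℕ) := fun H => by simp [relist, Function.comp_def]
      have e1 : ∀ H : CapGraph n, ((relist L H).map fun e => (e.2.1 : ℕ)) =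
          L.map fun e => (e.2.1 : ℕ) := fun H => by simp [relist, Function.comp_def]
      simp only [e0, e1]
      split_ifs with h0 h1 h2
      · rfl
      · rfl
      · by_cases hj : j < L.length
        · have hji : (⟨j, hj⟩ : Fin L.length) ≠ ⟨i, hi⟩ := fun e => hne ⟨h2, by simpa using e⟩
          have hc : ∀ ρ : Fin L.length → ℕ, ((relist L (G.shake L 2 ρ)).map fun e => e.2.2).getD j 0
              = 2 * G.cap L[j].1 L[j].2.1 + ρ ⟨j, hj⟩ := by
            intro ρ
            rw [List.getD_eq_getElem _ _ (by simpa [relist] using hj)]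
            simp only [relist, List.getElem_map]
            rw [hL.shake_cap, ← hL.noise_getElem ρ ⟨j, hj⟩]
            rfl
          rw [hG₁, hc, hc]
          simp only [hρ, if_neg hji]
        · rw [List.getD_eq_default _ _ (by simpa [relist] using hj),
            List.getD_eq_default _ _ (by simpa [relist] using hj)]
      · rfl
  obtain ⟨τ, g, hτ⟩ := e₁ i hiT.1 _ hag
  have := hpre₂.unique g
  subst this
  have hsame := e₂ i hiT.2 _ _ _ hA₂ _ hτ hσ₂
  set G₂ := G.shake L 2 ρ with hG₂
  have hge := hskel G₂.maxFlow G₂.maxFlow_comm (fun u v w huw => G₂.min_le_maxFlow v huw) hsame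
  have hne : L[i].1 ≠ L[i].2.1 := by
    intro e
    have := hL.cap_pos ⟨i, hi⟩
    simp only [Fin.getElem_fin] at this
    rw [e, G.loopless] at this
    omega
  -- This cut crosses the unread edge, so it costs one less in `G₂`.
  obtain ⟨S, hs, ht, hS⟩ := G₁.exists_minCut hne
  have h1 := hge _ _ hne
  have h2 := G₂.maxFlow_le_cutValue hs ht
  have h3 := (isoWeight_of_eq_off (a := fun S => 2 * G.cutValue S) (X := CapGraph.crossing L)
    (ρ := ρ) (ρ' := fun _ => 1) (i := ⟨i, hi⟩) (fun j hj => by simp only [hρ, if_neg hj]) S).2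
    (by simp [CapGraph.crossing, hs, ht])
  rw [← hL.shake_cutValue, ← hL.shake_cutValue, ← hG₁, ← hG₂] at h3
  simp only [hρ, if_true] at h3
  omega

end lowerBound

/-! ## Executions of randomized programs -/

section semantics

variable {D : DataStructure} {w : ℕ}

theorem andThen_pure_some (τ : Config) (f : Config → PMF (Option Config)) :
    andThen (PMF.pure (some τ)) f = f τ := by
  simp [andThen, PMF.pure_bind]

theorem andThen_assoc (μ : PMF (Option Config)) (f g : Config → PMF (Option Config)) :
    andThen (andThen μ f) g = andThen μ fun τ => andThen (f τ) g := by
  unfold andThen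
  rw [PMF.bind_bind]
  congr 1
  funext o
  cases o <;> simp [PMF.pure_bind]

/-- The program `p` certainly goes from `τ` to `τ'`, when the fuel exceeds the time at `τ'`. -/
def Runs (D : DataStructure) (w : ℕ) (p : Prog) (τ τ' : Config) : Prop :=
  τ.time ≤ τ'.time ∧ ∀ fuel, τ'.time < fuel → p.exec D w fuel τ = PMF.pure (some τ')

theorem Runs.instr (i : Instr) (τ : Config) :
    Runs D w (.instr i) τ { τ.tick with mem := i.step w τ.mem } :=
  ⟨Nat.le_succ _, fun _ _ => rfl⟩

theorem Runs.seq {p q : Prog} {τ₁ τ₂ τ₃ : Config} (hp : Runs D w p τ₁ τ₂)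
    (hq : Runs D w q τ₂ τ₃) : Runs D w (.seq p q) τ₁ τ₃ := by
  refine ⟨hp.1.trans hq.1, fun fuel hf => ?_⟩
  rw [Prog.exec, hp.2 fuel (hq.1.trans_lt hf), andThen_pure_some, hq.2 fuel hf]

theorem Runs.ite_pos {x : ℕ} {p q : Prog} {τ τ' : Config} (hx : τ.mem.reg x ≠ 0)
    (hp : Runs D w p τ.tick τ') : Runs D w (.ite x p q) τ τ' := by
  refine ⟨(Nat.le_succ _).trans hp.1, fun fuel hf => ?_⟩
  rw [Prog.exec, if_neg hx, hp.2 fuel hf]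

theorem Runs.ite_neg {x : ℕ} {p q : Prog} {τ τ' : Config} (hx : τ.mem.reg x = 0)
    (hq : Runs D w q τ.tick τ') : Runs D w (.ite x p q) τ τ' := by
  refine ⟨(Nat.le_succ _).trans hq.1, fun fuel hf => ?_⟩
  rw [Prog.exec, if_pos hx, hq.2 fuel hf]

theorem Runs.preprocess {τ : Config} {σ : Mem} {k : ℕ}
    (h : D.pre.Halts w τ.mem.graphPart σ k) :
    Runs D w .preprocess τ { τ with ds := σ, time := τ.time + 1 + k } := by
  refine ⟨by dsimp only; omega, fun fuel hf => ?_⟩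
  dsimp only at hf
  rw [Prog.exec, h.exec_eq _ (by omega)]
  rfl

theorem Runs.query {τ : Config} {d x y : ℕ} {σ : Mem} {k : ℕ}
    (h : D.qry.Halts w (askMem τ.ds (τ.mem.reg x) (τ.mem.reg y)) σ k) :
    Runs D w (.query d x y) τ
      ⟨τ.mem.setReg d (σ.reg 0), σ, τ.time + 1 + k, τ.queries + 1⟩ := by
  refine ⟨by dsimp only; omega, fun fuel hf => ?_⟩
  dsimp only at hf
  rw [Prog.exec, h.exec_eq _ (by omega)]
  rfl

/-- Several instructions, one after the other. -/
def block (i : Instr) : List Instr → Prog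
  | [] => .instr i
  | j :: l => .seq (.instr i) (block j l)

/-- The effect of several instructions. -/
def steps (w : ℕ) (l : List Instr) (σ : Mem) : Mem := l.foldl (fun σ i => i.step w σ) σ

theorem Runs.block (i : Instr) (l : List Instr) (τ : Config) :
    Runs D w (block i l) τ
      { τ with mem := steps w (i :: l) τ.mem, time := τ.time + (l.length + 1) } := by
  induction l generalizing i τ with
  | nil => exact Runs.instr i τ
  | cons j l ih =>
    have e : τ.time + ((j :: l).length + 1) = τ.time + 1 + (l.length + 1) := by
      simp only [List.length_cons]; omega
    rw [e]
    exact (Runs.instr (D := D) (w := w) i τ).seq (ih j _)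

/-- A loop whose test register counts down, with the invariant `I`. -/
theorem Runs.countdown {x : ℕ} {p : Prog} (I : ℕ → Config → Prop)
    (hreg : ∀ k τ, I k τ → τ.mem.reg x = k)
    (hstep : ∀ k τ, I (k + 1) τ → ∃ τ', Runs D w p τ.tick τ' ∧ I k τ') (k : ℕ) :
    ∀ τ, I k τ → ∃ τ', Runs D w (.loop x p) τ τ'.tick ∧ I 0 τ' := by
  -- Every test takes a step, so fuel exceeding the final time also exceeds the number of tests.
  suffices H : ∀ τ, I k τ → ∃ τ', I 0 τ' ∧ τ.time + k ≤ τ'.time ∧ ∀ F f, τ'.time + 1 < F →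
      k < f → Prog.iter x (p.exec D w F) f τ = PMF.pure (some τ'.tick) by
    intro τ hτ
    obtain ⟨τ', h0, ht, h⟩ := H τ hτ
    refine ⟨τ', ⟨by simp only [Config.tick]; omega, fun fuel hf => ?_⟩, h0⟩
    simp only [Config.tick] at hf
    rw [Prog.exec, h fuel fuel hf (by omega)]
  induction k with
  | zero =>
    intro τ hτ
    refine ⟨τ, hτ, le_rfl, fun F f _ hf => ?_⟩
    obtain ⟨f, rfl⟩ : ∃ g, f = g + 1 := ⟨f - 1, by omega⟩
    rw [Prog.iter, if_pos (hreg 0 τ hτ)]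
  | succ k ih =>
    intro τ hτ
    obtain ⟨τ₁, hr, h1⟩ := hstep k τ hτ
    obtain ⟨τ', h0, ht, h⟩ := ih τ₁ h1
    have ht1 := hr.1
    simp only [Config.tick] at ht1
    refine ⟨τ', h0, by omega, fun F f hF hf => ?_⟩
    obtain ⟨f, rfl⟩ : ∃ g, f = g + 1 := ⟨f - 1, by omega⟩
    rw [Prog.iter, if_neg (by rw [hreg _ τ hτ]; omega), hr.2 F (by omega), andThen_pure_some,
      h F f hF (by omega)]

theorem Runs.exec_andThen {p : Prog} {τ τ' : Config} (h : Runs D w p τ τ') {fuel : ℕ}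
    (hf : τ'.time < fuel) (f : Config → PMF (Option Config)) :
    andThen (p.exec D w fuel τ) f = f τ' := by
  rw [h.2 fuel hf, andThen_pure_some]

/-- A random draw averages the probability of an event. -/
theorem rand_andThen {d x k fuel : ℕ} {τ : Config} (hx : τ.mem.reg x = k) (hk : 0 < k)
    (f : Config → PMF (Option Config)) (S : Set (Option Config)) :
    (andThen ((Prog.rand d x).exec D w fuel τ) f).toOuterMeasure S =
      (k : ENNReal)⁻¹ * ∑ j : Fin k,
        (f { τ.tick with mem := τ.mem.setReg d j }).toOuterMeasure S := by
  obtain ⟨k, rfl⟩ : ∃ k', k = k' + 1 := ⟨k - 1, by omega⟩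
  have hk' : τ.mem.reg x - 1 + 1 = k + 1 := by omega
  have e : (Prog.rand d x).exec D w fuel τ =
      (PMF.uniformOfFintype (Fin (τ.mem.reg x - 1 + 1))).bind fun j =>
        PMF.pure (some { τ.tick with mem := τ.mem.setReg d j }) := by
    rw [Prog.exec]
    change (((PMF.uniformOfFintype (Fin (τ.mem.reg x - 1 + 1))).bind fun a =>
      PMF.pure (a : ℕ)).map _) = _
    rw [PMF.map, PMF.bind_bind]
    simp only [PMF.pure_bind, Function.comp_def]
  rw [e, andThen, PMF.bind_bind, PMF.toOuterMeasure_bind_apply, tsum_fintype,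
    Finset.mul_sum, ← Fin.sum_congr' _ hk']
  refine Finset.sum_congr rfl fun j _ => ?_
  simp only [PMF.uniformOfFintype_apply, Fintype.card_fin, PMF.pure_bind, Option.elim_some,
    Fin.val_cast]
  rw [show ((τ.mem.reg x - 1 + 1 : ℕ) : ENNReal) = ((k + 1 : ℕ) : ENNReal) by rw [hk']]

theorem toOuterMeasure_le_one {α : Type*} (μ : PMF α) (S : Set α) : μ.toOuterMeasure S ≤ 1 := by
  rw [PMF.toOuterMeasure_apply, ← μ.tsum_coe]
  exact ENNReal.tsum_le_tsum fun a => Set.indicator_le_self _ _ a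

theorem one_le_add_compl {α : Type*} (μ : PMF α) (S : Set α) :
    1 ≤ μ.toOuterMeasure S + μ.toOuterMeasure Sᶜ := by
  rw [← μ.tsum_coe, PMF.toOuterMeasure_apply, PMF.toOuterMeasure_apply, ← ENNReal.tsum_add]
  refine ENNReal.tsum_le_tsum fun a => ?_
  by_cases h : a ∈ S <;> simp [h]

end semantics

/-! ## Frames -/

section frames

/-- At most the registers in `rs` and the arrays in `as` have changed. -/
def Frame (rs as : Set ℕ) (σ σ' : Mem) : Prop :=
  (∀ r, r ∉ rs → σ'.reg r = σ.reg r) ∧ ∀ a, a ∉ as → σ'.arr a = σ.arr a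

variable {rs as : Set ℕ} {σ σ₁ σ₂ : Mem}

theorem Frame.refl : Frame rs as σ σ := ⟨fun _ _ => rfl, fun _ _ => rfl⟩

theorem Frame.trans (h₁ : Frame rs as σ σ₁) (h₂ : Frame rs as σ₁ σ₂) : Frame rs as σ σ₂ :=
  ⟨fun r hr => (h₂.1 r hr).trans (h₁.1 r hr), fun a ha => (h₂.2 a ha).trans (h₁.2 a ha)⟩

theorem Frame.mono {rs' as' : Set ℕ} (h : Frame rs as σ σ₁) (hr : rs ⊆ rs') (ha : as ⊆ as') :
    Frame rs' as' σ σ₁ :=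
  ⟨fun r h' => h.1 r fun h'' => h' (hr h''), fun a h' => h.2 a fun h'' => h' (ha h'')⟩

theorem Frame.setReg {d x : ℕ} (h : Frame rs as σ σ₁) (hd : d ∈ rs) :
    Frame rs as σ (σ₁.setReg d x) := by
  refine ⟨fun r hr => ?_, h.2⟩
  have : r ≠ d := fun e => hr (e ▸ hd)
  simp only [Mem.setReg, Function.update_of_ne this]
  exact h.1 r hr

theorem Frame.setArr {a i x : ℕ} (h : Frame rs as σ σ₁) (ha : a ∈ as) :
    Frame rs as σ (σ₁.setArr a i x) := by
  refine ⟨h.1, fun b hb => ?_⟩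
  have : b ≠ a := fun e => hb (e ▸ ha)
  simp only [Mem.setArr, Function.update_of_ne this]
  exact h.2 b hb

/-- The instruction writes only to the registers in `rs` and the arrays in `as`. -/
def Instr.WritesIn (rs as : Set ℕ) : Instr → Prop
  | .const d _ => d ∈ rs
  | .op _ d _ _ => d ∈ rs
  | .load d _ _ => d ∈ rs
  | .store a _ _ => a ∈ as

theorem Frame.steps {w : ℕ} {l : List Instr} (hl : ∀ i ∈ l, i.WritesIn rs as) (σ : Mem) :
    Frame rs as σ (steps w l σ) := by
  induction l generalizing σ with
  | nil => exact .refl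
  | cons i l ih =>
    have h1 : Frame rs as σ (i.step w σ) := by
      have := hl i (by simp)
      cases i with
      | const d k => exact Frame.refl.setReg this
      | op o d x y => exact Frame.refl.setReg this
      | load d a j => exact Frame.refl.setReg this
      | store a j x => exact Frame.refl.setArr this
    exact h1.trans (ih (fun j hj => hl j (by simp [hj])) _)

end frames

/-! ## Loops over the nodes -/

/-- Repeat `p`, whose first instruction has to decrement register `7`, as often as register `N`
says; register `2` holds the number `1`. -/
def forLoop (N : ℕ) (p : Prog) : Prog := .seq (.instr (.op .mul 7 N 2)) (.loop 7 p)

theorem Runs.forLoop {D : DataStructure} {w : ℕ} {N n : ℕ} {p : Prog} {τ : Config}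
    (hN : τ.mem.reg N = n) (h2 : τ.mem.reg 2 = 1) (hnw : n < 2 ^ w) (J : ℕ → Config → Prop)
    (hreg : ∀ k τ, J k τ → τ.mem.reg 7 = k)
    (hinit : J n { τ.tick with mem := τ.mem.setReg 7 n })
    (hstep : ∀ k τ, J (k + 1) τ → ∃ τ', Runs D w p τ.tick τ' ∧ J k τ') :
    ∃ τ', Runs D w (forLoop N p) τ τ'.tick ∧ J 0 τ' := by
  obtain ⟨τ', h, h0⟩ := Runs.countdown (D := D) (w := w) J hreg hstep n _ hinit
  refine ⟨τ', Runs.seq ?_ h, h0⟩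
  have := Runs.instr (D := D) (w := w) (.op .mul 7 N 2) τ
  simpa only [Instr.step, Op.eval, hN, h2, mul_one, Nat.mod_eq_of_lt hnw] using this

/-- Assign ranks within the classes of the labels in array `3` (to array `5`), and count the
classes (in array `4`). -/
def countBody : Prog :=
  block (.op .sub 7 7 2)
    [.load 8 3 7, .load 9 4 8, .store 5 7 9, .op .add 9 9 2, .store 4 8 9]

/-- For a random number in register `6`, store the pivots of the classes in array `6`. -/
def pivotBody : Prog :=
  .seq (block (.op .sub 7 7 2)
      [.load 8 3 7, .load 9 4 8, .op .mod 10 6 9, .load 9 5 7, .op .eq 11 10 9])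
    (.ite 11 (.instr (.store 6 8 7)) (.instr (.const 10 0)))

/-- Query the Max-Flow values between the nodes and the pivots of their classes, store them in
array `8`, enter the nodes into the table in array `7`, and clear array `4`. -/
def queryBody : Prog :=
  .seq (block (.op .sub 7 7 2) [.load 8 3 7, .load 12 6 8, .op .eq 11 12 7])
    (.seq (.ite 11 (.instr (.const 13 0)) (.query 13 12 7))
      (block (.op .mul 14 13 0)
        [.op .add 14 14 8, .store 7 14 7, .store 8 7 13, .const 9 0, .store 4 7 9]))

/-- Look up the new labels in the table, and append the new edges to the listing in register `1`
and arrays `0`, `1`, `2`. -/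
def relabelBody : Prog :=
  .seq (block (.op .sub 7 7 2)
      [.load 8 3 7, .load 12 6 8, .load 13 8 7, .op .mul 14 13 0, .op .add 14 14 8,
        .load 15 7 14, .store 3 7 15, .op .eq 11 15 7, .const 10 0, .op .lt 10 10 13,
        .op .mul 11 11 10])
    (.ite 11
      (block (.store 0 1 12) [.store 1 1 7, .op .div 13 13 4, .store 2 1 13, .op .add 1 1 2])
      (.instr (.const 10 0)))

section loops

variable {D : DataStructure} {w n : ℕ} {lab lab' piv : Fin n → Fin n} {τ : Config}

theorem card_filter_ge {k : ℕ} (hk : k < n) (P : Fin n → Prop) [DecidablePred P] :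
    (Finset.univ.filter fun u : Fin n => k ≤ u ∧ P u).card =
      (Finset.univ.filter fun u : Fin n => k + 1 ≤ u ∧ P u).card +
        if P ⟨k, hk⟩ then 1 else 0 := by
  split_ifs with h
  · rw [← Finset.card_insert_of_notMem (a := ⟨k, hk⟩) (by simp)]
    congr 1
    ext u
    simp only [Finset.mem_filter, Finset.mem_univ, true_and, Finset.mem_insert, Fin.ext_iff]
    constructor
    · rintro ⟨h1, h2⟩
      rcases eq_or_ne (u : ℕ) k with e | e
      · exact .inl e
      · exact .inr ⟨by omega, h2⟩
    · rintro (e | ⟨h1, h2⟩)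
      · have : u = ⟨k, hk⟩ := Fin.ext e
        exact ⟨by omega, this ▸ h⟩
      · exact ⟨by omega, h2⟩
  · rw [add_zero]
    congr 1
    ext u
    simp only [Finset.mem_filter, Finset.mem_univ, true_and]
    constructor
    · rintro ⟨h1, h2⟩
      rcases eq_or_ne (u : ℕ) k with e | e
      · have : u = ⟨k, hk⟩ := Fin.ext e
        exact absurd (this ▸ h2) h
      · exact ⟨by omega, h2⟩
    · rintro ⟨h1, h2⟩
      exact ⟨by omega, h2⟩

theorem card_filter_ge_self (P : Fin n → Prop) [DecidablePred P] :
    (Finset.univ.filter fun u : Fin n => n ≤ u ∧ P u).card = 0 := by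
  rw [Finset.card_eq_zero]
  ext u
  simp only [Finset.mem_filter, Finset.mem_univ, true_and, Finset.notMem_empty, iff_false]
  omega

/-- The loop runs downwards, so the count found at a node is the number of later nodes of its class,
that is, its rank. Registers from 7 on are scratch; registers 0 to 6 hold `n`, the length of the
listing, 1, the range `R`, the scale `K`, the round counter and the random number. -/
theorem count_run (h0 : τ.mem.reg 0 = n) (h2 : τ.mem.reg 2 = 1) (hnw : n + 1 < 2 ^ w)
    (hlab : ∀ v : Fin n, τ.mem.arr 3 v = lab v) (hcnt : ∀ v : Fin n, τ.mem.arr 4 v = 0) :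
    ∃ τ', Runs D w (forLoop 0 countBody) τ τ' ∧ Frame (Set.Ici 7) {4, 5} τ.mem τ'.mem ∧
      τ'.ds = τ.ds ∧ τ'.queries = τ.queries ∧ τ'.time ≤ τ.time + 7 * n + 2 ∧
      (∀ v : Fin n, τ'.mem.arr 5 v = rankIn lab v) ∧
      ∀ l : Fin n, τ'.mem.arr 4 l = classSize lab l := by
  let J (k : ℕ) (τ' : Config) : Prop := τ'.mem.reg 7 = k ∧ k ≤ n ∧
    Frame (Set.Ici 7) {4, 5} τ.mem τ'.mem ∧
    τ'.ds = τ.ds ∧ τ'.queries = τ.queries ∧ τ'.time + 7 * k ≤ τ.time + 7 * n + 1 ∧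
    (∀ v : Fin n, k ≤ v → τ'.mem.arr 5 v = rankIn lab v) ∧
    ∀ l : Fin n, τ'.mem.arr 4 l = (Finset.univ.filter fun u : Fin n => k ≤ u ∧ lab u = l).card
  obtain ⟨τ', hr, -, -, hfr, hds, hq, ht, h5, h4⟩ :=
    Runs.forLoop (D := D) (w := w) (p := countBody) h0 h2 (by omega) J (fun k τ h => h.1)
    (by
      refine ⟨by simp [Mem.setReg], le_rfl, Frame.refl.setReg (by simp), rfl, rfl, ?_, ?_, ?_⟩
      · simp only [Config.tick]; omega
      · intro v hv; omega
      · intro l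
        rw [card_filter_ge_self]
        exact hcnt l)
    (by
      rintro k τ₁ ⟨h7, hk, hfr, hds, hq, ht, h5, h4⟩
      refine ⟨_, Runs.block _ _ _, ?_⟩
      have hv : k < n := by omega
      have e2 : τ₁.mem.reg 2 = 1 := by rw [hfr.1 2 (by simp)]; exact h2
      have e3 : τ₁.mem.arr 3 k = lab ⟨k, hv⟩ := by
        rw [hfr.2 3 (by simp)]; exact hlab ⟨k, hv⟩
      have hcard : (Finset.univ.filter fun u : Fin n => k + 1 ≤ u ∧ lab u = lab ⟨k, hv⟩).card =
          rankIn lab ⟨k, hv⟩ := by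
        unfold rankIn; congr 1
      have e4 : τ₁.mem.arr 4 (lab ⟨k, hv⟩) = rankIn lab ⟨k, hv⟩ := by rw [h4, hcard]
      have hle : rankIn lab ⟨k, hv⟩ ≤ n := (Finset.card_le_univ _).trans (by simp)
      have m1 : (rankIn lab ⟨k, hv⟩ + 1) % 2 ^ w = rankIn lab ⟨k, hv⟩ + 1 :=
        Nat.mod_eq_of_lt (by omega)
      have m2 : k % 2 ^ w = k := Nat.mod_eq_of_lt (by omega)
      refine ⟨?_, by omega, hfr.trans (Frame.steps (by simp [Instr.WritesIn]) _), hds, hq, ?_, ?_, ?_⟩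
      · simp [steps, Instr.step, Op.eval, Mem.setReg, Mem.setArr, Config.tick, h7, e2, m2]
      · simp only [Config.tick, List.length_cons, List.length_nil]; omega
      · intro v hkv
        simp only [steps, List.foldl, Instr.step, Op.eval, Mem.setReg, Mem.setArr, Config.tick]
        simp [h7, e2, m2, e3, e4]
        rw [Function.update_apply]
        split_ifs with hvk
        · congr 1; exact Fin.ext hvk.symm
        · exact h5 v (by omega)
      · intro l
        simp only [steps, List.foldl, Instr.step, Op.eval, Mem.setReg, Mem.setArr, Config.tick]
        simp [h7, e2, m2, e3, e4, m1]
        rw [Function.update_apply, card_filter_ge hv]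
        by_cases h : l = lab ⟨k, hv⟩
        · rw [if_pos (by rw [h]), if_pos h.symm, ← hcard, h]
        · rw [if_neg (fun e => h (Fin.ext e)), if_neg (fun e => h e.symm), h4, add_zero])
  refine ⟨_, hr, hfr, hds, hq, ?_, fun v => h5 v (Nat.zero_le _), fun l => ?_⟩
  · simp only [Config.tick]; omega
  · simp only [Config.tick, h4, classSize, Nat.zero_le, true_and]

theorem pivot_run {x : ℕ} (h0 : τ.mem.reg 0 = n) (h2 : τ.mem.reg 2 = 1) (h6 : τ.mem.reg 6 = x)
    (hnw : n + 1 < 2 ^ w)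
    (hlab : ∀ v : Fin n, τ.mem.arr 3 v = lab v)
    (hrank : ∀ v : Fin n, τ.mem.arr 5 v = rankIn lab v)
    (hcnt : ∀ l : Fin n, τ.mem.arr 4 l = classSize lab l) :
    ∃ τ', Runs D w (forLoop 0 pivotBody) τ τ' ∧ Frame (Set.Ici 7) {6} τ.mem τ'.mem ∧
      τ'.ds = τ.ds ∧ τ'.queries = τ.queries ∧ τ'.time ≤ τ.time + 9 * n + 2 ∧
      ∃ piv : Fin n → Fin n, ∀ v : Fin n, τ'.mem.arr 6 (lab v) = piv (lab v) ∧
        lab (piv (lab v)) = lab v ∧ IsPivot lab x (piv (lab v)) := by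
  let J (k : ℕ) (τ' : Config) : Prop := τ'.mem.reg 7 = k ∧ k ≤ n ∧
    Frame (Set.Ici 7) {6} τ.mem τ'.mem ∧
    τ'.ds = τ.ds ∧ τ'.queries = τ.queries ∧ τ'.time + 9 * k ≤ τ.time + 9 * n + 1 ∧
    (∀ v : Fin n, k ≤ v → IsPivot lab x v →
      ∃ p : Fin n, τ'.mem.arr 6 (lab v) = p ∧ lab p = lab v ∧ IsPivot lab x p)
  obtain ⟨τ', hr, -, -, hfr, hds, hq, ht, h6'⟩ :=
    Runs.forLoop (D := D) (w := w) (p := pivotBody) h0 h2 (by omega) J (fun k τ h => h.1)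
    (by
      refine ⟨by simp [Mem.setReg], le_rfl, Frame.refl.setReg (by simp), rfl, rfl, ?_, ?_⟩
      · simp only [Config.tick]; omega
      · intro v hv; omega)
    (by
      rintro k τ₁ ⟨h7, hk, hfr, hds, hq, ht, hp⟩
      have hv : k < n := by omega
      have e2 : τ₁.mem.reg 2 = 1 := by rw [hfr.1 2 (by simp)]; exact h2
      have e6 : τ₁.mem.reg 6 = x := by rw [hfr.1 6 (by simp)]; exact h6
      have e3 : τ₁.mem.arr 3 k = lab ⟨k, hv⟩ := by
        rw [hfr.2 3 (by simp)]; exact hlab ⟨k, hv⟩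
      have e4 : τ₁.mem.arr 4 (lab ⟨k, hv⟩) = classSize lab (lab ⟨k, hv⟩) := by
        rw [hfr.2 4 (by simp)]; exact hcnt _
      have e5 : τ₁.mem.arr 5 k = rankIn lab ⟨k, hv⟩ := by
        rw [hfr.2 5 (by simp)]; exact hrank ⟨k, hv⟩
      have hpos : 0 < classSize lab (lab ⟨k, hv⟩) :=
        (Nat.zero_le _).trans_lt (rankIn_lt_classSize lab ⟨k, hv⟩)
      have hle : classSize lab (lab ⟨k, hv⟩) ≤ n := (Finset.card_le_univ _).trans (by simp)
      have hmod := Nat.mod_lt x hpos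
      have m1 : x % classSize lab (lab ⟨k, hv⟩) % 2 ^ w = x % classSize lab (lab ⟨k, hv⟩) :=
        Nat.mod_eq_of_lt (by omega)
      have m2 : k % 2 ^ w = k := Nat.mod_eq_of_lt (by omega)
      have m3 : 1 % 2 ^ w = 1 := Nat.mod_eq_of_lt (by omega)
      set σ := steps w (.op .sub 7 7 2 :: [.load 8 3 7, .load 9 4 8, .op .mod 10 6 9, .load 9 5 7,
        .op .eq 11 10 9]) τ₁.mem with hσ
      have s7 : σ.reg 7 = k := by
        simp [hσ, steps, Instr.step, Op.eval, Mem.setReg, h7, e2, m2]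
      have s8 : σ.reg 8 = lab ⟨k, hv⟩ := by
        simp [hσ, steps, Instr.step, Op.eval, Mem.setReg, h7, e2, m2, e3]
      have s11 : σ.reg 11 =
          if x % classSize lab (lab ⟨k, hv⟩) = rankIn lab ⟨k, hv⟩ then 1 else 0 := by
        simp only [hσ, steps, List.foldl, Instr.step, Op.eval, Mem.setReg, Function.update_apply]
        simp [h7, e2, m2, e3, e4, e5, e6, m1]
        split_ifs <;> simp [m3]
      have sfr : Frame (Set.Ici 7) {6} τ₁.mem σ := Frame.steps (by simp [Instr.WritesIn]) _
      have hr1 := Runs.block (D := D) (w := w) (.op .sub 7 7 2)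
        [.load 8 3 7, .load 9 4 8, .op .mod 10 6 9, .load 9 5 7, .op .eq 11 10 9] τ₁.tick
      by_cases hpk : IsPivot lab x ⟨k, hv⟩
      · rw [if_pos (show _ % _ = _ from hpk)] at s11
        refine ⟨_, hr1.seq (Runs.ite_pos (by
          show σ.reg 11 ≠ 0
          omega) (Runs.instr _ _)), ?_⟩
        refine ⟨s7, by omega, (hfr.trans sfr).setArr (by simp), hds, hq, ?_, ?_⟩
        · simp only [Config.tick, List.length_cons, List.length_nil]; omega
        · intro v hkv hpv
          have a6 : ∀ l, (σ.setArr 6 (σ.reg 8) (σ.reg 7)).arr 6 l =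
              if l = lab ⟨k, hv⟩ then k else σ.arr 6 l := by
            intro l
            simp [Mem.setArr, s7, s8, Function.update_apply]
          change ∃ p : Fin n, (σ.setArr 6 (σ.reg 8) (σ.reg 7)).arr 6 (lab v) = p ∧ _
          by_cases hl : lab v = lab ⟨k, hv⟩
          · exact ⟨⟨k, hv⟩, by rw [a6, hl, if_pos rfl], hl.symm, hpk⟩
          · obtain ⟨p, hp1, hp2⟩ := hp v (by
              rcases eq_or_ne (v : ℕ) k with e | e
              · exact absurd (congrArg lab (Fin.ext e)) hl
              · omega) hpv
            refine ⟨p, ?_, hp2⟩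
            rw [a6, if_neg (fun e => hl (Fin.ext e)), ← hp1]
            rfl
      · rw [if_neg (show ¬ _ % _ = _ from hpk)] at s11
        refine ⟨_, hr1.seq (Runs.ite_neg (by
          show σ.reg 11 = 0
          omega) (Runs.instr _ _)), ?_⟩
        refine ⟨?_, by omega, (hfr.trans sfr).setReg (by simp), hds, hq, ?_, ?_⟩
        · show (σ.setReg 10 (0 % 2 ^ w)).reg 7 = k
          simpa [Mem.setReg] using s7
        · simp only [Config.tick, List.length_cons, List.length_nil]; omega
        · intro v hkv hpv
          exact hp v (by
              rcases eq_or_ne (v : ℕ) k with e | e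
              · exact absurd ((Fin.ext e : v = ⟨k, hv⟩) ▸ hpv) hpk
              · omega) hpv)
  refine ⟨_, hr, hfr, hds, hq, ?_, ?_⟩
  · simp only [Config.tick]; omega
  · have : ∀ l : Fin n, ∃ p : Fin n, ∀ v, lab v = l →
        τ'.mem.arr 6 l = p ∧ lab p = l ∧ IsPivot lab x p := by
      intro l
      by_cases h : ∃ v, lab v = l
      · obtain ⟨v, rfl⟩ := h
        obtain ⟨u, hu, hpu⟩ := exists_pivot lab x v
        obtain ⟨p, hp1, hp2, hp3⟩ := h6' u (Nat.zero_le _) hpu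
        rw [hu] at hp1 hp2
        exact ⟨p, fun _ _ => ⟨hp1, hp2, hp3⟩⟩
      -- An unused label gets an arbitrary pivot.
      · exact ⟨l, fun v hv => absurd ⟨v, hv⟩ h⟩
    choose piv hpiv using this
    exact ⟨piv, fun v => hpiv (lab v) v rfl⟩

end loops

/-! ### Splitting the classes by their Max-Flow values. -/

section loops

variable {D : DataStructure} {w n : ℕ} {lab lab' piv : Fin n → Fin n} {τ : Config}

/-- The number under which a node is entered into the table. -/
def nodeKey (f : Fin n → Fin n → ℕ) (lab piv : Fin n → Fin n) (v : Fin n) : ℕ :=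
  f (piv (lab v)) v * n + lab v

/-- As labels are below `n`, the key has the value and the label as its digits in base `n`. -/
theorem nodeKey_eq_iff {f : Fin n → Fin n → ℕ} {u v : Fin n} :
    nodeKey f lab piv u = nodeKey f lab piv v ↔
      lab u = lab v ∧ f (piv (lab u)) u = f (piv (lab v)) v := by
  unfold nodeKey
  constructor
  · intro h
    have h1 := congrArg (· % n) h
    simp only [Nat.mul_add_mod_self_right, Nat.mod_eq_of_lt (lab u).2,
      Nat.mod_eq_of_lt (lab v).2] at h1
    have hn : 0 < n := (Nat.zero_le _).trans_lt u.2
    have h2 : f (piv (lab u)) u * n = f (piv (lab v)) v * n := by omega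
    exact ⟨Fin.ext h1, Nat.eq_of_mul_eq_mul_right hn h2⟩
  · rintro ⟨h1, h2⟩
    rw [h2, h1]

/-- The table needs no clearing, because only keys written in the same round are looked up. The node
entered last under a key becomes the representative of the new class. -/
theorem query_run {f : Fin n → Fin n → ℕ} {B : ℕ} {Inv : Mem → Prop}
    (h0 : τ.mem.reg 0 = n) (h2 : τ.mem.reg 2 = 1) (hnw : n + 1 < 2 ^ w)
    (hf0 : ∀ u, f u u = 0) (hfw : ∀ u v, f u v * n + n < 2 ^ w)
    (hans : Answers D.qry w f B Inv) (hinv : Inv τ.ds)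
    (hlab : ∀ v : Fin n, τ.mem.arr 3 v = lab v)
    (hpiv : ∀ v : Fin n, τ.mem.arr 6 (lab v) = piv (lab v)) :
    ∃ τ', Runs D w (forLoop 0 queryBody) τ τ' ∧ Frame (Set.Ici 7) {4, 7, 8} τ.mem τ'.mem ∧
      Inv τ'.ds ∧ τ'.queries ≤ τ.queries + n ∧ τ'.time ≤ τ.time + (B + 13) * n + 2 ∧
      (∀ v : Fin n, τ'.mem.arr 4 v = 0) ∧
      (∀ v : Fin n, τ'.mem.arr 8 v = f (piv (lab v)) v) ∧
      ∀ v : Fin n, ∃ u : Fin n, τ'.mem.arr 7 (nodeKey f lab piv v) = u ∧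
        nodeKey f lab piv u = nodeKey f lab piv v := by
  let J (k : ℕ) (τ' : Config) : Prop := τ'.mem.reg 7 = k ∧ k ≤ n ∧
    Frame (Set.Ici 7) {4, 7, 8} τ.mem τ'.mem ∧
    Inv τ'.ds ∧ τ'.queries + k ≤ τ.queries + n ∧
    τ'.time + (B + 13) * k ≤ τ.time + (B + 13) * n + 1 ∧
    (∀ v : Fin n, k ≤ v → τ'.mem.arr 4 v = 0) ∧
    (∀ v : Fin n, k ≤ v → τ'.mem.arr 8 v = f (piv (lab v)) v) ∧
    ∀ v : Fin n, k ≤ v → ∃ u : Fin n, τ'.mem.arr 7 (nodeKey f lab piv v) = u ∧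
        nodeKey f lab piv u = nodeKey f lab piv v
  obtain ⟨τ', hr, -, -, hfr, hds, hq, ht, h4, h8, h7⟩ :=
    Runs.forLoop (D := D) (w := w) (p := queryBody) h0 h2 (by omega) J (fun k τ h => h.1)
    (by
      refine ⟨by simp [Mem.setReg], le_rfl, Frame.refl.setReg (by simp), hinv, le_rfl, ?_,
        ?_, ?_, ?_⟩
      · simp only [Config.tick]; omega
      all_goals intro v hv; omega)
    (by
      rintro k τ₁ ⟨h7, hk, hfr, hds, hq, ht, h4, h8, hmap⟩
      have hv : k < n := by omega
      set v₀ : Fin n := ⟨k, hv⟩ with hv₀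
      have e0 : τ₁.mem.reg 0 = n := by rw [hfr.1 0 (by simp)]; exact h0
      have e2 : τ₁.mem.reg 2 = 1 := by rw [hfr.1 2 (by simp)]; exact h2
      have e3 : τ₁.mem.arr 3 k = lab v₀ := by
        rw [hfr.2 3 (by simp)]; exact hlab v₀
      have e6 : τ₁.mem.arr 6 (lab v₀) = piv (lab v₀) := by
        rw [hfr.2 6 (by simp)]; exact hpiv v₀
      have m2 : k % 2 ^ w = k := Nat.mod_eq_of_lt (by omega)
      have m3 : 1 % 2 ^ w = 1 := Nat.mod_eq_of_lt (by omega)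
      set σ := steps w (.op .sub 7 7 2 :: [.load 8 3 7, .load 12 6 8, .op .eq 11 12 7]) τ₁.mem
        with hσ
      have s7 : σ.reg 7 = k := by
        simp [hσ, steps, Instr.step, Op.eval, Mem.setReg, h7, e2, m2]
      have s8 : σ.reg 8 = lab v₀ := by
        simp [hσ, steps, Instr.step, Op.eval, Mem.setReg, h7, e2, m2, e3]
      have s12 : σ.reg 12 = piv (lab v₀) := by
        simp [hσ, steps, Instr.step, Op.eval, Mem.setReg, h7, e2, m2, e3, e6]
      have s11 : σ.reg 11 = if piv (lab v₀) = v₀ then 1 else 0 := by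
        simp only [hσ, steps, List.foldl, Instr.step, Op.eval, Mem.setReg, Function.update_apply]
        have hc : piv (lab v₀) = v₀ ↔ (piv (lab v₀) : ℕ) = k := Fin.ext_iff
        simp [h7, e2, m2, e3, e6, hc]
        split_ifs <;> simp [m3]
      have sfr : Frame (Set.Ici 7) {4, 7, 8} τ₁.mem σ := Frame.steps (by simp [Instr.WritesIn]) _
      have s0 : σ.reg 0 = n := by rw [sfr.1 0 (by simp), e0]
      have hr1 := Runs.block (D := D) (w := w) (.op .sub 7 7 2)
        [.load 8 3 7, .load 12 6 8, .op .eq 11 12 7] τ₁.tick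
      set τa : Config := ⟨σ, τ₁.ds, τ₁.time + 5, τ₁.queries⟩ with hτa
      change Runs D w _ τ₁.tick τa at hr1
      -- Queries are answered only for distinct nodes, so the pivot gets its value 0 without one.
      have mid : ∃ τb, Runs D w (.ite 11 (.instr (.const 13 0)) (.query 13 12 7)) τa τb ∧
          τb.mem = σ.setReg 13 (f (piv (lab v₀)) v₀) ∧ Inv τb.ds ∧
          τb.queries ≤ τa.queries + 1 ∧ τb.time ≤ τa.time + B + 2 := by
        by_cases hp : piv (lab v₀) = v₀
        · rw [if_pos hp] at s11
          refine ⟨_, Runs.ite_pos (by show σ.reg 11 ≠ 0; omega) (Runs.instr _ _), ?_, hds, ?_, ?_⟩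
          · rw [hp, hf0]
            simp [Instr.step, Config.tick, hτa]
          · simp only [Config.tick]; omega
          · simp only [Config.tick]; omega
        · rw [if_neg hp] at s11
          obtain ⟨σ', j, hh, hj, hf, hI⟩ := hans τ₁.ds hds _ _ hp
          have hh' : D.qry.Halts w (askMem τa.tick.ds (τa.tick.mem.reg 12) (τa.tick.mem.reg 7))
              σ' j := by
            show D.qry.Halts w (askMem τ₁.ds (σ.reg 12) (σ.reg 7)) σ' j
            rw [s12, s7]
            exact hh
          refine ⟨_, Runs.ite_neg (by show σ.reg 11 = 0; omega) (Runs.query hh'), ?_, hI, ?_, ?_⟩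
          · simp only [hf]; rfl
          · simp only [Config.tick]; omega
          · simp only [Config.tick]; omega
      obtain ⟨τb, hr2, hmem, hI, hqb, htb⟩ := mid
      have hr3 := Runs.block (D := D) (w := w) (.op .mul 14 13 0)
        [.op .add 14 14 8, .store 7 14 7, .store 8 7 13, .const 9 0, .store 4 7 9] τb
      set q := f (piv (lab v₀)) v₀ with hqdef
      have hfq : q * n + n < 2 ^ w := hfw _ _
      have hlabn := (lab v₀).2
      have m4 : q * n % 2 ^ w = q * n := Nat.mod_eq_of_lt (by omega)
      have m5 : nodeKey f lab piv v₀ % 2 ^ w = nodeKey f lab piv v₀ :=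
        Nat.mod_eq_of_lt (show q * n + lab v₀ < 2 ^ w by omega)
      have hkey : q * n + lab v₀ = nodeKey f lab piv v₀ := rfl
      have bfr : Frame (Set.Ici 7) {4, 7, 8} τ.mem τb.mem := by
        rw [hmem]; exact (hfr.trans sfr).setReg (by simp)
      set σ₂ := steps w (.op .mul 14 13 0 ::
        [.op .add 14 14 8, .store 7 14 7, .store 8 7 13, .const 9 0, .store 4 7 9]) τb.mem with hσ₂
      have t7 : σ₂.reg 7 = k := by
        simp [hσ₂, hmem, steps, Instr.step, Op.eval, Mem.setReg, Mem.setArr, s7]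
      have t4 : σ₂.arr 4 = Function.update (σ.arr 4) k 0 := by
        simp [hσ₂, hmem, steps, Instr.step, Op.eval, Mem.setReg, Mem.setArr, s7]
      have t8 : σ₂.arr 8 = Function.update (σ.arr 8) k q := by
        simp [hσ₂, hmem, steps, Instr.step, Op.eval, Mem.setReg, Mem.setArr, s7]
      have t7' : σ₂.arr 7 = Function.update (σ.arr 7) (nodeKey f lab piv v₀) k := by
        simp [hσ₂, hmem, steps, Instr.step, Op.eval, Mem.setReg, Mem.setArr, s7, s0, s8, m4, m5,
          hkey]
      have hsplit : ∀ v : Fin n, k ≤ v → v = v₀ ∨ k + 1 ≤ v := fun v hkv => by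
        rcases eq_or_ne (v : ℕ) k with e | e
        · exact .inl (Fin.ext e)
        · exact .inr (by omega)
      refine ⟨_, hr1.seq (hr2.seq hr3), t7, by omega,
        bfr.trans (Frame.steps (by simp [Instr.WritesIn]) _), hI, ?_, ?_, ?_, ?_, ?_⟩
      · simp only [hτa] at hqb ⊢; omega
      · simp only [hτa, List.length_cons, List.length_nil] at htb ⊢
        rw [Nat.mul_succ] at ht
        omega
      · intro v hkv
        show σ₂.arr 4 v = 0
        rw [t4, Function.update_apply]
        split_ifs with e
        · rfl
        · exact h4 v ((hsplit v hkv).resolve_left fun e' => e (by rw [e']))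
      · intro v hkv
        show σ₂.arr 8 v = _
        rw [t8, Function.update_apply]
        split_ifs with e
        · have : v = v₀ := Fin.ext e
          rw [this]
        · exact h8 v ((hsplit v hkv).resolve_left fun e' => e (by rw [e']))
      · intro v hkv
        show ∃ u : Fin n, σ₂.arr 7 _ = _ ∧ _
        simp only [t7', Function.update_apply]
        by_cases e : nodeKey f lab piv v = nodeKey f lab piv v₀
        · exact ⟨v₀, by rw [if_pos e], e.symm⟩
        · simp only [if_neg e]
          exact hmap v ((hsplit v hkv).resolve_left fun e' => e (by rw [e'])))
  refine ⟨_, hr, hfr, hds, by simpa [Config.tick] using hq, ?_, fun v => h4 v (Nat.zero_le _),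
    fun v => h8 v (Nat.zero_le _), fun v => h7 v (Nat.zero_le _)⟩
  simp only [Config.tick]; omega

/-- Edges go to the representatives of new classes, except to the pivots, which have value 0. The
listing may overwrite the input arrays, as the data structure has its own memory; division by `K`
removes scale and noise. -/
theorem relabel_run {f : Fin n → Fin n → ℕ} {K : ℕ} {E : List (Fin n × Fin n × ℕ)}
    (hE : τ.mem.Holds E) (h2 : τ.mem.reg 2 = 1) (h4 : τ.mem.reg 4 = K)
    (hnw : E.length + n + 1 < 2 ^ w)
    (hfw : ∀ u v, f u v * n + n < 2 ^ w)
    (hlab : ∀ v : Fin n, τ.mem.arr 3 v = lab v)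
    (hpiv : ∀ v : Fin n, τ.mem.arr 6 (lab v) = piv (lab v))
    (hflow : ∀ v : Fin n, τ.mem.arr 8 v = f (piv (lab v)) v)
    (hmap : ∀ v : Fin n, τ.mem.arr 7 (nodeKey f lab piv v) = lab' v) :
    ∃ τ', Runs D w (forLoop 0 relabelBody) τ τ' ∧
      Frame ({1} ∪ Set.Ici 7) {0, 1, 2, 3} τ.mem τ'.mem ∧
      τ'.ds = τ.ds ∧ τ'.queries = τ.queries ∧ τ'.time ≤ τ.time + 19 * n + 2 ∧
      (∀ v : Fin n, τ'.mem.arr 3 v = lab' v) ∧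
      ∃ E', τ'.mem.Holds E' ∧ Grows f (fun u v => f u v / K) lab lab' piv E E' := by
  let J (k : ℕ) (τ' : Config) : Prop := τ'.mem.reg 7 = k ∧ k ≤ n ∧
    Frame ({1} ∪ Set.Ici 7) {0, 1, 2, 3} τ.mem τ'.mem ∧
    τ'.ds = τ.ds ∧ τ'.queries = τ.queries ∧ τ'.time + 19 * k ≤ τ.time + 19 * n + 1 ∧
    (∀ v : Fin n, τ'.mem.arr 3 v = if k ≤ v then lab' v else lab v) ∧
    ∃ E', τ'.mem.Holds E' ∧
      (∀ e, e ∈ E' ↔ e ∈ E ∨ ∃ v : Fin n, (k ≤ v ∧ lab' v = v ∧ f (piv (lab v)) v ≠ 0) ∧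
        e = (piv (lab v), v, f (piv (lab v)) v / K)) ∧
      E'.length = E.length +
        (Finset.univ.filter fun v : Fin n => k ≤ v ∧ (lab' v = v ∧ f (piv (lab v)) v ≠ 0)).card
  obtain ⟨τ', hr, -, -, hfr, hds, hq, ht, h3, E', hE', hmem', hlen'⟩ :=
    Runs.forLoop (D := D) (w := w) (p := relabelBody) hE.1 h2 (by omega) J (fun k τ h => h.1)
    (by
      refine ⟨by simp [Mem.setReg], le_rfl, Frame.refl.setReg (by simp), rfl, rfl, ?_, ?_, E,
        ⟨?_, ?_, hE.2.2⟩, ?_, ?_⟩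
      · simp only [Config.tick]; omega
      · intro v
        rw [if_neg (by omega)]
        exact hlab v
      · simpa [Mem.setReg] using hE.1
      · simpa [Mem.setReg] using hE.2.1
      · intro e
        constructor
        · exact .inl
        · rintro (h | ⟨v, ⟨h, -⟩, -⟩)
          · exact h
          · omega
      · rw [card_filter_ge_self, add_zero])
    (by
      rintro k τ₁ ⟨h7, hk, hfr, hds, hq, ht, h3, E₁, hE₁, hmem₁, hlen₁⟩
      have hv : k < n := by omega
      set v₀ : Fin n := ⟨k, hv⟩ with hv₀
      have e0 : τ₁.mem.reg 0 = n := hE₁.1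
      have e2 : τ₁.mem.reg 2 = 1 := by rw [hfr.1 2 (by simp)]; exact h2
      have e4 : τ₁.mem.reg 4 = K := by rw [hfr.1 4 (by simp)]; exact h4
      have e3 : τ₁.mem.arr 3 k = lab v₀ := by
        have := h3 v₀
        rw [if_neg (by simp [hv₀])] at this
        exact this
      have e6 : τ₁.mem.arr 6 (lab v₀) = piv (lab v₀) := by
        rw [hfr.2 6 (by simp)]; exact hpiv v₀
      have e8 : τ₁.mem.arr 8 k = f (piv (lab v₀)) v₀ := by
        rw [hfr.2 8 (by simp)]; exact hflow v₀
      have e7 : τ₁.mem.arr 7 (nodeKey f lab piv v₀) = lab' v₀ := by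
        rw [hfr.2 7 (by simp)]; exact hmap v₀
      set q := f (piv (lab v₀)) v₀ with hqdef
      have hfq : q * n + n < 2 ^ w := hfw _ _
      have hlabn := (lab v₀).2
      have m2 : k % 2 ^ w = k := Nat.mod_eq_of_lt (by omega)
      have m3 : 1 % 2 ^ w = 1 := Nat.mod_eq_of_lt (by omega)
      have m4 : q * n % 2 ^ w = q * n := Nat.mod_eq_of_lt (by omega)
      have m5 : nodeKey f lab piv v₀ % 2 ^ w = nodeKey f lab piv v₀ :=
        Nat.mod_eq_of_lt (show q * n + lab v₀ < 2 ^ w by omega)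
      have hqn : q ≤ q * n := Nat.le_mul_of_pos_right q (by omega)
      have m6 : q / K % 2 ^ w = q / K := Nat.mod_eq_of_lt (by
        have := Nat.div_le_self q K; omega)
      have hcard : (Finset.univ.filter fun v : Fin n =>
          k + 1 ≤ v ∧ (lab' v = v ∧ f (piv (lab v)) v ≠ 0)).card ≤ n :=
        (Finset.card_le_univ _).trans (by simp)
      have m7 : (E₁.length + 1) % 2 ^ w = E₁.length + 1 := Nat.mod_eq_of_lt (by omega)
      have hkey : q * n + lab v₀ = nodeKey f lab piv v₀ := rfl
      set l : List Instr := [.load 8 3 7, .load 12 6 8, .load 13 8 7, .op .mul 14 13 0,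
        .op .add 14 14 8, .load 15 7 14, .store 3 7 15, .op .eq 11 15 7, .const 10 0,
        .op .lt 10 10 13, .op .mul 11 11 10] with hl
      set σ := steps w (.op .sub 7 7 2 :: l) τ₁.mem with hσ
      have s7 : σ.reg 7 = k := by
        simp [hσ, hl, steps, Instr.step, Op.eval, Mem.setReg, Mem.setArr, h7, e2, m2]
      have s12 : σ.reg 12 = piv (lab v₀) := by
        simp [hσ, hl, steps, Instr.step, Op.eval, Mem.setReg, Mem.setArr, h7, e2, m2, e3, e6]
      have s13 : σ.reg 13 = q := by
        simp [hσ, hl, steps, Instr.step, Op.eval, Mem.setReg, Mem.setArr, h7, e2, m2, e8]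
      have s11 : σ.reg 11 = if lab' v₀ = v₀ ∧ q ≠ 0 then 1 else 0 := by
        simp only [hσ, hl, steps, List.foldl, Instr.step, Op.eval, Mem.setReg, Mem.setArr]
        have hc : lab' v₀ = v₀ ↔ (lab' v₀ : ℕ) = k := Fin.ext_iff
        simp [h7, e2, m2, e3, e8, e0, m4, m5, hkey, e7, hc]
        by_cases c1 : (lab' v₀ : ℕ) = k <;> by_cases c2 : q = 0 <;>
          simp [c1, c2, m3, Nat.pos_iff_ne_zero]
      have s3 : σ.arr 3 = Function.update (τ₁.mem.arr 3) k (lab' v₀) := by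
        simp [hσ, hl, steps, Instr.step, Op.eval, Mem.setReg, Mem.setArr, h7, e2, m2, e3, e6, e8,
          e0, m4, m5, hkey, e7]
      have sfr : Frame (Set.Ici 7) {3} τ₁.mem σ := Frame.steps (by simp [hl, Instr.WritesIn]) _
      have hr1 := Runs.block (D := D) (w := w) (.op .sub 7 7 2) l τ₁.tick
      set τa : Config := ⟨σ, τ₁.ds, τ₁.time + 13, τ₁.queries⟩ with hτa
      change Runs D w _ τ₁.tick τa at hr1
      have afr : Frame ({1} ∪ Set.Ici 7) {0, 1, 2, 3} τ.mem σ :=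
        hfr.trans (sfr.mono (by simp) (by simp))
      have hEσ : σ.Holds E₁ := by
        refine ⟨by rw [sfr.1 0 (by simp)]; exact hE₁.1, by rw [sfr.1 1 (by simp)]; exact hE₁.2.1, ?_⟩
        intro i hi
        rw [sfr.2 0 (by simp), sfr.2 1 (by simp), sfr.2 2 (by simp)]
        exact hE₁.2.2 i hi
      have harr3 : ∀ v : Fin n, σ.arr 3 v = if k ≤ v then lab' v else lab v := by
        intro v
        rw [s3, Function.update_apply]
        by_cases e : (v : ℕ) = k
        · have : v = v₀ := Fin.ext e
          rw [if_pos e, if_pos e.ge, this]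
        · rw [if_neg e, h3]
          by_cases e' : k + 1 ≤ v
          · rw [if_pos e', if_pos (by omega)]
          · rw [if_neg e', if_neg (by omega)]
      by_cases hnew : lab' v₀ = v₀ ∧ q ≠ 0
      · rw [if_pos hnew] at s11
        set l' : List Instr := [.store 1 1 7, .op .div 13 13 4, .store 2 1 13, .op .add 1 1 2]
          with hl'
        have hr2 := Runs.block (D := D) (w := w) (.store 0 1 12) l' τa.tick
        set σ₂ := steps w (.store 0 1 12 :: l') σ with hσ₂
        have a1 : σ.reg 1 = E₁.length := hEσ.2.1
        have a2 : σ.reg 2 = 1 := by rw [sfr.1 2 (by simp), e2]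
        have a4 : σ.reg 4 = K := by rw [sfr.1 4 (by simp), e4]
        have t7 : σ₂.reg 7 = k := by
          simp [hσ₂, hl', steps, Instr.step, Mem.setReg, Mem.setArr, s7]
        have t0 : σ₂.reg 0 = n := by
          rw [← hEσ.1]
          simp [hσ₂, hl', steps, Instr.step, Mem.setReg, Mem.setArr]
        have t1 : σ₂.reg 1 = E₁.length + 1 := by
          simp [hσ₂, hl', steps, Instr.step, Op.eval, Mem.setReg, Mem.setArr, a1, a2, m7]
        have b0 : σ₂.arr 0 = Function.update (σ.arr 0) E₁.length (piv (lab v₀)) := by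
          simp [hσ₂, hl', steps, Instr.step, Op.eval, Mem.setReg, Mem.setArr, a1, s12]
        have b1 : σ₂.arr 1 = Function.update (σ.arr 1) E₁.length k := by
          simp [hσ₂, hl', steps, Instr.step, Op.eval, Mem.setReg, Mem.setArr, a1, s7]
        have b2 : σ₂.arr 2 = Function.update (σ.arr 2) E₁.length (q / K) := by
          simp [hσ₂, hl', steps, Instr.step, Op.eval, Mem.setReg, Mem.setArr, a1, s13, a4, m6]
        have b3 : σ₂.arr 3 = σ.arr 3 := by
          simp [hσ₂, hl', steps, Instr.step, Mem.setReg, Mem.setArr]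
        refine ⟨_, hr1.seq (Runs.ite_pos (by show σ.reg 11 ≠ 0; omega) hr2), t7, by omega,
          afr.trans (Frame.steps (by simp [hl', Instr.WritesIn]) _), hds, hq, ?_, ?_,
          E₁ ++ [(piv (lab v₀), v₀, q / K)], ⟨t0, ?_, ?_⟩, ?_, ?_⟩
        · simp only [Config.tick, hτa, hl', List.length_cons, List.length_nil]; omega
        · intro v
          show σ₂.arr 3 v = _
          rw [b3]
          exact harr3 v
        · show σ₂.reg 1 = _
          rw [t1]; simp
        · intro i hi
          show σ₂.arr 0 i = _ ∧ σ₂.arr 1 i = _ ∧ σ₂.arr 2 i = _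
          rw [b0, b1, b2]
          simp only [List.length_append, List.length_cons, List.length_nil] at hi
          rcases eq_or_ne i E₁.length with rfl | hne
          · simp [hv₀]
          · have hi' : i < E₁.length := by omega
            simp only [Function.update_of_ne hne, List.getElem_append_left hi']
            exact hEσ.2.2 i hi'
        · intro e
          rw [List.mem_append, hmem₁, List.mem_singleton]
          constructor
          · rintro ((h | ⟨v, ⟨h1, h2⟩, h3⟩) | h)
            · exact .inl h
            · exact .inr ⟨v, ⟨by omega, h2⟩, h3⟩
            · exact .inr ⟨v₀, ⟨le_rfl, hnew⟩, h⟩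
          · rintro (h | ⟨v, ⟨h1, h2⟩, h3⟩)
            · exact .inl (.inl h)
            · rcases eq_or_ne (v : ℕ) k with ek | ek
              · have : v = v₀ := Fin.ext ek
                subst this
                exact .inr h3
              · exact .inl (.inr ⟨v, ⟨by omega, h2⟩, h3⟩)
        · rw [card_filter_ge hv, if_pos hnew, List.length_append, hlen₁]
          rfl
      · rw [if_neg hnew] at s11
        refine ⟨_, hr1.seq (Runs.ite_neg (by show σ.reg 11 = 0; omega) (Runs.instr _ _)), ?_,
          by omega, afr.setReg (by simp), hds, hq, ?_, harr3, E₁, ⟨?_, ?_, hEσ.2.2⟩, ?_, ?_⟩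
        · show (σ.setReg 10 (0 % 2 ^ w)).reg 7 = k
          simpa [Mem.setReg] using s7
        · simp only [Config.tick, hτa]; omega
        · show (σ.setReg 10 (0 % 2 ^ w)).reg 0 = n
          simpa [Mem.setReg] using hEσ.1
        · show (σ.setReg 10 (0 % 2 ^ w)).reg 1 = _
          simpa [Mem.setReg] using hEσ.2.1
        · intro e
          rw [hmem₁]
          refine or_congr_right (exists_congr fun v => and_congr_left fun _ => ?_)
          constructor
          · rintro ⟨h1, h2⟩
            exact ⟨by omega, h2⟩
          · rintro ⟨h1, h2⟩
            refine ⟨?_, h2⟩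
            rcases eq_or_ne (v : ℕ) k with ek | ek
            · have : v = v₀ := Fin.ext ek
              subst this
              exact absurd h2 hnew
            · omega
        · rw [card_filter_ge hv, if_neg hnew, hlen₁, add_zero])
  refine ⟨_, hr, hfr, hds, hq, ?_, fun v => ?_, E', hE', ⟨fun e => ?_, ?_⟩⟩
  · simp only [Config.tick]; omega
  · have := h3 v
    rwa [if_pos (Nat.zero_le _)] at this
  · rw [hmem']
    simp
  · rw [hlen']
    simp

end loops

/-! ## Rounds of refinement -/

/-- One round: split all classes according to the Max-Flow values between their nodes and their
pivots. -/
def roundProg : Prog :=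
  .seq (forLoop 0 countBody) (.seq (forLoop 0 pivotBody)
    (.seq (forLoop 0 queryBody) (forLoop 0 relabelBody)))

/-- The body of the main loop, which halves register `5`. -/
def mainBody : Prog :=
  .seq (block (.const 9 2) [.op .div 5 5 9]) (.seq (.rand 6 3) roundProg)

section rounds

variable {D : DataStructure} {w n : ℕ} {H : CapGraph n} {K R B : ℕ} {Inv : Mem → Prop}
  {lab : Fin n → Fin n} {E : List (Fin n × Fin n × ℕ)} {τ : Config}

/-- The state between two rounds. -/
structure RoundState (H : CapGraph n) (K R : ℕ) (Inv : Mem → Prop) (lab : Fin n → Fin n)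
    (E : List (Fin n × Fin n × ℕ)) (τ : Config) : Prop where
  one : τ.mem.reg 2 = 1
  range : τ.mem.reg 3 = R
  scale : τ.mem.reg 4 = K
  labels : ∀ v : Fin n, τ.mem.arr 3 v = lab v
  clear : ∀ v : Fin n, τ.mem.arr 4 v = 0
  inv : Inv τ.ds
  holds : τ.mem.Holds E
  tree : TreeInv H.maxFlow (fun u v => H.maxFlow u v / K) lab E

theorem round_run (hH : H.graph.Connected) (hn : 2 * n + 1 < 2 ^ w)
    (hfw : ∀ u v, H.maxFlow u v * n + n < 2 ^ w) (hans : Answers D.qry w H.maxFlow B Inv)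
    (h : RoundState H K R Inv lab E τ) {x : ℕ} (hx : τ.mem.reg 6 = x) :
    ∃ τ' lab' piv E', Runs D w roundProg τ τ' ∧ RoundState H K R Inv lab' E' τ' ∧
      Refines H.maxFlow x lab lab' piv ∧ τ'.mem.reg 5 = τ.mem.reg 5 ∧
      τ'.queries ≤ τ.queries + n ∧ τ'.time ≤ τ.time + (B + 48) * n + 8 := by
  obtain ⟨τ₁, r1, fr1, ds1, q1, t1, rank1, cnt1⟩ :=
    count_run (D := D) (w := w) h.holds.1 h.one (by omega) h.labels h.clear
  have lab1 : ∀ v : Fin n, τ₁.mem.arr 3 v = lab v := fun v => by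
    rw [fr1.2 3 (by simp)]; exact h.labels v
  obtain ⟨τ₂, r2, fr2, ds2, q2, t2, piv, hpiv⟩ :=
    pivot_run (D := D) (w := w) (x := x) (by rw [fr1.1 0 (by simp)]; exact h.holds.1)
      (by rw [fr1.1 2 (by simp)]; exact h.one) (by rw [fr1.1 6 (by simp)]; exact hx) (by omega)
      lab1 rank1 cnt1
  have fr12 : Frame (Set.Ici 7) {4, 5, 6} τ.mem τ₂.mem :=
    (fr1.mono subset_rfl (by grind)).trans (fr2.mono subset_rfl (by simp))
  have lab2 : ∀ v : Fin n, τ₂.mem.arr 3 v = lab v := fun v => by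
    rw [fr12.2 3 (by simp)]; exact h.labels v
  obtain ⟨τ₃, r3, fr3, inv3, q3, t3, clear3, flow3, map3⟩ :=
    query_run (D := D) (w := w) (f := H.maxFlow) (B := B) (Inv := Inv)
      (by rw [fr12.1 0 (by simp)]; exact h.holds.1) (by rw [fr12.1 2 (by simp)]; exact h.one)
      (by omega) H.maxFlow_self hfw hans (by rw [ds2, ds1]; exact h.inv) lab2
      (fun v => (hpiv v).1)
  choose lab' hmap hkey using map3
  have fr13 : Frame (Set.Ici 7) {4, 5, 6, 7, 8} τ.mem τ₃.mem :=
    (fr12.mono subset_rfl (by grind)).trans (fr3.mono subset_rfl (by grind))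
  have hold3 : τ₃.mem.Holds E := by
    refine ⟨by rw [fr13.1 0 (by simp)]; exact h.holds.1,
      by rw [fr13.1 1 (by simp)]; exact h.holds.2.1, ?_⟩
    rw [fr13.2 0 (by simp), fr13.2 1 (by simp), fr13.2 2 (by simp)]
    exact h.holds.2.2
  have hlen : E.length + 1 ≤ n := by
    rw [h.tree.count]
    exact (Finset.card_le_univ _).trans (by simp)
  obtain ⟨τ₄, r4, fr4, ds4, q4, t4, lab4, E', hE', hgrow⟩ :=
    relabel_run (D := D) (w := w) (f := H.maxFlow) (lab' := lab') (piv := piv) (K := K) hold3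
      (by rw [fr13.1 2 (by simp)]; exact h.one) (by rw [fr13.1 4 (by simp)]; exact h.scale)
      (by omega) hfw (fun v => by rw [fr13.2 3 (by simp)]; exact h.labels v)
      (fun v => by rw [fr3.2 6 (by simp)]; exact (hpiv v).1) flow3 hmap
  have fr14 : Frame ({1} ∪ Set.Ici 7) {0, 1, 2, 3, 4, 5, 6, 7, 8} τ.mem τ₄.mem :=
    (fr13.mono (by simp) (by grind)).trans (fr4.mono subset_rfl (by grind))
  have href : Refines H.maxFlow x lab lab' piv := by
    have heq : ∀ u v, lab' u = lab' v ↔ nodeKey H.maxFlow lab piv u = nodeKey H.maxFlow lab piv v := by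
      intro u v
      constructor
      · intro e
        rw [← hkey u, ← hkey v, e]
      · intro e
        apply Fin.ext
        rw [← hmap u, ← hmap v, e]
    exact ⟨fun v => (hpiv v).2.1, fun v => (hpiv v).2.2, fun u v => (heq u v).trans nodeKey_eq_iff,
      fun v => (heq _ _).2 (hkey v)⟩
  refine ⟨τ₄, lab', piv, E', r1.seq (r2.seq (r3.seq r4)), ?_, href, fr14.1 5 (by simp),
    by omega, ?_⟩
  · refine ⟨by rw [fr14.1 2 (by simp)]; exact h.one, by rw [fr14.1 3 (by simp)]; exact h.range,
      by rw [fr14.1 4 (by simp)]; exact h.scale, lab4, fun v => ?_, by rw [ds4]; exact inv3, hE',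
      h.tree.step H.maxFlow_comm (fun u v w huw => H.min_le_maxFlow v huw) H.maxFlow_self
        (fun u v huv => CapGraph.maxFlow_pos hH huv) href hgrow⟩
    rw [fr4.2 4 (by simp)]
    exact clear3 v
  · have : (B + 48) * n = 7 * n + 9 * n + (B + 13) * n + 19 * n := by ring
    omega

/-- The probability that the main loop ends badly, when it has `s` rounds. -/
theorem main_loop (hH : H.graph.Connected) (hties : H.NoTies) (hw2 : 2 < 2 ^ w)
    (hn : 2 * n + 1 < 2 ^ w)
    (hfw : ∀ u v, H.maxFlow u v * n + n < 2 ^ w) (hans : Answers D.qry w H.maxFlow B Inv)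
    (hR : 2 * n ≤ R) (hR0 : 0 < R) {T Q : ℕ} {bad : Set (Option Config)}
    (hgood : ∀ lab E τ, RoundState H K R Inv lab E τ → Function.Injective lab → τ.time + 1 ≤ T →
      τ.queries ≤ Q → some τ.tick ∉ bad) {F : ℕ} (hF : T < F) (s : ℕ) :
    ∀ j lab E τ t, s < j → RoundState H K R Inv lab E τ → τ.mem.reg 5 = t → t < 2 ^ s →
      2 ^ s ≤ 2 * t + 1 → t < 2 ^ w → τ.time + s * ((B + 48) * n + 12) + 1 ≤ T →
      τ.queries + s * n ≤ Q →
      (Prog.iter 5 (mainBody.exec D w F) j τ).toOuterMeasure bad ≤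
        collisions lab * (2 ^ s : ENNReal)⁻¹ := by
  -- The bounds `t < 2 ^ s ≤ 2 * t + 1` say that `t` has exactly `s` binary digits, so halving stops
  -- after exactly `s` rounds.
  induction s with
  | zero =>
    intro j lab E τ t hj hst ht h1 h2 _ hT hQ
    obtain ⟨j, rfl⟩ : ∃ i, j = i + 1 := ⟨j - 1, by omega⟩
    rw [Prog.iter, if_pos (by omega)]
    -- Markov's inequality: without collisions the outcome is good, and otherwise their number is at
    -- least 1, which bounds any probability.
    rcases Nat.eq_zero_or_pos (collisions lab) with h0 | h0
    · have := hgood lab E τ hst (injective_of_collisions h0) (by omega) (by omega)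
      rw [PMF.toOuterMeasure_pure_apply, if_neg this]
      exact zero_le
    · refine (toOuterMeasure_le_one _ _).trans ?_
      simp only [pow_zero, inv_one, mul_one]
      exact_mod_cast h0
  | succ s ih =>
    intro j lab E τ t hj hst ht h1 h2 htw hT hQ
    obtain ⟨j, rfl⟩ : ∃ i, j = i + 1 := ⟨j - 1, by omega⟩
    have ht0 : t ≠ 0 := by
      rintro rfl
      have := Nat.one_le_two_pow (n := s)
      rw [pow_succ] at h2
      omega
    rw [Prog.iter, if_neg (by omega)]
    have hr1 := Runs.block (D := D) (w := w) (.const 9 2) [.op .div 5 5 9] τ.tick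
    set σ := steps w (.const 9 2 :: [.op .div 5 5 9]) τ.mem with hσ
    set τa : Config := ⟨σ, τ.ds, τ.time + 3, τ.queries⟩ with hτa
    change Runs D w _ τ.tick τa at hr1
    have s5 : σ.reg 5 = t / 2 := by
      simp [hσ, steps, Instr.step, Op.eval, Mem.setReg, ht, Nat.mod_eq_of_lt hw2,
        Nat.mod_eq_of_lt ((Nat.div_le_self t 2).trans_lt htw)]
    have sfr : Frame {5, 9} ∅ τ.mem σ := Frame.steps (by simp [Instr.WritesIn]) _
    have hexp : (s + 1) * ((B + 48) * n + 12) = s * ((B + 48) * n + 12) + ((B + 48) * n + 12) := by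
      ring
    have hexp' : (s + 1) * n = s * n + n := by ring
    rw [mainBody, Prog.exec, andThen_assoc, hr1.exec_andThen (by simp only [hτa]; omega),
      Prog.exec, andThen_assoc,
      rand_andThen (k := R) (by simp only [hτa]; rw [sfr.1 3 (by simp)]; exact hst.range) hR0]
    have hround : ∀ x : ℕ, ∃ τ' lab' piv E',
        Runs D w roundProg { τa.tick with mem := τa.mem.setReg 6 x } τ' ∧
        RoundState H K R Inv lab' E' τ' ∧ Refines H.maxFlow x lab lab' piv ∧
        τ'.mem.reg 5 = t / 2 ∧ τ'.queries ≤ τ.queries + n ∧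
        τ'.time ≤ τ.time + ((B + 48) * n + 12) := by
      intro x
      have hfr : Frame {5, 6, 9} ∅ τ.mem (σ.setReg 6 x) :=
        (sfr.mono (by grind) subset_rfl).setReg (by simp)
      have hst' : RoundState H K R Inv lab E { τa.tick with mem := τa.mem.setReg 6 x } := by
        refine ⟨?_, ?_, ?_, hst.labels, hst.clear, hst.inv, ?_, hst.tree⟩
        · exact (hfr.1 2 (by simp)).trans hst.one
        · exact (hfr.1 3 (by simp)).trans hst.range
        · exact (hfr.1 4 (by simp)).trans hst.scale
        · exact ⟨(hfr.1 0 (by simp)).trans hst.holds.1, (hfr.1 1 (by simp)).trans hst.holds.2.1,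
            hst.holds.2.2⟩
      obtain ⟨τ', lab', piv, E', a1, a2, a3, a4, a5, a6⟩ :=
        round_run (D := D) (w := w) (x := x) hH hn hfw hans hst' (by simp [Mem.setReg])
      refine ⟨τ', lab', piv, E', a1, a2, a3, a4.trans ?_, a5, ?_⟩
      · simpa [Mem.setReg, hτa] using s5
      · simp only [Config.tick, hτa] at a6; omega
    choose τ' lab' piv E' b1 b2 b3 b4 b5 b6 using hround
    have hsum := sum_collisions_le H.maxFlow_comm H.maxFlow_self
      (fun u v huv => CapGraph.maxFlow_pos hH huv) hties lab hR lab' piv (fun x _ => b3 x)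
    calc _ ≤ (R : ENNReal)⁻¹ * ∑ x : Fin R, (collisions (lab' x) : ENNReal) * (2 ^ s : ENNReal)⁻¹ := by
          refine mul_le_mul_right (Finset.sum_le_sum fun x _ => ?_) _
          have htime := b6 x
          rw [(b1 x).exec_andThen (by omega)]
          refine ih j (lab' x) (E' x) (τ' x) (t / 2) (by omega) (b2 x) (b4 x) ?_ ?_ ?_ ?_ ?_
          · rw [pow_succ] at h1; omega
          · rw [pow_succ] at h2; omega
          · omega
          · omega
          · have := b5 x; omega
      _ = (R : ENNReal)⁻¹ * ((∑ x ∈ Finset.range R, collisions (lab' x) : ℕ) * (2 ^ s : ENNReal)⁻¹) := by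
          rw [← Finset.sum_mul, Finset.sum_range]
          push_cast
          rfl
      _ ≤ _ := by
          have hR' : (R : ENNReal) ≠ 0 := by exact_mod_cast hR0.ne'
          have h2s : (2 : ENNReal) * ((∑ x ∈ Finset.range R, collisions (lab' x) : ℕ)) ≤
              R * collisions lab := by exact_mod_cast hsum
          rw [pow_succ, ENNReal.mul_inv (by simp) (by simp)]
          calc (R : ENNReal)⁻¹ * ((∑ x ∈ Finset.range R, collisions (lab' x) : ℕ) *
                (2 ^ s : ENNReal)⁻¹)
              = (R : ENNReal)⁻¹ * ((2⁻¹ * 2) * (∑ x ∈ Finset.range R, collisions (lab' x) : ℕ) *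
                (2 ^ s : ENNReal)⁻¹) := by
                rw [ENNReal.inv_mul_cancel (by simp) (by simp), one_mul]
            _ = (R : ENNReal)⁻¹ * (2 * (∑ x ∈ Finset.range R, collisions (lab' x) : ℕ)) *
                ((2 ^ s : ENNReal)⁻¹ * 2⁻¹) := by ring
            _ ≤ (R : ENNReal)⁻¹ * (R * collisions lab) * ((2 ^ s : ENNReal)⁻¹ * 2⁻¹) := by
                gcongr
            _ = _ := by
                rw [← mul_assoc (R : ENNReal)⁻¹, ENNReal.inv_mul_cancel hR' (by simp), one_mul]

end rounds

/-! ## Random perturbation of the capacities -/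

section shaking

variable {D : DataStructure} {w n : ℕ}

theorem steps_append (l₁ l₂ : List Instr) (σ : Mem) :
    steps w (l₁ ++ l₂) σ = steps w l₂ (steps w l₁ σ) := List.foldl_append

theorem steps_power {d x : ℕ} (hd : d ≠ 0) (k : ℕ) :
    ∀ (σ : Mem) (y : ℕ), σ.reg 0 = x → 0 < x → σ.reg d = y → y * x ^ k < 2 ^ w →
      steps w (List.replicate k (.op .mul d d 0)) σ = σ.setReg d (y * x ^ k) := by
  induction k with
  | zero =>
    rintro σ y - - rfl -
    simp [steps, Mem.setReg]
  | succ k ih =>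
    intro σ y h0 hx hy hw
    have e : y * x * x ^ k = y * x ^ (k + 1) := by ring
    have hle : y * x < 2 ^ w := by
      refine lt_of_le_of_lt ?_ hw
      rw [← e]
      exact Nat.le_mul_of_pos_right _ (Nat.pow_pos hx)
    have hstep : Instr.step w (.op .mul d d 0) σ = σ.setReg d (y * x) := by
      simp only [Instr.step, Op.eval, h0, hy, Nat.mod_eq_of_lt hle]
    rw [List.replicate_succ]
    change steps w (List.replicate k (.op .mul d d 0)) (Instr.step w (.op .mul d d 0) σ) = _
    rw [hstep, ih _ (y * x) _ hx (by simp [Mem.setReg]) (by rw [e]; exact hw), e]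
    · simp [Mem.setReg]
    · simp [Mem.setReg, hd.symm, h0]

/-- Replace the capacity of an edge by a random perturbation; the range is in register `3` and the
scale in register `4`. -/
def shakeBody : Prog :=
  .seq (block (.op .sub 7 7 2) [.load 8 2 7, .op .mul 8 8 4])
    (.seq (.rand 9 3) (block (.op .add 8 8 9) [.store 2 7 8]))

/-- The state when `i` capacities are still to be perturbed. -/
structure ShakeState (L : List (Fin n × Fin n × ℕ)) (K R T : ℕ) (σ : Mem) (i : ℕ)
    (ρ : Fin L.length → ℕ) (τ : Config) : Prop where
  todo : τ.mem.reg 7 = i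
  frame : Frame (Set.Ici 7) {2} σ τ.mem
  before : ∀ j : Fin L.length, (j : ℕ) < i → τ.mem.arr 2 j = L[j].2.2
  after : ∀ j : Fin L.length, i ≤ (j : ℕ) → τ.mem.arr 2 j = K * L[j].2.2 + ρ j ∧ ρ j < R
  outside : ∀ j, L.length ≤ j → τ.mem.arr 2 j = 0
  queries : τ.queries = 0
  time : τ.time + 7 * i + 1 ≤ T

/-- The independent draws made one after the other amount to a single uniform vector, so that the
perturbations can be counted as in `IsListing.card_not_noTies`. Entries of `ρ` from `i` on are
already drawn. -/
theorem shake_loop {L : List (Fin n × Fin n × ℕ)} {K R T F : ℕ} {σ : Mem} (h2 : σ.reg 2 = 1)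
    (h3 : σ.reg 3 = R) (h4 : σ.reg 4 = K) (hR : 0 < R)
    (hw : ∀ j : Fin L.length, K * L[j].2.2 + R ≤ 2 ^ w) (hmw : L.length < 2 ^ w) (hF : T < F)
    {h : Config → PMF (Option Config)} {S : Set (Option Config)}
    {β : (Fin L.length → ℕ) → ENNReal}
    (hβ : ∀ ρ τ, ShakeState L K R T σ 0 ρ τ → (h τ.tick).toOuterMeasure S ≤ β ρ) (i : ℕ) :
    ∀ f ρ τ, i < f → i ≤ L.length → ShakeState L K R T σ i ρ τ →
      (andThen (Prog.iter 7 (shakeBody.exec D w F) f τ) h).toOuterMeasure S ≤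
        ((R : ENNReal) ^ i)⁻¹ * ∑ ρ' : Fin i → Fin R,
          β fun j => if hj : (j : ℕ) < i then ρ' ⟨j, hj⟩ else ρ j := by
  induction i with
  | zero =>
    intro f ρ τ hf _ hst
    obtain ⟨f, rfl⟩ : ∃ g, f = g + 1 := ⟨f - 1, by omega⟩
    rw [Prog.iter, if_pos hst.todo, andThen_pure_some]
    simpa using hβ ρ τ hst
  | succ i ih =>
    intro f ρ τ hf hi hst
    obtain ⟨f, rfl⟩ : ∃ g, f = g + 1 := ⟨f - 1, by omega⟩
    set p : Fin L.length := ⟨i, hi⟩ with hp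
    rw [Prog.iter, if_neg (by rw [hst.todo]; omega), andThen_assoc]
    have htime := hst.time
    have g2 : τ.mem.reg 2 = 1 := (hst.frame.1 2 (by simp)).trans h2
    have g4 : τ.mem.reg 4 = K := (hst.frame.1 4 (by simp)).trans h4
    have hb : τ.mem.arr 2 i = L[p].2.2 := hst.before p (by simp [hp])
    have hwp := hw p
    have hr1 := Runs.block (D := D) (w := w) (.op .sub 7 7 2) [.load 8 2 7, .op .mul 8 8 4] τ.tick
    have hmem : steps w (.op .sub 7 7 2 :: [.load 8 2 7, .op .mul 8 8 4]) τ.tick.mem =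
        ((τ.mem.setReg 7 i).setReg 8 L[p].2.2).setReg 8 (K * L[p].2.2) := by
      have e1 : Instr.step w (.op .sub 7 7 2) τ.mem = τ.mem.setReg 7 i := by
        simp only [Instr.step, Op.eval, hst.todo, g2, Nat.add_sub_cancel]
        rw [Nat.mod_eq_of_lt (by omega)]
      have e2 : Instr.step w (.load 8 2 7) (τ.mem.setReg 7 i) =
          (τ.mem.setReg 7 i).setReg 8 L[p].2.2 := by
        rw [← hb]; simp [Instr.step, Mem.setReg]
      have e3 : Instr.step w (.op .mul 8 8 4) ((τ.mem.setReg 7 i).setReg 8 L[p].2.2) =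
          ((τ.mem.setReg 7 i).setReg 8 L[p].2.2).setReg 8 (K * L[p].2.2) := by
        have a : ((τ.mem.setReg 7 i).setReg 8 L[p].2.2).reg 8 = L[p].2.2 := by simp [Mem.setReg]
        have b : ((τ.mem.setReg 7 i).setReg 8 L[p].2.2).reg 4 = K := by
          rw [← g4]; simp [Mem.setReg]
        simp only [Instr.step, Op.eval, a, b]
        rw [mul_comm, Nat.mod_eq_of_lt (by omega)]
      simp only [steps, List.foldl_cons, List.foldl_nil, Config.tick]
      rw [e1, e2, e3]
    rw [hmem] at hr1
    set μ := ((τ.mem.setReg 7 i).setReg 8 L[p].2.2).setReg 8 (K * L[p].2.2) with hμ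
    have fr1 : Frame (Set.Ici 7) {2} σ μ :=
      ((hst.frame.setReg (by simp)).setReg (by simp)).setReg (by simp)
    have e : shakeBody.exec D w F τ.tick = andThen ((block (.op .sub 7 7 2)
        [.load 8 2 7, .op .mul 8 8 4]).exec D w F τ.tick) fun τ =>
          andThen ((Prog.rand 9 3).exec D w F τ)
            ((block (.op .add 8 8 9) [.store 2 7 8]).exec D w F) := rfl
    rw [e, andThen_assoc, hr1.exec_andThen (by simp only [Config.tick, List.length]; omega),
      andThen_assoc, rand_andThen (k := R) (τ := ⟨μ, _, _, _⟩) ((fr1.1 3 (by simp)).trans h3) hR]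
    have hbound : ∀ x : Fin R,
        (andThen ((block (.op .add 8 8 9) [.store 2 7 8]).exec D w F
          ⟨μ.setReg 9 x, τ.ds, τ.time + 5, τ.queries⟩)
          fun τ => andThen (Prog.iter 7 (shakeBody.exec D w F) f τ) h).toOuterMeasure S ≤
        ((R : ENNReal) ^ i)⁻¹ * ∑ ρ' : Fin i → Fin R,
          β fun j => if hj : (j : ℕ) < i then ρ' ⟨j, hj⟩ else Function.update ρ p (x : ℕ) j := by
      intro x
      have hr2 := Runs.block (D := D) (w := w) (.op .add 8 8 9) [.store 2 7 8]
        ⟨μ.setReg 9 x, τ.ds, τ.time + 5, τ.queries⟩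
      have hmem2 : steps w (.op .add 8 8 9 :: [.store 2 7 8]) (μ.setReg 9 x) =
          ((μ.setReg 9 x).setReg 8 (K * L[p].2.2 + x)).setArr 2 i (K * L[p].2.2 + x) := by
        have e1 : Instr.step w (.op .add 8 8 9) (μ.setReg 9 x) =
            (μ.setReg 9 x).setReg 8 (K * L[p].2.2 + x) := by
          have a : (μ.setReg 9 x).reg 8 = K * L[p].2.2 := by simp [hμ, Mem.setReg]
          have b : (μ.setReg 9 x).reg 9 = x := by simp [Mem.setReg]
          have := x.2
          simp only [Instr.step, Op.eval, a, b]
          rw [Nat.mod_eq_of_lt (by omega)]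
        simp only [steps, List.foldl_cons, List.foldl_nil]
        rw [e1]
        simp [Instr.step, hμ, Mem.setReg]
      dsimp only at hr2
      rw [hmem2] at hr2
      rw [hr2.exec_andThen (by simp only [List.length]; omega)]
      refine ih f _ _ (by omega) (by omega) ⟨?_, ?_, ?_, ?_, ?_, hst.queries, ?_⟩
      · simp [hμ, Mem.setReg, Mem.setArr]
      · exact ((fr1.setReg (by simp)).setReg (by simp)).setArr (by simp)
      · intro j hj
        have : (j : ℕ) ≠ i := by omega
        simpa [hμ, Mem.setReg, Mem.setArr, Function.update_of_ne this] using
          hst.before j (by omega)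
      · intro j hj
        rcases hj.eq_or_lt with e | hlt
        · obtain rfl : j = p := Fin.ext e.symm
          simp [hμ, Mem.setReg, Mem.setArr, hp]
        · have h1 : (j : ℕ) ≠ i := by omega
          have h2 : j ≠ p := fun e => h1 (by rw [e])
          simpa [hμ, Mem.setReg, Mem.setArr, Function.update_of_ne h1, Function.update_of_ne h2]
            using hst.after j (by omega)
      · intro j hj
        have : j ≠ i := by omega
        simpa [hμ, Mem.setReg, Mem.setArr, Function.update_of_ne this] using hst.outside j hj
      · simp only [List.length]; omega
    calc _ ≤ (R : ENNReal)⁻¹ * ∑ x : Fin R, ((R : ENNReal) ^ i)⁻¹ * ∑ ρ' : Fin i → Fin R,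
          β fun j => if hj : (j : ℕ) < i then ρ' ⟨j, hj⟩ else Function.update ρ p (x : ℕ) j :=
        mul_le_mul_right (Finset.sum_le_sum fun x _ => hbound x) _
      _ = _ := by
        rw [← Finset.mul_sum, ← mul_assoc, pow_succ, ENNReal.mul_inv (by simp) (by simp),
          mul_comm (R : ENNReal)⁻¹, ← Fintype.sum_prod_type']
        congr 1
        -- The loop counts down, so the first draw is the last coordinate of the vector.
        refine Fintype.sum_equiv (Fin.snocEquiv fun _ => Fin R) _ _ fun y => ?_
        congr 1
        funext j
        simp only [Fin.snocEquiv, Equiv.coe_fn_mk, Fin.snoc]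
        rcases lt_trichotomy (j : ℕ) i with hj | hj | hj
        · simp [hj, Nat.lt_succ_of_lt hj]
        · obtain rfl : j = p := Fin.ext hj
          simp [hp]
        · have h1 : ¬ (j : ℕ) < i := by omega
          have h2 : j ≠ p := fun e => hj.ne' (by rw [e])
          simp [h1, h2, show ¬ (j : ℕ) < i + 1 by omega]

end shaking

/-! ## Estimates -/

section estimates

theorem natCast_mul_inv_le {a x y : ℕ} (hx : x ≠ 0) (h : a * x ≤ y) :
    (a : ENNReal) * (y : ENNReal)⁻¹ ≤ (x : ENNReal)⁻¹ := by
  have hx' : (x : ENNReal) ≠ 0 := by exact_mod_cast hx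
  rw [← div_eq_mul_inv]
  refine ENNReal.div_le_of_le_mul ?_
  calc (a : ENNReal) = (x : ENNReal)⁻¹ * (a * x : ℕ) := by
        push_cast
        rw [mul_comm (a : ENNReal), ← mul_assoc, ENNReal.inv_mul_cancel hx' (by simp), one_mul]
    _ ≤ _ := by gcongr

open Classical in
/-- An average of a quantity that is at most `1`, and at most `δ` on good inputs. -/
theorem average_le {m R : ℕ} (hR : R ≠ 0) (good : (Fin m → Fin R) → Prop) (δ : ENNReal) :
    ((R : ENNReal) ^ m)⁻¹ * ∑ ρ : Fin m → Fin R, (if good ρ then δ else 1) ≤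
      δ + (Finset.univ.filter fun ρ => ¬ good ρ).card * ((R ^ m : ℕ) : ENNReal)⁻¹ := by
  have hR' : (R : ENNReal) ^ m ≠ 0 := pow_ne_zero _ (by exact_mod_cast hR)
  calc _ ≤ ((R : ENNReal) ^ m)⁻¹ * ∑ ρ : Fin m → Fin R, (δ + if ¬ good ρ then 1 else 0) := by
        gcongr with ρ
        split_ifs <;> simp
    _ = _ := by
        rw [Finset.sum_add_distrib, mul_add, Finset.sum_boole]
        simp only [Finset.sum_const, Finset.card_univ, Fintype.card_fun, Fintype.card_fin,
          nsmul_eq_mul, Nat.cast_pow]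
        rw [← mul_assoc, ENNReal.inv_mul_cancel hR' (by simp), one_mul, mul_comm _⁻¹]

theorem half_le_log {n : ℕ} (hn : 2 ≤ n) : (1 / 2 : ℝ) ≤ Real.log n := by
  have h2 : Real.log 2 ≤ Real.log n := Real.log_le_log two_pos (by exact_mod_cast hn)
  linarith [Real.log_two_gt_d9]

theorem rounds_le_log {n s d : ℕ} (hs : 2 ^ s ≤ n ^ d) :
    (s : ℝ) ≤ 2 * d * Real.log n := by
  have h1 : (s : ℝ) * Real.log 2 ≤ d * Real.log n := by
    rw [← Real.log_pow, ← Real.log_pow]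
    exact Real.log_le_log (by positivity) (by exact_mod_cast hs)
  have h2 : (s : ℝ) * (1 / 2) ≤ s * Real.log 2 := by
    gcongr
    linarith [Real.log_two_gt_d9]
  linarith

/-- The hypothesis `hm` absorbs the cost of perturbing. There are of order `log n` rounds, and as
`log n ≥ 1 / 2` for `n ≥ 2`, lower powers of the logarithm and constants are absorbed by higher
powers. -/
theorem time_budget {n m s d k X Y C₁ C₂ : ℕ} (hn : 2 ≤ n) (hs : 2 ^ s ≤ n ^ d)
    (hm : m ≤ C₂ * X + n * (C₂ * Y)) :
    ((k + 7 * m + C₁ * X + s * ((C₁ * Y + 48) * n + 12) : ℕ) : ℝ) ≤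
      ((2 * k + 14 * C₂ + C₁ + 2 * d * C₁ + 240 * d : ℕ) : ℝ) *
        (X + n * Real.log n * Y + n * Real.log n ^ 2) := by
  have hs' := rounds_le_log hs
  have hl := half_le_log hn
  set l := Real.log n
  have hn' : (2 : ℝ) ≤ n := by exact_mod_cast hn
  have hm' : (m : ℝ) ≤ C₂ * X + n * (C₂ * Y) := by exact_mod_cast hm
  have a1 : (1 : ℝ) ≤ 2 * (n * l ^ 2) := by nlinarith
  have a2 : (n : ℝ) * (C₂ * Y) ≤ n * (C₂ * Y) * (2 * l) :=
    le_mul_of_one_le_right (by positivity) (by linarith)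
  have a3 : (s : ℝ) * (C₁ * Y * n) ≤ 2 * d * l * (C₁ * Y * n) := by gcongr
  have a4 : (s : ℝ) * (48 * n + 12) ≤ 2 * d * l * (48 * n + 12) := by gcongr
  have a5 : (d : ℝ) * l * (48 * n + 12) ≤ d * l * (120 * (n * l)) := by
    gcongr
    nlinarith
  have a6 : (k : ℝ) ≤ k * (2 * (n * l ^ 2)) := le_mul_of_one_le_right (by positivity) a1
  have hX : (0 : ℝ) ≤ X := by positivity
  have hY : (0 : ℝ) ≤ n * l * Y := by positivity
  have hZ : (0 : ℝ) ≤ n * l ^ 2 := by positivity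
  calc ((k + 7 * m + C₁ * X + s * ((C₁ * Y + 48) * n + 12) : ℕ) : ℝ)
      = k + 7 * m + C₁ * X + (s * (C₁ * Y * n) + s * (48 * n + 12)) := by push_cast; ring
    _ ≤ k * (2 * (n * l ^ 2)) + 7 * (C₂ * X + n * (C₂ * Y) * (2 * l)) + C₁ * X +
          (2 * d * l * (C₁ * Y * n) + 2 * (d * l * (120 * (n * l)))) := by linarith
    _ = (7 * C₂ + C₁) * X + (14 * C₂ + 2 * d * C₁) * (n * l * Y) +
          (2 * k + 240 * d) * (n * l ^ 2) := by ring
    _ ≤ (2 * k + 14 * C₂ + C₁ + 2 * d * C₁ + 240 * d) * X +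
          (2 * k + 14 * C₂ + C₁ + 2 * d * C₁ + 240 * d) * (n * l * Y) +
          (2 * k + 14 * C₂ + C₁ + 2 * d * C₁ + 240 * d) * (n * l ^ 2) := by
        have p1 : (0 : ℝ) ≤ C₂ := by positivity
        have p2 : (0 : ℝ) ≤ C₁ := by positivity
        have p3 : (0 : ℝ) ≤ d * C₁ := by positivity
        have p4 : (0 : ℝ) ≤ d := by positivity
        have p5 : (0 : ℝ) ≤ k := by positivity
        refine add_le_add (add_le_add ?_ ?_) ?_
        · exact mul_le_mul_of_nonneg_right (by linarith) hX
        · exact mul_le_mul_of_nonneg_right (by linarith) hY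
        · exact mul_le_mul_of_nonneg_right (by linarith) hZ
    _ = _ := by push_cast; ring

/-- The total failure probability. -/
theorem failure_le {n m c k s N : ℕ} (hn : 2 ≤ n) (hk : k ≤ n * n) (hs : n ^ (c + 3) ≤ 2 ^ s)
    (hm : m ≤ n * n) (hN : N * n ^ (c + 5) ≤ n * n * m * (n ^ (c + 5)) ^ m) :
    (k : ENNReal) * (2 ^ s : ENNReal)⁻¹ + N * (((n ^ (c + 5)) ^ m : ℕ) : ENNReal)⁻¹ ≤
      ((n : ENNReal) ^ c)⁻¹ := by
  have hn0 : n ≠ 0 := by omega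
  -- Without ties the refinement fails with probability at most `n ^ 2 / n ^ (c + 3)`, and ties
  -- occur with probability at most `n ^ 4 / n ^ (c + 5)`. Both are `1 / n ^ (c + 1)`, and `n ≥ 2`
  -- absorbs the factor 2.
  have h1 : (k : ENNReal) * (2 ^ s : ENNReal)⁻¹ ≤ ((n ^ (c + 1) : ℕ) : ENNReal)⁻¹ := by
    have := natCast_mul_inv_le (a := k) (x := n ^ (c + 1)) (y := 2 ^ s) (by positivity)
      (by
        refine le_trans ?_ hs
        calc k * n ^ (c + 1) ≤ n * n * n ^ (c + 1) := by gcongr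
          _ = n ^ (c + 3) := by ring)
    simpa using this
  have h2 : (N : ENNReal) * (((n ^ (c + 5)) ^ m : ℕ) : ENNReal)⁻¹ ≤
      ((n ^ (c + 1) : ℕ) : ENNReal)⁻¹ := by
    refine natCast_mul_inv_le (by positivity) ?_
    refine le_of_mul_le_mul_left (a := n ^ 4) ?_ (by positivity)
    calc n ^ 4 * (N * n ^ (c + 1)) = N * n ^ (c + 5) := by ring
      _ ≤ n * n * m * (n ^ (c + 5)) ^ m := hN
      _ ≤ n * n * (n * n) * (n ^ (c + 5)) ^ m := by gcongr
      _ = n ^ 4 * (n ^ (c + 5)) ^ m := by ring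
  have h3 : ((2 : ℕ) : ENNReal) * ((n ^ (c + 1) : ℕ) : ENNReal)⁻¹ ≤ ((n ^ c : ℕ) : ENNReal)⁻¹ := by
    refine natCast_mul_inv_le (by positivity) ?_
    rw [pow_succ, mul_comm]
    gcongr
  calc _ ≤ ((n ^ (c + 1) : ℕ) : ENNReal)⁻¹ + ((n ^ (c + 1) : ℕ) : ENNReal)⁻¹ := add_le_add h1 h2
    _ = ((2 : ℕ) : ENNReal) * ((n ^ (c + 1) : ℕ) : ENNReal)⁻¹ := by push_cast; ring
    _ ≤ _ := by simpa using h3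

end estimates

/-! ## The algorithm -/

/-- The perturbation phase. -/
def shakeProg (c : ℕ) : Prog :=
  .seq (block (.const 2 1) (.const 3 1 :: (List.replicate (c + 5) (.op .mul 3 3 0) ++
    [.op .mul 4 0 0, .op .mul 4 4 3]))) (forLoop 1 shakeBody)

/-- The refinement phase. -/
def refineProg (c : ℕ) : Prog :=
  .seq .preprocess (.seq (block (.const 1 0) (.const 5 1 :: List.replicate (c + 3) (.op .mul 5 5 0)))
    (.loop 5 mainBody))

section phases

variable {D : DataStructure} {w n : ℕ} {G : CapGraph n} {L : List (Fin n × Fin n × ℕ)}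
  {K R T F : ℕ}

/-- Preprocessing is specified only on `Mem.input`, so the memories have to coincide exactly,
including the zeros beyond the listing. -/
theorem ShakeState.graphPart (hL : G.IsListing L) {σ : Mem} {ρ : Fin L.length → ℕ} {τ : Config}
    (h0 : σ.reg 0 = n) (h1 : σ.reg 1 = L.length) (ha : ∀ a ≤ 2, σ.arr a = (Mem.input L).arr a)
    (h : ShakeState L K R T σ 0 ρ τ) :
    τ.mem.graphPart = Mem.input (relist L (G.shake L K ρ)) := by
  have hreg : τ.mem.graphPart.reg = (Mem.input (relist L (G.shake L K ρ))).reg := by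
    funext i
    have e0 : τ.mem.reg 0 = n := (h.frame.1 0 (by simp)).trans h0
    have e1 : τ.mem.reg 1 = L.length := (h.frame.1 1 (by simp)).trans h1
    rcases i with _ | _ | i
    · simpa [Mem.graphPart, Mem.input] using e0
    · simpa [Mem.graphPart, Mem.input, relist] using e1
    · simp [Mem.graphPart, Mem.input]
  have harr : τ.mem.graphPart.arr = (Mem.input (relist L (G.shake L K ρ))).arr := by
    funext a i
    have e0 : τ.mem.arr 0 = (Mem.input L).arr 0 := (h.frame.2 0 (by simp)).trans (ha 0 (by simp))
    have e1 : τ.mem.arr 1 = (Mem.input L).arr 1 := (h.frame.2 1 (by simp)).trans (ha 1 (by simp))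
    rcases a with _ | _ | _ | a
    · simp [Mem.graphPart, e0, Mem.input, relist, Function.comp_def]
    · simp [Mem.graphPart, e1, Mem.input, relist, Function.comp_def]
    · rcases lt_or_ge i L.length with hi | hi
      · have e2 := (h.after ⟨i, hi⟩ (Nat.zero_le _)).1
        have e3 := hL.2.2 L[i] (List.getElem_mem _)
        have e4 := hL.noise_getElem ρ ⟨i, hi⟩
        simp only [Fin.getElem_fin] at e2 e4
        simp [Mem.graphPart, Mem.input, relist, e2, hi, hL.shake_cap, e3, e4]
      · have e2 := h.outside i hi
        simp [Mem.graphPart, Mem.input, relist, e2, hi]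
    · simp [Mem.graphPart, Mem.input]
  exact congrArg₂ Mem.mk hreg harr

/-- The successful outcomes. -/
def Success (G : CapGraph n) (T Q : ℕ) : Set (Option Config) :=
  {o | ∃ τ : Config, o = some τ ∧ τ.time ≤ T ∧ τ.queries ≤ Q ∧
    ∃ (S : CapGraph n) (L' : List (Fin n × Fin n × ℕ)),
      G.IsFlowEquivalentTree S ∧ S.IsListing L' ∧ τ.mem.Holds L'}

/-- Division by `K` is monotone, so the order of the perturbed values refines that of the original
ones, and chains that are good for `H` are good for `G`. -/
theorem RoundState.success {H : CapGraph n} {Inv : Mem → Prop} {lab : Fin n → Fin n}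
    {E : List (Fin n × Fin n × ℕ)} {τ : Config} {Q : ℕ} (hG : G.graph.Connected)
    (hH : H.graph.Connected) (hdiv : ∀ u v, u ≠ v → H.maxFlow u v / K = G.maxFlow u v)
    (h : RoundState H K R Inv lab E τ) (hlab : Function.Injective lab) (hT : τ.time + 1 ≤ T)
    (hQ : τ.queries ≤ Q) : some τ.tick ∈ Success G T Q := by
  have ht : TreeInv H.maxFlow G.maxFlow lab E :=
    ⟨h.tree.idem, fun e he => ⟨(h.tree.edge e he).1,
      (h.tree.edge e he).2.trans (hdiv _ _ (h.tree.edge e he).1)⟩, h.tree.count, h.tree.conn⟩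
  obtain ⟨a, b⟩ := ht.isFlowEquivalentTree hG hlab
    (fun u v x y huv hxy hle => by
      rw [← hdiv u v huv, ← hdiv x y hxy]
      exact Nat.div_le_div_right hle)
    H.maxFlow_self (fun u v huv => CapGraph.maxFlow_pos hH huv)
  exact ⟨τ.tick, rfl, hT, hQ, _, E, a, b, h.holds⟩

theorem refine_failure {H : CapGraph n} {Inv : Mem → Prop} {B P c s Q : ℕ} (hn : 2 ≤ n)
    (hG : G.graph.Connected) (hH : H.graph.Connected)
    (hdiv : ∀ u v, u ≠ v → H.maxFlow u v / K = G.maxFlow u v) (hties : H.NoTies)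
    (hw : 2 * n + 1 < 2 ^ w) (hfw : ∀ u v, H.maxFlow u v * n + n < 2 ^ w)
    (htw : n ^ (c + 3) < 2 ^ w) (hR : 2 * n ≤ R)
    (hans : Answers D.qry w H.maxFlow B Inv) {τ : Config}
    (hpre : ∃ σ k, D.pre.Halts w τ.mem.graphPart σ k ∧ k ≤ P ∧ Inv σ)
    (h0 : τ.mem.reg 0 = n) (h2 : τ.mem.reg 2 = 1) (h3 : τ.mem.reg 3 = R) (h4 : τ.mem.reg 4 = K)
    (ha3 : ∀ i, τ.mem.arr 3 i = 0) (ha4 : ∀ i, τ.mem.arr 4 i = 0) (hs1 : n ^ (c + 3) < 2 ^ s)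
    (hs2 : 2 ^ s ≤ 2 * n ^ (c + 3)) (hq : τ.queries + s * n ≤ Q)
    (hT : τ.time + P + s * ((B + 48) * n + 12) + (c + 7) ≤ T) (hF : T < F) :
    ((refineProg c).exec D w F τ).toOuterMeasure (Success G T Q)ᶜ ≤
      (n * n : ℕ) * (2 ^ s : ENNReal)⁻¹ := by
  obtain ⟨σ, k, hσ, hk, hinv⟩ := hpre
  have hr1 := Runs.preprocess hσ
  set τ₁ : Config := { τ with ds := σ, time := τ.time + 1 + k } with hτ₁
  have hr2 := Runs.block (D := D) (w := w) (.const 1 0)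
    (.const 5 1 :: List.replicate (c + 3) (.op .mul 5 5 0)) τ₁
  have hmem : steps w (.const 1 0 :: .const 5 1 :: List.replicate (c + 3) (.op .mul 5 5 0))
      τ₁.mem = ((τ.mem.setReg 1 0).setReg 5 1).setReg 5 (n ^ (c + 3)) := by
    have e : Instr.step w (.const 5 1) (Instr.step w (.const 1 0) τ.mem) =
        (τ.mem.setReg 1 0).setReg 5 1 := by
      simp only [Instr.step, Nat.zero_mod]
      rw [Nat.mod_eq_of_lt (by omega)]
    change steps w (List.replicate (c + 3) (.op .mul 5 5 0))
      (Instr.step w (.const 5 1) (Instr.step w (.const 1 0) τ.mem)) = _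
    rw [e, steps_power (x := n) (y := 1) (by simp) _ _ (by simp [Mem.setReg, h0]) (by omega)
      (by simp [Mem.setReg]) (by simpa using htw), one_mul]
  rw [hmem] at hr2
  have htime : τ₁.time = τ.time + 1 + k := rfl
  rw [refineProg, Prog.exec, hr1.exec_andThen (by omega), Prog.exec,
    hr2.exec_andThen (by simp only [List.length_cons, List.length_replicate]; omega), Prog.exec]
  -- In blank arrays all nodes carry the label 0: there is a single class and no edge.
  have hst : RoundState H K R Inv (fun _ => ⟨0, by omega⟩) [] ⟨((τ.mem.setReg 1 0).setReg 5
      1).setReg 5 (n ^ (c + 3)), τ₁.ds, τ₁.time + ((Instr.const 5 1 :: List.replicate (c + 3)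
        (.op .mul 5 5 0)).length + 1), τ₁.queries⟩ := by
    refine ⟨by simp [Mem.setReg, h2], by simp [Mem.setReg, h3], by simp [Mem.setReg, h4],
      fun v => ha3 v, fun v => ha4 v, hinv, ⟨by simp [Mem.setReg, h0], by simp [Mem.setReg],
        by simp⟩, TreeInv.init _ _ _⟩
  refine (main_loop hH hties (by omega) hw hfw hans hR (by omega) (T := T) (Q := Q) ?_ hF s F _ _ _
    (n ^ (c + 3)) ?_ hst (by simp [Mem.setReg]) hs1 (by omega) htw ?_ hq).trans ?_
  · intro lab E τ' h1 h5 h6 h7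
    exact fun hc => hc (h1.success hG hH hdiv h5 h6 h7)
  · have : s ≤ s * ((B + 48) * n + 12) := Nat.le_mul_of_pos_right _ (by omega)
    omega
  · simp only [List.length_cons, List.length_replicate]
    omega
  · gcongr
    exact_mod_cast collisions_le _

theorem shake_failure (hn : 2 ≤ n) (hL : G.IsListing L) {c : ℕ} {S : Set (Option Config)}
    {β : (Fin L.length → ℕ) → ENNReal} {h : Config → PMF (Option Config)}
    (hmw : L.length < 2 ^ w) (hw : ∀ u v, n ^ (c + 7) * G.cap u v + n ^ (c + 5) ≤ 2 ^ w)
    (hKw : n ^ (c + 7) < 2 ^ w) (hT : 7 * L.length + (c + 11) ≤ T) (hF : T < F)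
    (hβ : ∀ ρ τ, (∀ j, ρ j < n ^ (c + 5)) → τ.mem.graphPart =
      Mem.input (relist L (G.shake L (n ^ (c + 7)) ρ)) → τ.mem.reg 0 = n → τ.mem.reg 2 = 1 →
      τ.mem.reg 3 = n ^ (c + 5) → τ.mem.reg 4 = n ^ (c + 7) → (∀ i, τ.mem.arr 3 i = 0) →
      (∀ i, τ.mem.arr 4 i = 0) → τ.queries = 0 → τ.time ≤ T →
      (h τ).toOuterMeasure S ≤ β ρ) :
    (andThen ((shakeProg c).exec D w F (Config.start L)) h).toOuterMeasure S ≤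
      (((n ^ (c + 5) : ℕ) : ENNReal) ^ L.length)⁻¹ *
        ∑ ρ : Fin L.length → Fin (n ^ (c + 5)), β fun j => ρ j := by
  have hn0 : 0 < n := by omega
  have hRK : n ^ (c + 5) ≤ n ^ (c + 7) := Nat.pow_le_pow_right hn0 (by omega)
  have hnn : n * n ≤ n ^ (c + 7) := by
    rw [← sq]; exact Nat.pow_le_pow_right hn0 (by omega)
  have h1w : 1 < 2 ^ w := by nlinarith
  have hr := Runs.block (D := D) (w := w) (.const 2 1) (.const 3 1 ::
    (List.replicate (c + 5) (.op .mul 3 3 0) ++ [.op .mul 4 0 0, .op .mul 4 4 3])) (Config.start L)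
  set σ := ((((((Mem.input L).setReg 2 1).setReg 3 1).setReg 3 (n ^ (c + 5))).setReg 4
    (n * n)).setReg 4 (n ^ (c + 7))) with hσ
  have hmem : steps w (.const 2 1 :: .const 3 1 :: (List.replicate (c + 5) (.op .mul 3 3 0) ++
      [.op .mul 4 0 0, .op .mul 4 4 3])) (Config.start L).mem = σ := by
    have e1 : Instr.step w (.const 3 1) (Instr.step w (.const 2 1) (Mem.input L)) =
        ((Mem.input L).setReg 2 1).setReg 3 1 := by
      simp only [Instr.step]
      rw [Nat.mod_eq_of_lt h1w]
    change steps w (List.replicate (c + 5) (.op .mul 3 3 0) ++ [.op .mul 4 0 0, .op .mul 4 4 3])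
      (Instr.step w (.const 3 1) (Instr.step w (.const 2 1) (Mem.input L))) = σ
    rw [e1, steps_append, steps_power (x := n) (y := 1) (by simp) _ _
      (by simp [Mem.setReg, Mem.input]) hn0 (by simp [Mem.setReg])
      (by rw [one_mul]; omega), one_mul]
    have e2 : n * n * n ^ (c + 5) = n ^ (c + 7) := by ring
    simp [steps, Instr.step, Op.eval, Mem.setReg, Mem.input, hσ,
      Nat.mod_eq_of_lt (hnn.trans_lt hKw), e2, Nat.mod_eq_of_lt hKw]
  rw [hmem] at hr
  have hr3 := Runs.instr (D := D) (w := w) (.op .mul 7 1 2) ⟨σ, (Config.start L).ds,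
    (Config.start L).time + ((Instr.const 3 1 :: (List.replicate (c + 5) (.op .mul 3 3 0) ++
      [.op .mul 4 0 0, .op .mul 4 4 3])).length + 1), (Config.start L).queries⟩
  have hmem3 : Instr.step w (.op .mul 7 1 2) σ = σ.setReg 7 L.length := by
    simp [Instr.step, Op.eval, hσ, Mem.setReg, Mem.input, Nat.mod_eq_of_lt hmw]
  dsimp only at hr3
  rw [hmem3] at hr3
  have hst : ShakeState L (n ^ (c + 7)) (n ^ (c + 5)) T σ L.length (fun _ => 0)
      ⟨σ.setReg 7 L.length, Mem.blank, c + 10, 0⟩ := by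
    refine ⟨by simp [Mem.setReg], Frame.refl.setReg (by simp), fun j _ => ?_, fun j hj => ?_,
      fun j hj => ?_, rfl, ?_⟩
    · simp [Mem.setReg, Mem.input, hσ]
    · exact absurd j.2 (by omega)
    · simp [Mem.setReg, Mem.input, hσ, hj]
    · dsimp only; omega
  have hloop := shake_loop (D := D) (w := w) (K := n ^ (c + 7)) (R := n ^ (c + 5)) (T := T)
    (F := F) (σ := σ) (h := h) (S := S) (β := fun ρ => β ρ) (L := L) (by simp [hσ, Mem.setReg])
    (by simp [hσ, Mem.setReg]) (by simp [hσ, Mem.setReg]) (by positivity)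
    (fun j => by rw [hL.2.2 L[j] (List.getElem_mem _)]; exact hw _ _) hmw hF
    (fun ρ τ hτ => ?_) L.length F _ _ (by omega) le_rfl hst
  · simp only [Fin.is_lt, dite_true] at hloop
    rw [shakeProg, Prog.exec, andThen_assoc, hr.exec_andThen ?_, forLoop, Prog.exec, andThen_assoc,
      hr3.exec_andThen ?_]
    · have e : (Config.start L).time + ((Instr.const 3 1 :: (List.replicate (c + 5)
          (.op .mul 3 3 0) ++ [.op .mul 4 0 0, .op .mul 4 4 3])).length + 1) + 1 = c + 10 := by
        simp [Config.start]
      simp only [Config.tick, e]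
      exact hloop
    · simp [Config.start, Config.tick]; omega
    · simp [Config.start]; omega
  · refine hβ ρ τ.tick (fun j => (hτ.after j (Nat.zero_le _)).2) ?_ ?_ ?_ ?_ ?_ ?_ ?_ hτ.queries ?_
    · exact ShakeState.graphPart (σ := σ) (τ := τ) hL (by simp [hσ, Mem.setReg, Mem.input])
        (by simp [hσ, Mem.setReg, Mem.input]) (fun a _ => rfl) hτ
    · exact (hτ.frame.1 0 (by simp)).trans (by simp [hσ, Mem.setReg, Mem.input])
    · exact (hτ.frame.1 2 (by simp)).trans (by simp [hσ, Mem.setReg])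
    · exact (hτ.frame.1 3 (by simp)).trans (by simp [hσ, Mem.setReg])
    · exact (hτ.frame.1 4 (by simp)).trans (by simp [hσ, Mem.setReg])
    · intro i
      change τ.mem.arr 3 i = 0
      rw [hτ.frame.2 3 (by simp)]; simp [hσ, Mem.setReg, Mem.input]
    · intro i
      change τ.mem.arr 4 i = 0
      rw [hτ.frame.2 4 (by simp)]; simp [hσ, Mem.setReg, Mem.input]
    · have := hτ.time
      simp only [Config.tick]; omega

end phases

end FlowTree

/-! ### Choice of the parameters and conclusion. -/

theorem theorem5p1 (c : ℕ) :
    ∃ A : Prog,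
      ∀ (F : ∀ n, Set (CapGraph n)), ClosedUnderPerturbation F →
      ∀ (D : DataStructure) (tp tmf : ℕ → ℕ), D.AnswersMaxFlow F tp tmf →
      ∀ b : ℕ, ∃ κ C : ℕ,
        ∀ n : ℕ, 2 ≤ n → ∀ G ∈ F n, G.graph.Connected → (∀ u v, G.cap u v ≤ n ^ b) →
        ∀ L : List (Fin n × Fin n × ℕ), G.IsListing L → ∀ w : ℕ, n ^ κ ≤ 2 ^ w →
          ∃ fuel : ℕ,
            1 - ((n : ENNReal) ^ c)⁻¹ ≤
              (A.exec D w fuel (Config.start L)).toOuterMeasure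
                {o | ∃ τ : Config, o = some τ ∧
                  (τ.time : ℝ) ≤ C * (tp G.numEdges + n * Real.log n * tmf G.numEdges
                    + n * Real.log n ^ 2) ∧
                  (τ.queries : ℝ) ≤ C * (n * Real.log n) ∧
                  ∃ (T : CapGraph n) (L' : List (Fin n × Fin n × ℕ)),
                    G.IsFlowEquivalentTree T ∧ T.IsListing L' ∧ τ.mem.Holds L'} := by
  classical
  refine ⟨.seq (shakeProg c) (refineProg c), fun F hF D tp tmf hD b => ?_⟩
  -- Perturbed capacities are at most `K * n ^ b + R ≤ 2 * n ^ (b + c + 7) ≤ n ^ (b + c + 8)`.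
  obtain ⟨κ₁, C₁, hD₁⟩ := hD (b + c + 8)
  obtain ⟨κ₂, C₂, hD₂⟩ := lowerBound hF hD b
  -- The exponent covers both demands on the word size as well as the table keys, which are below `n
  -- ^ (b + c + 12)`.
  refine ⟨κ₁ + κ₂ + b + c + 20, 2 * (2 * c + 18) + 14 * C₂ + C₁ + 2 * (c + 4) * C₁ + 240 * (c + 4),
    fun n hn G hGF hG hcap L hL w hw => ?_⟩
  have hn0 : 0 < n := by omega
  have hpow : ∀ d, d ≤ κ₁ + κ₂ + b + c + 20 → n ^ d ≤ 2 ^ w := fun d hd =>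
    (Nat.pow_le_pow_right hn0 hd).trans hw
  have hdouble : ∀ d, 2 * n ^ d ≤ n ^ (d + 1) := fun d => by
    rw [pow_succ, mul_comm]; exact Nat.mul_le_mul_left _ hn
  have hlt : ∀ d, d < κ₁ + κ₂ + b + c + 20 → n ^ d < 2 ^ w := fun d hd =>
    (Nat.pow_lt_pow_right (by omega) hd).trans_le hw
  have hlen := hL.length_eq
  have hmn : L.length ≤ n * n := hlen ▸ G.numEdges_le
  set m := G.numEdges with hm
  -- With this `R`, the `n ^ 4` triples of two nodes and an edge cause a tie with probability at
  -- most `1 / n ^ (c + 1)`. The scale is `K = n * n * R`, so the noise of a cut stays below `K`;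
  -- and `s` is the number of binary digits of `n ^ (c + 3)`.
  set R := n ^ (c + 5) with hR
  set K := n ^ (c + 7) with hK
  set s := Nat.log 2 (n ^ (c + 3)) + 1 with hs
  have hs1 : n ^ (c + 3) < 2 ^ s := Nat.lt_pow_succ_log_self (by norm_num) _
  have hs2 : 2 ^ s ≤ 2 * n ^ (c + 3) := by
    rw [hs, pow_succ, mul_comm]
    exact Nat.mul_le_mul_left _ (Nat.pow_log_le_self 2 (by positivity))
  have hs3 : 2 ^ s ≤ n ^ (c + 4) := hs2.trans (hdouble _)
  have hR0 : 0 < R := by positivity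
  have hRK : n * n * R = K := by rw [hR, hK]; ring
  have hRK' : R ≤ K := by rw [hR, hK]; exact Nat.pow_le_pow_right hn0 (by omega)
  have h2R : 2 * n ≤ R := by
    have h1 := hdouble 1
    rw [pow_one] at h1
    exact h1.trans (Nat.pow_le_pow_right hn0 (by omega))
  have hcapw : ∀ u v, K * G.cap u v + R ≤ n ^ (b + c + 8) := fun u v => by
    have e1 : K * G.cap u v ≤ n ^ (b + c + 7) := by
      calc K * G.cap u v ≤ n ^ (c + 7) * n ^ b := by rw [hK]; gcongr; exact hcap u v
        _ = n ^ (b + c + 7) := by ring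
    have e2 : R ≤ n ^ (b + c + 7) := Nat.pow_le_pow_right hn0 (by omega)
    have e3 : 2 * n ^ (b + c + 7) ≤ n ^ (b + c + 8) := hdouble (b + c + 7)
    omega
  set T := 2 * c + 18 + 7 * m + C₁ * tp m + s * ((C₁ * tmf m + 48) * n + 12) with hT
  refine ⟨T + 1, le_trans ?_ (MeasureTheory.measure_mono (μ := (Prog.exec D w (T + 1) _
    (Config.start L)).toOuterMeasure) (s := Success G T (s * n)) ?_)⟩
  · refine tsub_le_iff_left.2 ((one_le_add_compl _ (Success G T (s * n))).trans
      ((add_comm _ _).trans_le (add_le_add_left ?_ _)))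
    rw [Prog.exec]
    set k := n * n
    -- Perturbations with ties are charged as certain failures.
    refine (shake_failure (β := fun ρ => if (G.shake L K ρ).NoTies then
        (k : ENNReal) * (2 ^ s : ENNReal)⁻¹ else 1) (T := 7 * m + (c + 11)) hn hL ?_ ?_ ?_ ?_ ?_
        ?_).trans ?_
    · have := hlt 2 (by omega)
      rw [sq] at this
      omega
    · exact fun u v => (hcapw u v).trans (hpow _ (by omega))
    · exact hlt _ (by omega)
    · rw [hlen]
    · omega
    · intro ρ τ hρ hgp h0 h2 h3 h4 ha3 ha4 hq ht
      split_ifs with hties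
      · have hgraph : (G.shake L K ρ).graph = G.graph := CapGraph.perturb_graph (by omega)
        have hedges : (G.shake L K ρ).numEdges = m := CapGraph.perturb_numEdges (by omega)
        have hcap' : ∀ u v, (G.shake L K ρ).cap u v ≤ n ^ (b + c + 8) := fun u v => by
          rw [hL.shake_cap]
          have := hL.noise_lt hR0 hρ u v
          have := hcapw u v
          omega
        have hH : (G.shake L K ρ).graph.Connected := by rw [hgraph]; exact hG
        obtain ⟨Inv, hpre, hans⟩ := hD₁ n hn (G.shake L K ρ) (hF n G hGF K _
          (CapGraph.noise_comm L ρ) fun u v => (hL.noise_lt hR0 hρ u v).trans_le hRK') hH hcap'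
          (relist L (G.shake L K ρ)) (hL.relist hgraph) w (hpow _ (by omega))
        rw [hedges] at hpre hans
        refine refine_failure (P := C₁ * tp m) hn hG hH (fun u v huv => CapGraph.perturb_maxFlow_div hn0
          (hL.noise_lt hR0 hρ) hRK.le huv) hties ?_ ?_ ?_ h2R hans ?_ h0 h2 h3 h4 ha3 ha4 hs1 hs2
          ?_ ?_ ?_
        · have h1 := hdouble 1
          have h2 := hdouble 2
          have h3 := hlt 3 (by omega)
          simp only [pow_one] at h1
          have : 4 ≤ n ^ 2 := by nlinarith
          have e : n ^ (1 + 1) = n ^ 2 := rfl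
          have e' : n ^ (2 + 1) = n ^ 3 := rfl
          omega
        · intro u v
          have h1 := (G.shake L K ρ).maxFlow_le hcap' u v
          have e1 : (G.shake L K ρ).maxFlow u v * n ≤ n ^ (b + c + 11) := by
            calc _ ≤ n * n * n ^ (b + c + 8) * n := by gcongr
              _ = n ^ (b + c + 11) := by ring
          have e2 : n ≤ n ^ (b + c + 11) := Nat.le_self_pow (by omega) _
          have := hdouble (b + c + 11)
          have := hlt (b + c + 11 + 1) (by omega)
          omega
        · exact hlt _ (by omega)
        · rw [hgp]; exact hpre
        · omega
        · omega
        · omega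
      · exact toOuterMeasure_le_one _ _
    · refine (average_le hR0.ne' (fun ρ : Fin L.length → Fin R =>
        (G.shake L K fun j => ρ j).NoTies) _).trans ?_
      exact failure_le hn le_rfl hs1.le hmn (hL.card_not_noTies hG K R)
  · rintro o ⟨τ, rfl, h1, h2, h3⟩
    refine ⟨τ, rfl, ?_, ?_, h3⟩
    · refine le_trans (by exact_mod_cast h1) (time_budget (k := 2 * c + 18) hn hs3
        (hD₂ n hn G hGF hG hcap L hL w (hpow _ (by omega))))
    · have h4 := rounds_le_log hs3
      have h5 := half_le_log hn
      have h6 : (τ.queries : ℝ) ≤ s * n := by exact_mod_cast h2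
      calc (τ.queries : ℝ) ≤ 2 * (c + 4 : ℕ) * Real.log n * n := h6.trans (by gcongr)
        _ = (2 * (c + 4) : ℕ) * (n * Real.log n) := by push_cast; ring
        _ ≤ _ := by
          gcongr
          omega
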